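/- **Setting.** Let $m\ge 2$ and let $F\in \mathrm{GL}_m(\mathbb C)$ satisfy $\mathrm{Tr}(F^*F)=\mathrm{Tr}((F^*F)^{-1})$. For a matrix $U=(u_{ij})$ over a $*$-algebra put $\bar U=(u_{ij}^*)_{i,j}$. Let $\mathbb C[U_F^+]$ be the universal unital $*$-algebra with generators $u_{ij}$, $1\le i,j\le m$, and relations saying that $U=(u_{ij})$ and $F\bar UF^{-1}$ are unitary. It is a Hopf $*$-algebra with $\Delta(u_{ij})=\sum_k u_{ik}\otimes u_{kj}$, $\varepsilon(u_{ij})=\delta_{ij}$, $S(u_{ij})=u_{ji}^*$. Let $T$ be a compact abelian group with dual group $\hat T$, and let $\mathbb C[T]=\mathbb C\hat T$ be the group Hopf $*$-algebra of $\hat T$. Let $Z=(z_{ij})\in \mathrm{Mat}_m(\mathbb C[T])$ be a unitary corepresentation matrix (i.e. $Z$ is unitary, $\Delta(z_{ij})=\sum_k z_{ik}\otimes z_{kj}$ and $\varepsilon(z_{ij})=\delta_{ij}$) such that $F\bar ZF^{-1}$ is unitary. Let $\pi:\mathbb C[U_F^+]\to\mathbb C[T]$ be the Hopf $*$-algebra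 map with $\pi(u_{ij})=z_{ij}$. Let $\beta:\hat T\times\hat T\to\mathbb T$ be a bicharacter, extended to a bilinear form on $\mathbb C[T]$. **Transmutation.** Put $H=\mathbb C[U_F^+]$ and, for $a,b\in\hat T$, $H_{a,b}=\{x\in H:(\pi\otimes\iota)\Delta(x)=a\otimes x,\ (\iota\otimes\pi)\Delta(x)=x\otimes b\}$, so $H=\bigoplus_{a,b}H_{a,b}$. The transmutation $\mathbb C[U_F^+]_\beta$ is the coalgebra $H$ with product, involution and antipode determined by $$x\cdot_\beta y=\beta(a^{-1}b,c^{-1})\,xy,\qquad x^{*_\beta}=\beta(a^{-1}b,a^{-1})\,x^*,\qquad S_\beta(x)=\beta(a^{-1}b,b)\,S(x)$$ for $x\in H_{a,b}$, $y\in H_{c,d}$, and with the $\mathbb C[T]$-coaction $x\mapsto x_{(2)}\otimes\pi(S(x_{(1)})x_{(3)})$. **Braided notions.** Write coactions as $x\mapsto x^{(1)}\otimes x^{(2)}$. For $\mathbb C[T]$-comodule $*$-algebras $A,B$, the $*$-algebra $A\otimes_\beta B$ is $A\otimes B$ with $(a\otimes b)(a'\otimes b')=\beta(b^{(2)},a'^{(2)})\,aa'^{(1)}\otimes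 b^{(1)}b'$ and $(a\otimes b)^*=(1\otimes b^*)(a^*\otimes 1)$. A braided Hopf $*$-algebra over $(\mathbb C[T],\beta)$ is a $\mathbb C[T]$-comodule $*$-algebra $A$ with a coalgebra structure whose coproduct $A\to A\otimes_\beta A$ and counit $A\to\mathbb C$ are unital $*$-homomorphisms and $\mathbb C[T]$-comodule maps, and with an antipode that is a $\mathbb C[T]$-comodule map. For such $A$ and $m\times m$ corepresentation matrices $X$ of $\mathbb C[T]$ and $V$ of $A$, the pair $(X,V)$ defines an $A$-comodule if $\delta_V:\mathbb C^m\to\mathbb C^m\otimes A$, $\delta_V(e_j)=\sum_i e_i\otimes v_{ij}$, is a map of $\mathbb C[T]$-comodules, where $\mathbb C^m$ carries the coaction $\delta_X(e_j)=\sum_i e_i\otimes x_{ij}$ and $\mathbb C^m\otimes A$ the tensor product coaction. This $A$-comodule is unitary if the matrix $(\sum_k x_{ik}\otimes v_{kj})_{i,j}$ over $\mathbb C[T]\otimes_\beta A$ is unitary (here $\mathbb C[T]$ coacts on itself by its coproduct). It is unitarizable if $(GXG^{-1},GVG^{-1})$ defines a unitary $A$-comodule for some $G\in\mathrm{GL}_m(\mathbb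 C)$. For a matrix $U=(u_{ij})$ over a $*$-algebra put $$\bar U_Z=(\bar u_{ij}^Z)_{i,j},\qquad \bar u^Z_{ij}=\sum_{s,l,t}\beta(z_{tj}^*z_{sl},z_{il}^*)\,u_{st}^*.$$ A braided compact matrix quantum group over $(T,Z,\beta)$ with fundamental unitary $U=(u_{ij})$ is a braided Hopf $*$-algebra $A$ over $(\mathbb C[T],\beta)$, generated as a $*$-algebra by the entries $u_{ij}\in A$ of $U$, such that $(Z,U)$ defines a unitary $A$-comodule and $(\bar Z,\bar U_Z)$ defines a unitarizable $A$-comodule. **Proposition.** The transmutation $\mathbb C[U_F^+]_\beta$ is a braided compact matrix quantum group over $(T,Z,\beta)$ with fundamental unitary $U=(u_{ij})_{i,j}$. As a $*$-algebra, it is the universal unital $*$-algebra with generators $u_{ij}$ satisfying the relations $$U\quad\text{and}\quad F\bar U_ZF^{-1}\quad\text{are unitary.}$$ That is, these relations hold in $\mathbb C[U_F^+]_\beta$ (with respect to $\cdot_\beta$ and $*_\beta$), and for every unital complex $*$-algebra $B$ and every $V=(v_{ij})\in\mathrm{Mat}_m(B)$ such that $V$ and $F\bar V_ZF^{-1}$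 are unitary there is a unique unital $*$-homomorphism $\mathbb C[U_F^+]_\beta\to B$ mapping $u_{ij}$ to $v_{ij}$ for all $i,j$. -/

import Mathlib

set_option linter.unusedSimpArgs false
set_option linter.unusedSectionVars false

open scoped TensorProduct

noncomputable section

/-! ### The group Hopf star-algebra -/

namespace GroupAlg

variable {G : Type*} [Group G]

/-- The antilinear map `∑ c_g g ↦ ∑ conj(c_g) g⁻¹` on the group algebra. -/
def starHom (G : Type*) [Group G] : MonoidAlgebra ℂ G →+ MonoidAlgebra ℂ G :=
  MonoidAlgebra.liftNC
    ((MonoidAlgebra.singleAddHom (1 : G)).comp (starRingEnd ℂ : ℂ →+ ℂ))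
    (fun g => MonoidAlgebra.single g⁻¹ 1)

/-- The involution of the group algebra: group elements are unitary. -/
instance instStar : Star (MonoidAlgebra ℂ G) := ⟨starHom G⟩

theorem star_single (g : G) (c : ℂ) :
    star (MonoidAlgebra.single g c) = MonoidAlgebra.single g⁻¹ (star c) := by
  change starHom G _ = _
  simp [starHom, MonoidAlgebra.liftNC_single, MonoidAlgebra.single_mul_single]

theorem star_add' (x y : MonoidAlgebra ℂ G) : star (x + y) = star x + star y :=
  map_add (starHom G) x y

instance instStarRing : StarRing (MonoidAlgebra ℂ G) where
  star_involutive x := by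
    induction x using MonoidAlgebra.induction_linear with
    | zero => exact (congrArg star (map_zero (starHom G))).trans (map_zero (starHom G))
    | add f g hf hg => rw [star_add', star_add', hf, hg]
    | single a b => simp [star_single]
  star_mul x y := by
    induction x using MonoidAlgebra.induction_linear with
    | zero =>
      have h : star (0 : MonoidAlgebra ℂ G) = 0 := map_zero (starHom G)
      simp [h]
    | add f g hf hg => rw [add_mul, star_add', star_add', hf, hg, mul_add]
    | single a b =>
      induction y using MonoidAlgebra.induction_linear with
      | zero =>
        have h : star (0 : MonoidAlgebra ℂ G) = 0 := map_zero (starHom G)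
        simp [h]
      | add f g hf hg => rw [mul_add, star_add', star_add', hf, hg, add_mul]
      | single c d => simp [star_single, MonoidAlgebra.single_mul_single, mul_comm]
  star_add := star_add'

instance instStarModule : StarModule ℂ (MonoidAlgebra ℂ G) where
  star_smul c x := by
    induction x using MonoidAlgebra.induction_linear with
    | zero => simp
    | add f g hf hg => simp only [smul_add, star_add, hf, hg]
    | single a b => simp [star_single, MonoidAlgebra.smul_single]

end GroupAlg

/-! ### The free unital star-algebra on a set -/

/-- The opposite algebra with conjugated scalars; antilinear antihomomorphisms `A → A` are linear
homomorphisms `A → ConjOp A`. -/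
def ConjOp (A : Type*) := Aᵐᵒᵖ

namespace ConjOp

variable {A : Type*} [Ring A]

instance : Ring (ConjOp A) := inferInstanceAs (Ring Aᵐᵒᵖ)

instance [Algebra ℂ A] : Algebra ℂ (ConjOp A) :=
  RingHom.toAlgebra' ((algebraMap ℂ Aᵐᵒᵖ).comp (starRingEnd ℂ))
    (fun c x => Algebra.commutes (R := ℂ) (A := Aᵐᵒᵖ) (starRingEnd ℂ c) x)

/-- The identity map, as an additive equivalence. -/
def toA : ConjOp A ≃+ A := (MulOpposite.opAddEquiv (α := A)).symm

theorem toA_mul (x y : ConjOp A) : toA (x * y) = toA y * toA x := rfl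

theorem toA_one : toA (1 : ConjOp A) = 1 := rfl

theorem toA_algebraMap [Algebra ℂ A] (c : ℂ) :
    toA (algebraMap ℂ (ConjOp A) c) = algebraMap ℂ A (starRingEnd ℂ c) := rfl

end ConjOp

/-- The free unital complex star-algebra on `X`: the free algebra on the letters `x` (left copy of
`X`) and `x*` (right copy of `X`). -/
def FreeStarAlgebra (X : Type*) := FreeAlgebra ℂ (X ⊕ X)

namespace FreeStarAlgebra

variable {X : Type*}

instance : Ring (FreeStarAlgebra X) := inferInstanceAs (Ring (FreeAlgebra ℂ (X ⊕ X)))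

instance : Algebra ℂ (FreeStarAlgebra X) := inferInstanceAs (Algebra ℂ (FreeAlgebra ℂ (X ⊕ X)))

/-- The letters. -/
def letter (x : X ⊕ X) : FreeStarAlgebra X := FreeAlgebra.ι ℂ x

/-- The generators. -/
def of (x : X) : FreeStarAlgebra X := letter (Sum.inl x)

/-- Algebra homomorphisms out of the free star-algebra are given by images of the letters. -/
def liftAlg {B : Type*} [Ring B] [Algebra ℂ B] (f : X ⊕ X → B) : FreeStarAlgebra X →ₐ[ℂ] B :=
  FreeAlgebra.lift ℂ f

@[simp] theorem liftAlg_letter {B : Type*} [Ring B] [Algebra ℂ B] (f : X ⊕ X → B) (x : X ⊕ X) :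
    liftAlg f (letter x) = f x := FreeAlgebra.lift_ι_apply f x

theorem induction {P : FreeStarAlgebra X → Prop}
    (h0 : ∀ c : ℂ, P (algebraMap ℂ _ c)) (h1 : ∀ x, P (letter x))
    (h2 : ∀ a b, P a → P b → P (a * b)) (h3 : ∀ a b, P a → P b → P (a + b)) (a) : P a :=
  FreeAlgebra.induction ℂ (X ⊕ X) (motive := P) h0 h1 h2 h3 a

theorem algHom_ext {B : Type*} [Ring B] [Algebra ℂ B] {f g : FreeStarAlgebra X →ₐ[ℂ] B}
    (h : ∀ x, f (letter x) = g (letter x)) : f = g := by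
  ext a
  induction a using FreeStarAlgebra.induction with
  | h0 c => simp
  | h1 x => exact h x
  | h2 a b ha hb => rw [map_mul, map_mul, ha, hb]
  | h3 a b ha hb => rw [map_add, map_add, ha, hb]

/-- The involution as a homomorphism; it exchanges `x` and `x*`. -/
def starHom : FreeStarAlgebra X →ₐ[ℂ] ConjOp (FreeStarAlgebra X) :=
  liftAlg fun x => ConjOp.toA.symm (letter x.swap)

instance : Star (FreeStarAlgebra X) := ⟨fun a => ConjOp.toA (starHom a)⟩

theorem star_def (a : FreeStarAlgebra X) : star a = ConjOp.toA (starHom a) := rfl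

theorem star_letter (x : X ⊕ X) : star (letter x) = (letter x.swap : FreeStarAlgebra X) := by
  simp [star_def, starHom]

theorem star_algebraMap' (c : ℂ) : star (algebraMap ℂ (FreeStarAlgebra X) c) =
    algebraMap ℂ (FreeStarAlgebra X) (starRingEnd ℂ c) := by
  rw [star_def, AlgHom.commutes, ConjOp.toA_algebraMap]

theorem star_mul' (a b : FreeStarAlgebra X) : star (a * b) = star b * star a := by
  rw [star_def, map_mul, ConjOp.toA_mul]; rfl

theorem star_add' (a b : FreeStarAlgebra X) : star (a + b) = star a + star b := by
  rw [star_def, map_add, map_add]; rfl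

instance : StarRing (FreeStarAlgebra X) where
  star_involutive a := by
    induction a using FreeStarAlgebra.induction with
    | h0 c => rw [star_algebraMap', star_algebraMap', Complex.conj_conj]
    | h1 x => rw [star_letter, star_letter, Sum.swap_swap]
    | h2 a b ha hb => rw [star_mul', star_mul', ha, hb]
    | h3 a b ha hb => rw [star_add', star_add', ha, hb]
  star_mul := star_mul'
  star_add := star_add'

instance : StarModule ℂ (FreeStarAlgebra X) where
  star_smul c a := by
    rw [Algebra.smul_def, star_mul, star_algebraMap', Algebra.smul_def, Algebra.commutes]; rfl

theorem star_of (x : X) : star (of x) = letter (Sum.inr x) := star_letter _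

end FreeStarAlgebra

/-! ### Matrices over star-algebras -/

section Mat

variable {n : Type*} [Fintype n] [DecidableEq n]

/-- A scalar matrix, with entries viewed in the algebra `A`. -/
def scalarMat (A : Type*) [Ring A] [Algebra ℂ A] (F : Matrix n n ℂ) : Matrix n n A :=
  F.map (algebraMap ℂ A)

/-- The matrix `F V F⁻¹`. -/
def conjBy {A : Type*} [Ring A] [Algebra ℂ A] (F : GL n ℂ) (V : Matrix n n A) : Matrix n n A :=
  scalarMat A F.val * V * scalarMat A F⁻¹.val

/-- The matrix `Ū = (u_ij*)`, with no transposition. -/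
def barMat {A : Type*} [Star A] (U : Matrix n n A) : Matrix n n A := U.map star

variable {A B : Type*} [Ring A] [Algebra ℂ A] [Ring B] [Algebra ℂ B]

theorem scalarMat_mul (F G : Matrix n n ℂ) :
    scalarMat A (F * G) = scalarMat A F * scalarMat A G := by
  simp [scalarMat, Matrix.map_mul]

theorem scalarMat_one : scalarMat A (1 : Matrix n n ℂ) = 1 := by
  simp [scalarMat, Matrix.map_one]

theorem scalarMat_inv_mul (F : GL n ℂ) : scalarMat A F⁻¹.val * scalarMat A F.val = 1 := by
  rw [← scalarMat_mul, ← Units.val_mul, inv_mul_cancel, Units.val_one, scalarMat_one]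

theorem scalarMat_mul_inv (F : GL n ℂ) : scalarMat A F.val * scalarMat A F⁻¹.val = 1 := by
  rw [← scalarMat_mul, ← Units.val_mul, mul_inv_cancel, Units.val_one, scalarMat_one]

theorem conjBy_mul (F : GL n ℂ) (V W : Matrix n n A) :
    conjBy F V * conjBy F W = conjBy F (V * W) := by
  simp only [conjBy]
  calc _ = scalarMat A F.val * V * (scalarMat A F⁻¹.val * scalarMat A F.val) * W
          * scalarMat A F⁻¹.val := by simp only [mul_assoc]
    _ = _ := by rw [scalarMat_inv_mul, mul_one]; simp only [mul_assoc]

theorem conjBy_one (F : GL n ℂ) : conjBy F (1 : Matrix n n A) = 1 := by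
  rw [conjBy, mul_one, scalarMat_mul_inv]

theorem map_conjBy (f : A →ₐ[ℂ] B) (F : GL n ℂ) (V : Matrix n n A) :
    (conjBy F V).map f = conjBy F (V.map f) := by
  have h : ∀ G : Matrix n n ℂ, (scalarMat A G).map f = scalarMat B G := by
    intro G; ext i j; simp [scalarMat]
  rw [conjBy, Matrix.map_mul, Matrix.map_mul, h, h, conjBy]

theorem barMat_apply {A : Type*} [Star A] (U : Matrix n n A) (i j : n) :
    barMat U i j = star (U i j) := rfl

theorem star_scalarMat [StarRing A] [StarModule ℂ A] (F : Matrix n n ℂ) :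
    star (scalarMat A F) = scalarMat A (star F) := by
  ext i j
  exact (algebraMap_star_comm (F j i)).symm

theorem star_conjBy_barMat [StarRing A] [StarModule ℂ A] (F : GL n ℂ) (U : Matrix n n A) :
    star (conjBy F (barMat U)) =
      scalarMat A (star F⁻¹.val) * U.transpose * scalarMat A (star F.val) := by
  have h : star (barMat U) = U.transpose := by
    ext i j; simp [barMat, Matrix.star_apply]
  rw [conjBy, star_mul, star_mul, star_scalarMat, star_scalarMat, h, mul_assoc]

/-! ### The free unitary quantum group -/

variable (n) in
/-- The matrix of the generators of the free star-algebra. -/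
def genMat : Matrix n n (FreeStarAlgebra (n × n)) :=
  Matrix.of fun i j => FreeStarAlgebra.of (i, j)

/-- The defining relations of the free unitary quantum group: the matrices `U` and `F Ū F⁻¹` are
unitary, where `U` is the matrix of the generators. -/
inductive FreeUnitaryRel (F : GL n ℂ) :
    FreeStarAlgebra (n × n) → FreeStarAlgebra (n × n) → Prop
  | unit_right (i j : n) : FreeUnitaryRel F ((genMat n * star (genMat n)) i j)
      ((1 : Matrix n n (FreeStarAlgebra (n × n))) i j)
  | unit_left (i j : n) : FreeUnitaryRel F ((star (genMat n) * genMat n) i j)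
      ((1 : Matrix n n (FreeStarAlgebra (n × n))) i j)
  | conj_right (i j : n) : FreeUnitaryRel F
      ((conjBy F (barMat (genMat n)) * star (conjBy F (barMat (genMat n)))) i j)
      ((1 : Matrix n n (FreeStarAlgebra (n × n))) i j)
  | conj_left (i j : n) : FreeUnitaryRel F
      ((star (conjBy F (barMat (genMat n))) * conjBy F (barMat (genMat n))) i j)
      ((1 : Matrix n n (FreeStarAlgebra (n × n))) i j)

theorem FreeUnitaryRel.star_rel (F : GL n ℂ) (a b : FreeStarAlgebra (n × n))
    (h : FreeUnitaryRel F a b) : FreeUnitaryRel F (star a) (star b) := by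
  have key : ∀ (M : Matrix n n (FreeStarAlgebra (n × n))) (i j : n),
      star ((M * star M) i j) = (M * star M) j i := fun M i j => by
    rw [← Matrix.star_apply, star_mul, star_star]
  have key' : ∀ (M : Matrix n n (FreeStarAlgebra (n × n))) (i j : n),
      star ((star M * M) i j) = (star M * M) j i := fun M i j => by
    rw [← Matrix.star_apply, star_mul, star_star]
  have key1 : ∀ i j : n, star ((1 : Matrix n n (FreeStarAlgebra (n × n))) i j) =
      (1 : Matrix n n (FreeStarAlgebra (n × n))) j i := fun i j => by
    rw [← Matrix.star_apply, star_one]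
  cases h with
  | unit_right i j => rw [key, key1]; exact .unit_right j i
  | unit_left i j => rw [key', key1]; exact .unit_left j i
  | conj_right i j => rw [key, key1]; exact .conj_right j i
  | conj_left i j => rw [key', key1]; exact .conj_left j i

/-- The algebra `ℂ[U_F⁺]` of the free unitary quantum group: the universal unital star-algebra on
generators `u_ij` such that `U` and `F Ū F⁻¹` are unitary. -/
def FreeUnitary (F : GL n ℂ) := RingQuot (FreeUnitaryRel F)

namespace FreeUnitary

variable (F : GL n ℂ)

instance : Ring (FreeUnitary F) := inferInstanceAs (Ring (RingQuot (FreeUnitaryRel F)))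

instance : Algebra ℂ (FreeUnitary F) :=
  inferInstanceAs (Algebra ℂ (RingQuot (FreeUnitaryRel F)))

instance : StarRing (FreeUnitary F) :=
  RingQuot.starRing (FreeUnitaryRel F) (FreeUnitaryRel.star_rel F)

/-- The quotient map. -/
def mk : FreeStarAlgebra (n × n) →ₐ[ℂ] FreeUnitary F := RingQuot.mkAlgHom ℂ (FreeUnitaryRel F)

theorem mk_surjective : Function.Surjective (mk F) := RingQuot.mkAlgHom_surjective ℂ _

theorem mk_star (a : FreeStarAlgebra (n × n)) : mk F (star a) = star (mk F a) := by
  have h : ∀ b, RingQuot.mkAlgHom ℂ (FreeUnitaryRel F) b = ⟨Quot.mk _ b⟩ := fun b => by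
    rw [← AlgHom.coe_toRingHom, RingQuot.mkAlgHom_coe]
    simp [RingQuot.mkRingHom_def]
  exact (h (star a)).trans (congrArg (star : FreeUnitary F → FreeUnitary F) (h a)).symm

instance : StarModule ℂ (FreeUnitary F) where
  star_smul c a := by
    obtain ⟨a, rfl⟩ := mk_surjective F a
    rw [← map_smul, ← mk_star, star_smul, map_smul, mk_star]

/-- The fundamental unitary `U = (u_ij)`. -/
def U : Matrix n n (FreeUnitary F) := (genMat n).map (mk F)

variable {F}

theorem map_star_mat (M : Matrix n n (FreeStarAlgebra (n × n))) :
    (star M).map (mk F) = star (M.map (mk F)) := by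
  ext i j; simp [Matrix.star_apply, mk_star]

theorem map_barMat_mk (M : Matrix n n (FreeStarAlgebra (n × n))) :
    (barMat M).map (mk F) = barMat (M.map (mk F)) := by
  ext i j; simp [barMat, mk_star]

theorem mk_one_apply (i j : n) :
    mk F ((1 : Matrix n n (FreeStarAlgebra (n × n))) i j) =
      (1 : Matrix n n (FreeUnitary F)) i j := by
  by_cases h : i = j
  · subst h; simp
  · simp [h]

theorem U_mem : U F ∈ unitary (Matrix n n (FreeUnitary F)) := by
  rw [Unitary.mem_iff, U, ← map_star_mat, ← Matrix.map_mul, ← Matrix.map_mul]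
  constructor
  · ext i j
    refine (RingQuot.mkAlgHom_rel ℂ (FreeUnitaryRel.unit_left (F := F) i j)).trans ?_
    exact mk_one_apply i j
  · ext i j
    refine (RingQuot.mkAlgHom_rel ℂ (FreeUnitaryRel.unit_right (F := F) i j)).trans ?_
    exact mk_one_apply i j

theorem conj_mem : conjBy F (barMat (U F)) ∈ unitary (Matrix n n (FreeUnitary F)) := by
  rw [Unitary.mem_iff, U, ← map_barMat_mk, ← map_conjBy, ← map_star_mat, ← Matrix.map_mul,
    ← Matrix.map_mul]
  constructor
  · ext i j
    refine (RingQuot.mkAlgHom_rel ℂ (FreeUnitaryRel.conj_left (F := F) i j)).trans ?_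
    exact mk_one_apply i j
  · ext i j
    refine (RingQuot.mkAlgHom_rel ℂ (FreeUnitaryRel.conj_right (F := F) i j)).trans ?_
    exact mk_one_apply i j

section Lift

variable {B : Type*} [Ring B] [Algebra ℂ B]

/-- Algebra homomorphisms out of `ℂ[U_F⁺]`, in terms of the images `V` of `U` and `W` of `Ū`. -/
def liftAlg (V W : Matrix n n B) (h₁ : V * W.transpose = 1) (h₂ : W.transpose * V = 1)
    (h₃ : conjBy F W * (scalarMat B (star F⁻¹.val) * V.transpose * scalarMat B (star F.val)) = 1)
    (h₄ : (scalarMat B (star F⁻¹.val) * V.transpose * scalarMat B (star F.val)) * conjBy F W = 1) :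
    FreeUnitary F →ₐ[ℂ] B :=
  RingQuot.liftAlgHom ℂ
    ⟨FreeStarAlgebra.liftAlg (Sum.elim (fun p => V p.1 p.2) (fun p => W p.1 p.2)), by
      set f : FreeStarAlgebra (n × n) →ₐ[ℂ] B :=
        FreeStarAlgebra.liftAlg (Sum.elim (fun p => V p.1 p.2) (fun p => W p.1 p.2)) with hf
      have hV : (genMat n).map f = V := by
        ext i j; simp [genMat, hf, FreeStarAlgebra.of]
      have hW : (barMat (genMat n)).map f = W := by
        ext i j; simp [genMat, hf, barMat, FreeStarAlgebra.star_of]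
      have hW' : (star (genMat n)).map f = W.transpose := by
        ext i j; simp [genMat, hf, Matrix.star_apply, FreeStarAlgebra.star_of]
      have hc : ∀ G : Matrix n n ℂ,
          (scalarMat (FreeStarAlgebra (n × n)) G).map f = scalarMat B G := by
        intro G; ext i j; simp [scalarMat]
      have h1 : (1 : Matrix n n (FreeStarAlgebra (n × n))).map f = 1 := by
        simp [Matrix.map_one]
      have fin : ∀ (M : Matrix n n (FreeStarAlgebra (n × n))) (i j : n), M.map f = 1 →
          f (M i j) = f ((1 : Matrix n n (FreeStarAlgebra (n × n))) i j) := fun M i j h =>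
        (congrFun (congrFun h i) j).trans (congrFun (congrFun h1 i) j).symm
      rintro x y (⟨i, j⟩ | ⟨i, j⟩ | ⟨i, j⟩ | ⟨i, j⟩)
      · apply fin; rw [Matrix.map_mul, hV, hW', h₁]
      · apply fin; rw [Matrix.map_mul, hV, hW', h₂]
      · apply fin
        rw [Matrix.map_mul, map_conjBy, hW, star_conjBy_barMat, Matrix.map_mul, Matrix.map_mul,
          hc, hc, Matrix.transpose_map, hV, h₃]
      · apply fin
        rw [Matrix.map_mul, map_conjBy, hW, star_conjBy_barMat, Matrix.map_mul, Matrix.map_mul,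
          hc, hc, Matrix.transpose_map, hV, h₄]⟩

theorem liftAlg_U (V W : Matrix n n B) (h₁ h₂ h₃ h₄) (i j : n) :
    liftAlg (F := F) V W h₁ h₂ h₃ h₄ (U F i j) = V i j := by
  refine (RingQuot.liftAlgHom_mkAlgHom_apply ℂ _ _ _).trans ?_
  simp [genMat, FreeStarAlgebra.of]

theorem liftAlg_star_U (V W : Matrix n n B) (h₁ h₂ h₃ h₄) (i j : n) :
    liftAlg (F := F) V W h₁ h₂ h₃ h₄ (star (U F i j)) = W i j := by
  rw [U, Matrix.map_apply, ← mk_star]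
  refine (RingQuot.liftAlgHom_mkAlgHom_apply ℂ _ _ _).trans ?_
  simp [genMat, FreeStarAlgebra.star_of]

theorem induction {P : FreeUnitary F → Prop}
    (h0 : ∀ c : ℂ, P (algebraMap ℂ _ c)) (h1 : ∀ i j, P (U F i j)) (h1' : ∀ i j, P (star (U F i j)))
    (h2 : ∀ a b, P a → P b → P (a * b)) (h3 : ∀ a b, P a → P b → P (a + b)) (a) : P a := by
  obtain ⟨a, rfl⟩ := mk_surjective F a
  induction a using FreeStarAlgebra.induction with
  | h0 c => simpa using h0 c
  | h1 x =>
    rcases x with ⟨i, j⟩ | ⟨i, j⟩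
    · exact h1 i j
    · have := h1' i j
      rwa [U, Matrix.map_apply, ← mk_star, genMat, Matrix.of_apply, FreeStarAlgebra.star_of] at this
  | h2 a b ha hb => rw [map_mul]; exact h2 _ _ ha hb
  | h3 a b ha hb => rw [map_add]; exact h3 _ _ ha hb

theorem algHom_ext {f g : FreeUnitary F →ₐ[ℂ] B} (h : ∀ i j, f (U F i j) = g (U F i j))
    (h' : ∀ i j, f (star (U F i j)) = g (star (U F i j))) : f = g := by
  ext a
  induction a using FreeUnitary.induction with
  | h0 c => simp
  | h1 i j => exact h i j
  | h1' i j => exact h' i j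
  | h2 a b ha hb => rw [map_mul, map_mul, ha, hb]
  | h3 a b ha hb => rw [map_add, map_add, ha, hb]

variable [StarRing B] [StarModule ℂ B]

/-- The algebra homomorphism underlying `FreeUnitary.lift`. -/
def liftAux (V : Matrix n n B) (hV : V ∈ unitary (Matrix n n B))
    (hV' : conjBy F (barMat V) ∈ unitary (Matrix n n B)) : FreeUnitary F →ₐ[ℂ] B :=
  liftAlg (F := F) V (barMat V) hV.2 hV.1
    ((congrArg _ (star_conjBy_barMat F V)).symm.trans hV'.2)
    ((congrArg (· * conjBy F (barMat V)) (star_conjBy_barMat F V)).symm.trans hV'.1)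

theorem liftAux_U (V : Matrix n n B) (hV hV') (i j : n) :
    liftAux (F := F) V hV hV' (U F i j) = V i j :=
  liftAlg_U V (barMat V) hV.2 hV.1
    ((congrArg _ (star_conjBy_barMat F V)).symm.trans hV'.2)
    ((congrArg (· * conjBy F (barMat V)) (star_conjBy_barMat F V)).symm.trans hV'.1) i j

theorem liftAux_star_U (V : Matrix n n B) (hV hV') (i j : n) :
    liftAux (F := F) V hV hV' (star (U F i j)) = star (V i j) :=
  liftAlg_star_U V (barMat V) hV.2 hV.1
    ((congrArg _ (star_conjBy_barMat F V)).symm.trans hV'.2)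
    ((congrArg (· * conjBy F (barMat V)) (star_conjBy_barMat F V)).symm.trans hV'.1) i j

/-- The universal property of `ℂ[U_F⁺]`. -/
def lift (V : Matrix n n B) (hV : V ∈ unitary (Matrix n n B))
    (hV' : conjBy F (barMat V) ∈ unitary (Matrix n n B)) : FreeUnitary F →⋆ₐ[ℂ] B :=
  { liftAux (F := F) V hV hV' with
    map_star' := fun a => by
      change liftAux V hV hV' (star a) = star (liftAux V hV hV' a)
      induction a using FreeUnitary.induction with
      | h0 c => rw [← algebraMap_star_comm, AlgHom.commutes, AlgHom.commutes, algebraMap_star_comm]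
      | h1 i j => rw [liftAux_U, liftAux_star_U]
      | h1' i j => rw [star_star, liftAux_U, liftAux_star_U, star_star]
      | h2 a b ha hb => rw [star_mul, map_mul, map_mul, star_mul, ha, hb]
      | h3 a b ha hb => rw [star_add, map_add, map_add, star_add, ha, hb] }

theorem lift_U (V : Matrix n n B) (hV hV') (i j : n) :
    lift (F := F) V hV hV' (U F i j) = V i j := liftAux_U V hV hV' i j

end Lift

end FreeUnitary

end Mat

namespace FreeUnitary

open Matrix

variable {n : Type*} [Fintype n] [DecidableEq n]

section

variable {A : Type*} [Ring A] [Algebra ℂ A] [StarRing A] [StarModule ℂ A]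
  {B : Type*} [Ring B] [Algebra ℂ B] [StarRing B] [StarModule ℂ B]

theorem map_mem_unitary (f : A →⋆ₐ[ℂ] B) {V : Matrix n n A} (hV : V ∈ unitary (Matrix n n A)) :
    V.map f ∈ unitary (Matrix n n B) := by
  have hs : star (V.map f) = (star V).map f := by
    ext i j; simp [Matrix.star_apply, map_star]
  have h1 : (1 : Matrix n n A).map f = 1 := by simp [Matrix.map_one]
  rw [Unitary.mem_iff, hs, ← Matrix.map_mul, ← Matrix.map_mul, hV.1, hV.2]
  exact ⟨h1, h1⟩

theorem map_conjBy_barMat_mem (f : A →⋆ₐ[ℂ] B) (F : GL n ℂ) {V : Matrix n n A}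
    (hV : conjBy F (barMat V) ∈ unitary (Matrix n n A)) :
    conjBy F (barMat (V.map f)) ∈ unitary (Matrix n n B) := by
  have h : barMat (V.map f) = (barMat V).map f := by
    ext i j; simp [barMat, map_star]
  have h' := map_conjBy (f : A →ₐ[ℂ] B) F (barMat V)
  rw [h]
  have := map_mem_unitary f hV
  rwa [show (conjBy F (barMat V)).map f = conjBy F ((barMat V).map f) from h'] at this

/-- The inclusion of the left tensor factor. -/
def inclL (A B : Type*) [Ring A] [Algebra ℂ A] [StarRing A] [StarModule ℂ A]
    [Ring B] [Algebra ℂ B] [StarRing B] [StarModule ℂ B] : A →⋆ₐ[ℂ] A ⊗[ℂ] B :=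
  { (Algebra.TensorProduct.includeLeft : A →ₐ[ℂ] A ⊗[ℂ] B) with
    map_star' := fun a => by simp }

/-- The inclusion of the right tensor factor. -/
def inclR (A B : Type*) [Ring A] [Algebra ℂ A] [StarRing A] [StarModule ℂ A]
    [Ring B] [Algebra ℂ B] [StarRing B] [StarModule ℂ B] : B →⋆ₐ[ℂ] A ⊗[ℂ] B :=
  { (Algebra.TensorProduct.includeRight : B →ₐ[ℂ] A ⊗[ℂ] B) with
    map_star' := fun a => by simp }

theorem inclL_apply (a : A) : inclL A B a = a ⊗ₜ[ℂ] 1 := rfl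

theorem inclR_apply (b : B) : inclR A B b = 1 ⊗ₜ[ℂ] b := rfl

/-- The matrix `(∑_k v_ik ⊗ w_kj)`. -/
def tensorMat {A B : Type*} [Ring A] [Algebra ℂ A] [Ring B] [Algebra ℂ B]
    (V : Matrix n n A) (W : Matrix n n B) : Matrix n n (A ⊗[ℂ] B) :=
  Matrix.of fun i j => ∑ k, V i k ⊗ₜ[ℂ] W k j

theorem tensorMat_eq (V : Matrix n n A) (W : Matrix n n B) :
    tensorMat V W = V.map (inclL A B) * W.map (inclR A B) := by
  ext i j
  simp [tensorMat, Matrix.mul_apply, inclL_apply, inclR_apply]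

theorem barMat_tensorMat (V : Matrix n n A) (W : Matrix n n B) :
    barMat (tensorMat V W) = (barMat V).map (inclL A B) * (barMat W).map (inclR A B) := by
  ext i j
  simp [tensorMat, barMat, Matrix.mul_apply, inclL_apply, inclR_apply]

theorem tensorMat_mem {V : Matrix n n A} {W : Matrix n n B} (hV : V ∈ unitary (Matrix n n A))
    (hW : W ∈ unitary (Matrix n n B)) : tensorMat V W ∈ unitary (Matrix n n (A ⊗[ℂ] B)) := by
  rw [tensorMat_eq]
  exact mul_mem (map_mem_unitary _ hV) (map_mem_unitary _ hW)

theorem conjBy_tensorMat_mem (F : GL n ℂ) {V : Matrix n n A} {W : Matrix n n B}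
    (hV : conjBy F (barMat V) ∈ unitary (Matrix n n A))
    (hW : conjBy F (barMat W) ∈ unitary (Matrix n n B)) :
    conjBy F (barMat (tensorMat V W)) ∈ unitary (Matrix n n (A ⊗[ℂ] B)) := by
  rw [barMat_tensorMat, ← conjBy_mul]
  have h1 := map_conjBy (inclL A B : A →ₐ[ℂ] A ⊗[ℂ] B) F (barMat V)
  have h2 := map_conjBy (inclR A B : B →ₐ[ℂ] A ⊗[ℂ] B) F (barMat W)
  have h3 := map_mem_unitary (inclL A B) hV
  have h4 := map_mem_unitary (inclR A B) hW
  exact mul_mem (h1 ▸ h3) (h2 ▸ h4)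

end

variable (F : GL n ℂ)

/-- The coproduct, as a star-homomorphism: `Δ(u_ij) = ∑_k u_ik ⊗ u_kj`. -/
def comulHom : FreeUnitary F →⋆ₐ[ℂ] FreeUnitary F ⊗[ℂ] FreeUnitary F :=
  lift (tensorMat (U F) (U F)) (tensorMat_mem U_mem U_mem)
    (conjBy_tensorMat_mem F conj_mem conj_mem)

/-- The counit, as a star-homomorphism: `ε(u_ij) = δ_ij`. -/
def counitHom : FreeUnitary F →⋆ₐ[ℂ] ℂ :=
  lift 1 (one_mem _) (by
    have h : barMat (1 : Matrix n n ℂ) = 1 := by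
      ext i j
      by_cases h : i = j
      · subst h; simp [barMat]
      · simp [barMat, h]
    rw [h, conjBy_one]
    exact one_mem _)

theorem comulHom_U (i j : n) : comulHom F (U F i j) = ∑ k, U F i k ⊗ₜ[ℂ] U F k j :=
  lift_U _ _ _ i j

theorem comulHom_star_U (i j : n) :
    comulHom F (star (U F i j)) = ∑ k, star (U F i k) ⊗ₜ[ℂ] star (U F k j) := by
  rw [map_star, comulHom_U]; simp

theorem counitHom_U (i j : n) : counitHom F (U F i j) = (1 : Matrix n n ℂ) i j :=
  lift_U _ _ _ i j

theorem counitHom_star_U (i j : n) :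
    counitHom F (star (U F i j)) = (1 : Matrix n n ℂ) i j := by
  rw [map_star, counitHom_U]
  by_cases h : i = j
  · subst h; simp
  · simp [h]

instance : Bialgebra ℂ (FreeUnitary F) :=
  Bialgebra.ofAlgHom (comulHom F : FreeUnitary F →ₐ[ℂ] FreeUnitary F ⊗[ℂ] FreeUnitary F)
    (counitHom F : FreeUnitary F →ₐ[ℂ] ℂ)
    (by
      apply algHom_ext <;> intro i j
      · simp [comulHom_U, TensorProduct.sum_tmul, TensorProduct.tmul_sum]
        exact Finset.sum_comm
      · simp [comulHom_star_U, TensorProduct.sum_tmul, TensorProduct.tmul_sum]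
        exact Finset.sum_comm)
    (by
      apply algHom_ext <;> intro i j
      · simp [comulHom_U, counitHom_U, Matrix.one_apply, TensorProduct.ite_tmul]
      · simp [comulHom_star_U, counitHom_star_U, Matrix.one_apply, TensorProduct.ite_tmul])
    (by
      apply algHom_ext <;> intro i j
      · simp [comulHom_U, counitHom_U, Matrix.one_apply, TensorProduct.tmul_ite]
      · simp [comulHom_star_U, counitHom_star_U, Matrix.one_apply, TensorProduct.tmul_ite])

theorem comul_apply (x : FreeUnitary F) : Coalgebra.comul (R := ℂ) x = comulHom F x := rfl

theorem counit_apply (x : FreeUnitary F) : Coalgebra.counit (R := ℂ) x = counitHom F x := rfl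

end FreeUnitary

section OpMat

variable {n : Type*} [Fintype n] {A : Type*} [Ring A] [Algebra ℂ A]

/-- A matrix with entries viewed in the opposite algebra. -/
def opMat (M : Matrix n n A) : Matrix n n Aᵐᵒᵖ := M.map MulOpposite.op

theorem opMat_mul (M N : Matrix n n A) :
    opMat M * opMat N = opMat (N.transpose * M.transpose).transpose := by
  ext i j
  simp [opMat, Matrix.mul_apply]

theorem scalar_mul_opMat (G : Matrix n n ℂ) (M : Matrix n n A) :
    scalarMat Aᵐᵒᵖ G * opMat M = opMat (scalarMat A G * M) := by
  ext i j
  simp only [opMat, Matrix.mul_apply, scalarMat, Matrix.map_apply, Finset.op_sum,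
    Algebra.commutes (R := ℂ) (A := A), MulOpposite.algebraMap_apply, MulOpposite.op_mul]

theorem opMat_mul_scalar (G : Matrix n n ℂ) (M : Matrix n n A) :
    opMat M * scalarMat Aᵐᵒᵖ G = opMat (M * scalarMat A G) := by
  ext i j
  simp only [opMat, Matrix.mul_apply, scalarMat, Matrix.map_apply, Finset.op_sum,
    ← Algebra.commutes (R := ℂ) (A := A), MulOpposite.algebraMap_apply, MulOpposite.op_mul]

theorem transpose_scalar_mul_mul (G K : Matrix n n ℂ) (M : Matrix n n A) :
    (scalarMat A G * M * scalarMat A K).transpose =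
      scalarMat A K.transpose * M.transpose * scalarMat A G.transpose := by
  ext i j
  simp only [Matrix.mul_apply, scalarMat, Matrix.transpose_apply, Matrix.map_apply,
    Finset.sum_mul]
  rw [Finset.sum_comm]
  refine Finset.sum_congr rfl fun x _ => Finset.sum_congr rfl fun y _ => ?_
  rw [Algebra.commutes (G j x) (M x y), mul_assoc (algebraMap ℂ A (K y i)), ← Algebra.commutes]

theorem opMat_one [DecidableEq n] : opMat (1 : Matrix n n A) = 1 := by
  simp [opMat, Matrix.map_one]

end OpMat

namespace FreeUnitary

variable {n : Type*} [Fintype n] [DecidableEq n] (F : GL n ℂ)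

/-- The matrix `(F*F)⁻¹ Uᵗ (F*F)` of the values of the antipode on the entries of `Ū`. -/
def antipodeBar : Matrix n n (FreeUnitary F) :=
  scalarMat _ F⁻¹.val * (scalarMat _ (star F⁻¹.val) * (U F).transpose * scalarMat _ (star F.val)) *
    scalarMat _ F.val

theorem scalarMat_star_mul_inv (A : Type*) [Ring A] [Algebra ℂ A] :
    scalarMat A (star F.val) * scalarMat A (star F⁻¹.val) = 1 := by
  rw [← scalarMat_mul, ← star_mul, ← Units.val_mul, inv_mul_cancel, Units.val_one, star_one,
    scalarMat_one]

theorem scalarMat_star_inv_mul (A : Type*) [Ring A] [Algebra ℂ A] :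
    scalarMat A (star F⁻¹.val) * scalarMat A (star F.val) = 1 := by
  rw [← scalarMat_mul, ← star_mul, ← Units.val_mul, mul_inv_cancel, Units.val_one, star_one,
    scalarMat_one]

theorem conjBy_antipodeBar : conjBy F (antipodeBar F) =
    scalarMat _ (star F⁻¹.val) * (U F).transpose * scalarMat _ (star F.val) := by
  rw [conjBy, antipodeBar]
  set K := scalarMat (FreeUnitary F) (star F⁻¹.val) * (U F).transpose *
    scalarMat (FreeUnitary F) (star F.val)
  calc _ = (scalarMat (FreeUnitary F) F.val * scalarMat _ F⁻¹.val) * K *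
        (scalarMat _ F.val * scalarMat _ F⁻¹.val) := by simp only [mul_assoc]
    _ = K := by rw [scalarMat_mul_inv, one_mul, mul_one]

theorem antipodeBar_mul : antipodeBar F * barMat (U F) = 1 := by
  have h := (conj_mem (F := F)).1
  rw [star_conjBy_barMat, conjBy] at h
  rw [antipodeBar]
  set K := scalarMat (FreeUnitary F) (star F⁻¹.val) * (U F).transpose *
    scalarMat (FreeUnitary F) (star F.val)
  calc _ = scalarMat _ F⁻¹.val * (K * (scalarMat _ F.val * barMat (U F) * scalarMat _ F⁻¹.val)) *
        scalarMat _ F.val := by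
        simp only [mul_assoc]
        rw [scalarMat_inv_mul, mul_one]
    _ = 1 := by rw [h, mul_one, scalarMat_inv_mul]

theorem mul_antipodeBar : barMat (U F) * antipodeBar F = 1 := by
  have h := (conj_mem (F := F)).2
  rw [star_conjBy_barMat, conjBy] at h
  rw [antipodeBar]
  set K := scalarMat (FreeUnitary F) (star F⁻¹.val) * (U F).transpose *
    scalarMat (FreeUnitary F) (star F.val)
  calc _ = scalarMat _ F⁻¹.val * (scalarMat _ F.val * barMat (U F) * scalarMat _ F⁻¹.val * K) *
        scalarMat _ F.val := by
        simp only [← mul_assoc]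
        rw [scalarMat_inv_mul, one_mul]
    _ = 1 := by rw [h, mul_one, scalarMat_inv_mul]

theorem transpose_star_U : (star (U F)).transpose = barMat (U F) := by
  ext i j; simp [barMat, Matrix.star_apply]

theorem scalarMat_transpose_mul (A : Type*) [Ring A] [Algebra ℂ A] :
    scalarMat A (star F⁻¹.val).transpose * scalarMat A (star F.val).transpose = 1 := by
  rw [← scalarMat_mul, ← Matrix.transpose_mul, ← star_mul, ← Units.val_mul, inv_mul_cancel,
    Units.val_one, star_one, Matrix.transpose_one, scalarMat_one]

theorem scalarMat_transpose_mul' (A : Type*) [Ring A] [Algebra ℂ A] :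
    scalarMat A (star F.val).transpose * scalarMat A (star F⁻¹.val).transpose = 1 := by
  rw [← scalarMat_mul, ← Matrix.transpose_mul, ← star_mul, ← Units.val_mul, mul_inv_cancel,
    Units.val_one, star_one, Matrix.transpose_one, scalarMat_one]

theorem antipode_aux {M N : Matrix n n (FreeUnitary F)} (h : M * N = 1) :
    (scalarMat _ (star F⁻¹.val) * M.transpose * scalarMat _ (star F.val)).transpose *
      (scalarMat _ (star F⁻¹.val) * N.transpose * scalarMat _ (star F.val)).transpose = 1 := by
  rw [transpose_scalar_mul_mul, transpose_scalar_mul_mul, Matrix.transpose_transpose,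
    Matrix.transpose_transpose]
  set a := scalarMat (FreeUnitary F) (star F⁻¹.val).transpose with ha
  set b := scalarMat (FreeUnitary F) (star F.val).transpose with hb
  have hab : a * b = 1 := scalarMat_transpose_mul F _
  have hba : b * a = 1 := scalarMat_transpose_mul' F _
  calc _ = b * M * (a * b) * N * a := by simp only [mul_assoc]
    _ = b * (M * N) * a := by rw [hab, mul_one]; simp only [mul_assoc]
    _ = 1 := by rw [h, mul_one, hba]

/-- The antipode as a homomorphism to the opposite algebra: `S(u_ij) = u_ji*`, and the matrix
`(S(u_ij*))` is `(F*F)⁻¹ Uᵗ (F*F)`. -/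
def antipodeHom : FreeUnitary F →ₐ[ℂ] (FreeUnitary F)ᵐᵒᵖ :=
  liftAlg (opMat (star (U F))) (opMat (antipodeBar F))
    (by
      have h : (opMat (antipodeBar F)).transpose = opMat (antipodeBar F).transpose := rfl
      rw [h, opMat_mul, Matrix.transpose_transpose, transpose_star_U, antipodeBar_mul,
        Matrix.transpose_one, opMat_one])
    (by
      have h : (opMat (antipodeBar F)).transpose = opMat (antipodeBar F).transpose := rfl
      rw [h, opMat_mul, Matrix.transpose_transpose, transpose_star_U, mul_antipodeBar,
        Matrix.transpose_one, opMat_one])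
    (by
      have h : (opMat (star (U F))).transpose = opMat (star (U F)).transpose := rfl
      rw [h, conjBy, scalar_mul_opMat, opMat_mul_scalar, scalar_mul_opMat, opMat_mul_scalar,
        ← conjBy, conjBy_antipodeBar, opMat_mul, antipode_aux F U_mem.1, Matrix.transpose_one,
        opMat_one])
    (by
      have h : (opMat (star (U F))).transpose = opMat (star (U F)).transpose := rfl
      rw [h, conjBy, scalar_mul_opMat, opMat_mul_scalar, scalar_mul_opMat, opMat_mul_scalar,
        ← conjBy, conjBy_antipodeBar, opMat_mul, antipode_aux F U_mem.2, Matrix.transpose_one,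
        opMat_one])

/-- The antipode as a linear map. -/
def antipodeLin : FreeUnitary F →ₗ[ℂ] FreeUnitary F :=
  (MulOpposite.opLinearEquiv ℂ).symm.toLinearMap ∘ₗ (antipodeHom F).toLinearMap

theorem antipodeLin_U (i j : n) : antipodeLin F (U F i j) = star (U F j i) :=
  congrArg MulOpposite.unop (liftAlg_U _ _ _ _ _ _ i j)

theorem antipodeLin_star_U (i j : n) : antipodeLin F (star (U F i j)) = antipodeBar F i j :=
  congrArg MulOpposite.unop (liftAlg_star_U _ _ _ _ _ _ i j)

theorem antipodeLin_mul (a b : FreeUnitary F) :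
    antipodeLin F (a * b) = antipodeLin F b * antipodeLin F a := by
  simp [antipodeLin]

theorem antipodeLin_algebraMap (c : ℂ) :
    antipodeLin F (algebraMap ℂ _ c) = algebraMap ℂ _ c := by
  simp [antipodeLin]

/-- `a ⊗ b ↦ S(a) b`. -/
def convL : FreeUnitary F ⊗[ℂ] FreeUnitary F →ₗ[ℂ] FreeUnitary F :=
  LinearMap.mul' ℂ _ ∘ₗ (antipodeLin F).rTensor _

/-- `a ⊗ b ↦ a S(b)`. -/
def convR : FreeUnitary F ⊗[ℂ] FreeUnitary F →ₗ[ℂ] FreeUnitary F :=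
  LinearMap.mul' ℂ _ ∘ₗ (antipodeLin F).lTensor _

theorem convL_tmul (a b : FreeUnitary F) : convL F (a ⊗ₜ[ℂ] b) = antipodeLin F a * b := by
  simp [convL]

theorem convR_tmul (a b : FreeUnitary F) : convR F (a ⊗ₜ[ℂ] b) = a * antipodeLin F b := by
  simp [convR]

theorem convL_mul_tmul (t : FreeUnitary F ⊗[ℂ] FreeUnitary F) (a b : FreeUnitary F) :
    convL F (t * a ⊗ₜ[ℂ] b) = antipodeLin F a * convL F t * b := by
  induction t using TensorProduct.induction_on with
  | zero => simp
  | tmul x y => simp [convL_tmul, antipodeLin_mul, mul_assoc]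
  | add x y hx hy => simp [add_mul, mul_add, hx, hy]

theorem convR_mul_tmul (t : FreeUnitary F ⊗[ℂ] FreeUnitary F) (a b : FreeUnitary F) :
    convR F (a ⊗ₜ[ℂ] b * t) = a * convR F t * antipodeLin F b := by
  induction t using TensorProduct.induction_on with
  | zero => simp
  | tmul x y => simp [convR_tmul, antipodeLin_mul, mul_assoc]
  | add x y hx hy => simp [add_mul, mul_add, hx, hy]

theorem convL_mul_of_scalar (t s : FreeUnitary F ⊗[ℂ] FreeUnitary F) (c : ℂ)
    (h : convL F t = algebraMap ℂ _ c) : convL F (t * s) = algebraMap ℂ _ c * convL F s := by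
  induction s using TensorProduct.induction_on with
  | zero => simp
  | tmul x y =>
    rw [convL_mul_tmul, h, convL_tmul, ← Algebra.commutes, mul_assoc]
  | add x y hx hy => simp [mul_add, hx, hy]

theorem convR_mul_of_scalar (t s : FreeUnitary F ⊗[ℂ] FreeUnitary F) (c : ℂ)
    (h : convR F t = algebraMap ℂ _ c) : convR F (s * t) = algebraMap ℂ _ c * convR F s := by
  induction s using TensorProduct.induction_on with
  | zero => simp
  | tmul x y =>
    rw [convR_mul_tmul, h, convR_tmul, ← Algebra.commutes, mul_assoc]
  | add x y hx hy => simp [add_mul, mul_add, hx, hy]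

theorem one_apply_algebraMap (i j : n) : algebraMap ℂ (FreeUnitary F) ((1 : Matrix n n ℂ) i j) =
    (1 : Matrix n n (FreeUnitary F)) i j := by
  by_cases h : i = j
  · subst h; simp
  · simp [h]

theorem convL_comul (a : FreeUnitary F) :
    convL F (comulHom F a) = algebraMap ℂ _ (counitHom F a) := by
  induction a using FreeUnitary.induction with
  | h0 c =>
    rw [show comulHom F (algebraMap ℂ _ c) = algebraMap ℂ _ c from AlgHomClass.commutes _ c,
      show counitHom F (algebraMap ℂ _ c) = c from AlgHomClass.commutes _ c, Algebra.TensorProduct.algebraMap_apply,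
      convL_tmul, antipodeLin_algebraMap, mul_one]
  | h1 i j =>
    rw [counitHom_U, comulHom_U, map_sum, one_apply_algebraMap, ← (U_mem (F := F)).1,
      Matrix.mul_apply]
    simp [convL_tmul, antipodeLin_U, Matrix.star_apply]
  | h1' i j =>
    rw [counitHom_star_U, comulHom_star_U, map_sum, one_apply_algebraMap, ← antipodeBar_mul,
      Matrix.mul_apply]
    simp [convL_tmul, antipodeLin_star_U, barMat]
  | h2 a b ha hb => rw [map_mul, convL_mul_of_scalar _ _ _ _ ha, hb, map_mul, map_mul]
  | h3 a b ha hb => simp [ha, hb]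

theorem convR_comul (a : FreeUnitary F) :
    convR F (comulHom F a) = algebraMap ℂ _ (counitHom F a) := by
  induction a using FreeUnitary.induction with
  | h0 c =>
    rw [show comulHom F (algebraMap ℂ _ c) = algebraMap ℂ _ c from AlgHomClass.commutes _ c,
      show counitHom F (algebraMap ℂ _ c) = c from AlgHomClass.commutes _ c, Algebra.TensorProduct.algebraMap_apply,
      convR_tmul, show (1 : FreeUnitary F) = algebraMap ℂ _ 1 from (map_one _).symm,
      antipodeLin_algebraMap, map_one, mul_one]
  | h1 i j =>
    rw [counitHom_U, comulHom_U, map_sum, one_apply_algebraMap, ← (U_mem (F := F)).2,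
      Matrix.mul_apply]
    simp [convR_tmul, antipodeLin_U, Matrix.star_apply]
  | h1' i j =>
    rw [counitHom_star_U, comulHom_star_U, map_sum, one_apply_algebraMap, ← mul_antipodeBar,
      Matrix.mul_apply]
    simp [convR_tmul, antipodeLin_star_U, barMat]
  | h2 a b ha hb =>
    rw [map_mul, convR_mul_of_scalar _ _ _ _ hb, ha, map_mul, map_mul, ← Algebra.commutes]
  | h3 a b ha hb => simp [ha, hb]

/-- The Hopf algebra structure of `ℂ[U_F⁺]`. -/
instance : HopfAlgebra ℂ (FreeUnitary F) where
  antipode := antipodeLin F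
  mul_antipode_rTensor_comul := LinearMap.ext fun a => convL_comul F a
  mul_antipode_lTensor_comul := LinearMap.ext fun a => convR_comul F a

end FreeUnitary

/-! ### Hopf star-algebras -/

/-- A Hopf algebra with involution is a Hopf star-algebra if the coproduct and the counit are
star-preserving. -/
class HopfStar (H : Type*) [Ring H] [HopfAlgebra ℂ H] [StarRing H] [StarModule ℂ H] : Prop where
  comul_star : ∀ x : H, Coalgebra.comul (R := ℂ) (star x) = star (Coalgebra.comul (R := ℂ) x)
  counit_star : ∀ x : H, Coalgebra.counit (R := ℂ) (star x) = star (Coalgebra.counit (R := ℂ) x)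

/-- Homomorphisms of Hopf star-algebras. -/
structure HopfStarHom (H K : Type*) [Ring H] [HopfAlgebra ℂ H] [StarRing H]
    [Ring K] [HopfAlgebra ℂ K] [StarRing K] where
  /-- The underlying bialgebra homomorphism. -/
  hom : H →ₐc[ℂ] K
  map_star : ∀ x, hom (star x) = star (hom x)

/-- A corepresentation matrix of a coalgebra. -/
structure IsCorepMatrix {n C : Type*} [Fintype n] [DecidableEq n] [Ring C] [Algebra ℂ C]
    [Coalgebra ℂ C] (Z : Matrix n n C) : Prop where
  comul : ∀ i j, Coalgebra.comul (R := ℂ) (Z i j) = ∑ k, Z i k ⊗ₜ[ℂ] Z k j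
  counit : ∀ i j, Coalgebra.counit (R := ℂ) (Z i j) = (1 : Matrix n n ℂ) i j

instance GroupAlg.instHopfStar {G : Type*} [Group G] : HopfStar (MonoidAlgebra ℂ G) where
  comul_star x := by
    induction x using MonoidAlgebra.induction_linear with
    | zero => simp
    | add f g hf hg => simp only [star_add, map_add, hf, hg]
    | single a b => simp [GroupAlg.star_single]
  counit_star x := by
    induction x using MonoidAlgebra.induction_linear with
    | zero => simp
    | add f g hf hg => simp only [star_add, map_add, hf, hg]
    | single a b => simp [GroupAlg.star_single]

namespace FreeUnitary

variable {n : Type*} [Fintype n] [DecidableEq n] {F : GL n ℂ}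

instance : HopfStar (FreeUnitary F) where
  comul_star x := map_star (comulHom F) x
  counit_star x := map_star (counitHom F) x

theorem isCorepMatrix_U : IsCorepMatrix (U F) where
  comul := comulHom_U F
  counit := counitHom_U F

theorem lift_star_U {B : Type*} [Ring B] [Algebra ℂ B] [StarRing B] [StarModule ℂ B]
    (V : Matrix n n B) (hV hV') (i j : n) :
    lift (F := F) V hV hV' (star (U F i j)) = star (V i j) := liftAux_star_U V hV hV' i j

/-- The Hopf star-algebra homomorphism `ℂ[U_F⁺] → K` mapping `U` to a given unitary
corepresentation matrix `Z` such that `F Z̄ F⁻¹` is unitary. -/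
def toHopf {K : Type*} [Ring K] [HopfAlgebra ℂ K] [StarRing K] [StarModule ℂ K] [HopfStar K]
    (Z : Matrix n n K) (hc : IsCorepMatrix Z) (hZ : Z ∈ unitary (Matrix n n K))
    (hFZ : conjBy F (barMat Z) ∈ unitary (Matrix n n K)) : HopfStarHom (FreeUnitary F) K where
  hom := BialgHom.ofAlgHom (lift Z hZ hFZ : FreeUnitary F →ₐ[ℂ] K)
    (by
      have h1 : ∀ i j, Coalgebra.counit (R := ℂ) (star (Z i j)) = (1 : Matrix n n ℂ) i j := by
        intro i j
        rw [HopfStar.counit_star, hc.counit]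
        by_cases h : i = j
        · subst h; simp
        · simp [h]
      apply algHom_ext <;> intro i j
      · have := hc.counit i j
        simp [lift_U, this, counit_apply, counitHom_U]
      · simpa [lift_star_U, h1, counit_apply] using (counitHom_star_U F i j).symm)
    (by
      apply algHom_ext <;> intro i j
      · simp [lift_U, hc.comul, comul_apply, comulHom_U, map_sum]
      · simp [lift_star_U, hc.comul, comul_apply, comulHom_U, HopfStar.comul_star])
  map_star x := map_star (lift Z hZ hFZ) x

theorem toHopf_U {K : Type*} [Ring K] [HopfAlgebra ℂ K] [StarRing K] [StarModule ℂ K] [HopfStar K]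
    (Z : Matrix n n K) (hc : IsCorepMatrix Z) (hZ : Z ∈ unitary (Matrix n n K))
    (hFZ : conjBy F (barMat Z) ∈ unitary (Matrix n n K)) (i j : n) :
    (toHopf Z hc hZ hFZ).hom (U F i j) = Z i j :=
  lift_U Z hZ hFZ i j

end FreeUnitary

/-! ### The bigrading defined by a map to a group algebra -/

section Bigrading

variable {Γ : Type*} [CommGroup Γ]

/-- The group-like element of the group algebra given by a group element. -/
def chi (a : Γ) : MonoidAlgebra ℂ Γ := MonoidAlgebra.single a 1

theorem chi_mul (a b : Γ) : chi a * chi b = chi (a * b) := by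
  simp [chi, MonoidAlgebra.single_mul_single]

theorem chi_one : chi (1 : Γ) = 1 := rfl

theorem star_chi (a : Γ) : star (chi a) = chi a⁻¹ := by
  simp [chi, GroupAlg.star_single]

theorem comul_chi (a : Γ) : Coalgebra.comul (R := ℂ) (chi a) = chi a ⊗ₜ[ℂ] chi a := by
  simp [chi]

theorem single_eq_smul_chi (a : Γ) (c : ℂ) : MonoidAlgebra.single a c = c • chi a := by
  simp [chi, MonoidAlgebra.smul_single]

variable {H : Type*} [Ring H] [HopfAlgebra ℂ H] [StarRing H]
  (π : HopfStarHom H (MonoidAlgebra ℂ Γ))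

/-- The left coaction `δ_L = (π ⊗ ι)Δ`. -/
def coactL : H →ₐ[ℂ] MonoidAlgebra ℂ Γ ⊗[ℂ] H :=
  (Algebra.TensorProduct.map (π.hom : H →ₐ[ℂ] MonoidAlgebra ℂ Γ) (AlgHom.id ℂ H)).comp
    (Bialgebra.comulAlgHom ℂ H)

/-- The right coaction `δ_R = (ι ⊗ π)Δ`. -/
def coactR : H →ₐ[ℂ] H ⊗[ℂ] MonoidAlgebra ℂ Γ :=
  (Algebra.TensorProduct.map (AlgHom.id ℂ H) (π.hom : H →ₐ[ℂ] MonoidAlgebra ℂ Γ)).comp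
    (Bialgebra.comulAlgHom ℂ H)

/-- The homogeneous component
`H_{a,b} = {x | δ_L(x) = a ⊗ x and δ_R(x) = x ⊗ b}`. -/
def bigraded (a b : Γ) : Submodule ℂ H where
  carrier := {x | coactL π x = chi a ⊗ₜ[ℂ] x ∧ coactR π x = x ⊗ₜ[ℂ] chi b}
  add_mem' := fun ⟨h1, h2⟩ ⟨h3, h4⟩ => by
    constructor
    · rw [map_add, h1, h3, TensorProduct.tmul_add]
    · rw [map_add, h2, h4, TensorProduct.add_tmul]
  zero_mem' := by simp
  smul_mem' := fun c x ⟨h1, h2⟩ => by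
    constructor
    · rw [map_smul, h1, TensorProduct.tmul_smul]
    · rw [map_smul, h2, TensorProduct.smul_tmul']

open scoped Classical in
/-- The coefficients in the left tensor factor of an element of `ℂΓ ⊗ M`. -/
def coeffL (M : Type*) [AddCommGroup M] [Module ℂ M] :
    MonoidAlgebra ℂ Γ ⊗[ℂ] M →ₗ[ℂ] (Γ →₀ M) :=
  (TensorProduct.finsuppScalarLeft ℂ M Γ).toLinearMap ∘ₗ
    (MonoidAlgebra.coeffLinearEquiv ℂ).toLinearMap.rTensor M

open scoped Classical in
/-- The coefficients in the right tensor factor of an element of `M ⊗ ℂΓ`. -/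
def coeffR (M : Type*) [AddCommGroup M] [Module ℂ M] :
    M ⊗[ℂ] MonoidAlgebra ℂ Γ →ₗ[ℂ] (Γ →₀ M) :=
  (TensorProduct.finsuppScalarRight ℂ ℂ M Γ).toLinearMap ∘ₗ
    (MonoidAlgebra.coeffLinearEquiv ℂ).toLinearMap.lTensor M

theorem coeffL_tmul {M : Type*} [AddCommGroup M] [Module ℂ M] (k : MonoidAlgebra ℂ Γ) (x : M)
    (a : Γ) : coeffL M (k ⊗ₜ[ℂ] x) a = k.coeff a • x := by
  simp [coeffL]

theorem coeffR_tmul {M : Type*} [AddCommGroup M] [Module ℂ M] (k : MonoidAlgebra ℂ Γ) (x : M)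
    (a : Γ) : coeffR M (x ⊗ₜ[ℂ] k) a = k.coeff a • x := by
  simp [coeffR]

theorem coeffL_chi {M : Type*} [AddCommGroup M] [Module ℂ M] (x : M) (a : Γ) :
    coeffL M (chi a ⊗ₜ[ℂ] x) = Finsupp.single a x := by
  classical
  ext b
  simp [coeffL_tmul, chi, Finsupp.single_apply]

theorem coeffR_chi {M : Type*} [AddCommGroup M] [Module ℂ M] (x : M) (a : Γ) :
    coeffR M (x ⊗ₜ[ℂ] chi a) = Finsupp.single a x := by
  classical
  ext b
  simp [coeffR_tmul, chi, Finsupp.single_apply]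

/-- The map sending `x` to the finitely supported family of its homogeneous components
`x_{a,b} ∈ H_{a,b}`. -/
def components : H →ₗ[ℂ] (Γ × Γ →₀ H) :=
  (Finsupp.curryLinearEquiv ℂ).symm.toLinearMap ∘ₗ
    Finsupp.mapRange.linearMap (coeffR H ∘ₗ (coactR π).toLinearMap) ∘ₗ
      coeffL H ∘ₗ (coactL π).toLinearMap

theorem components_apply (x : H) (a b : Γ) :
    components π x (a, b) = coeffR H (coactR π (coeffL H (coactL π x) a)) b := by
  simp [components, Finsupp.curryLinearEquiv_symm_apply_apply]

theorem components_of_mem {x : H} {a b : Γ} (hx : x ∈ bigraded π a b) :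
    components π x = Finsupp.single (a, b) x := by
  classical
  ext ⟨c, d⟩
  rw [components_apply, hx.1, coeffL_chi]
  by_cases hc : a = c
  · subst hc
    rw [Finsupp.single_eq_same, hx.2, coeffR_chi]
    by_cases hd : b = d
    · subst hd; simp
    · rw [Finsupp.single_apply, Finsupp.single_apply]; simp [hd]
  · rw [Finsupp.single_apply, Finsupp.single_apply]; simp [hc]

/-- The map `π` as a linear map. -/
def piLin : H →ₗ[ℂ] MonoidAlgebra ℂ Γ := (π.hom : H →ₐ[ℂ] MonoidAlgebra ℂ Γ).toLinearMap

theorem comul_piLin (y : H) : Coalgebra.comul (R := ℂ) (piLin π y) =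
    TensorProduct.map (piLin π) (piLin π) (Coalgebra.comul (R := ℂ) y) :=
  (CoalgHomClass.map_comp_comul_apply π.hom y).symm

theorem counit_piLin (y : H) : Coalgebra.counit (R := ℂ) (piLin π y) =
    Coalgebra.counit (R := ℂ) y :=
  CoalgHomClass.counit_comp_apply π.hom y

theorem coactL_apply (x : H) :
    coactL π x = (piLin π).rTensor H (Coalgebra.comul (R := ℂ) x) := rfl

theorem coactR_apply (x : H) :
    coactR π x = (piLin π).lTensor H (Coalgebra.comul (R := ℂ) x) := rfl

theorem coactL_zero : coactL π 0 = 0 := map_zero _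

theorem coactR_zero : coactR π 0 = 0 := map_zero _

theorem coactL_add (x y : H) : coactL π (x + y) = coactL π x + coactL π y := map_add _ x y

theorem coactR_add (x y : H) : coactR π (x + y) = coactR π x + coactR π y := map_add _ x y

theorem coactL_coassoc (x : H) :
    (coactL π).toLinearMap.lTensor (MonoidAlgebra ℂ Γ) (coactL π x) =
      TensorProduct.assoc ℂ _ _ _
        ((Coalgebra.comul (R := ℂ) (A := MonoidAlgebra ℂ Γ)).rTensor H (coactL π x)) := by
  have h1 : ∀ t : H ⊗[ℂ] H,
      (coactL π).toLinearMap.lTensor (MonoidAlgebra ℂ Γ) ((piLin π).rTensor H t) =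
      TensorProduct.map (piLin π) ((piLin π).rTensor H)
        ((Coalgebra.comul (R := ℂ) (A := H)).lTensor H t) := by
    intro t
    induction t using TensorProduct.induction_on with
    | zero => simp only [LinearMap.map_zero, LinearEquiv.map_zero, coactL_zero, coactR_zero,
        TensorProduct.zero_tmul, TensorProduct.tmul_zero, Finsupp.coe_zero, Pi.zero_apply,
        Finsupp.sum_zero_index, star_zero]
    | tmul a b => simp [coactL_apply]
    | add t s ht hs => simp only [LinearMap.map_add, LinearEquiv.map_add, coactL_add, coactR_add, ht, hs]
  have h2 : ∀ (s : H ⊗[ℂ] H) (b : H),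
      TensorProduct.map (piLin π) ((piLin π).rTensor H) (TensorProduct.assoc ℂ _ _ _ (s ⊗ₜ[ℂ] b)) =
      TensorProduct.assoc ℂ _ _ _ (TensorProduct.map (piLin π) (piLin π) s ⊗ₜ[ℂ] b) := by
    intro s b
    induction s using TensorProduct.induction_on with
    | zero => simp only [LinearMap.map_zero, LinearEquiv.map_zero, coactL_zero, coactR_zero,
        TensorProduct.zero_tmul, TensorProduct.tmul_zero, Finsupp.coe_zero, Pi.zero_apply,
        Finsupp.sum_zero_index, star_zero]
    | tmul a c => simp
    | add t s ht hs => simp only [LinearMap.map_add, LinearEquiv.map_add, coactL_add, coactR_add, TensorProduct.add_tmul, ht, hs]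
  have h3 : ∀ t : H ⊗[ℂ] H,
      TensorProduct.map (piLin π) ((piLin π).rTensor H) (TensorProduct.assoc ℂ _ _ _
        ((Coalgebra.comul (R := ℂ) (A := H)).rTensor H t)) =
      TensorProduct.assoc ℂ _ _ _ ((Coalgebra.comul (R := ℂ) (A := MonoidAlgebra ℂ Γ)).rTensor H
        ((piLin π).rTensor H t)) := by
    intro t
    induction t using TensorProduct.induction_on with
    | zero => simp only [LinearMap.map_zero, LinearEquiv.map_zero, coactL_zero, coactR_zero,
        TensorProduct.zero_tmul, TensorProduct.tmul_zero, Finsupp.coe_zero, Pi.zero_apply,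
        Finsupp.sum_zero_index, star_zero]
    | tmul a b => rw [LinearMap.rTensor_tmul, h2, LinearMap.rTensor_tmul, LinearMap.rTensor_tmul,
        comul_piLin]
    | add t s ht hs => simp only [LinearMap.map_add, LinearEquiv.map_add, coactL_add, coactR_add, ht, hs]
  rw [coactL_apply, h1, ← Coalgebra.coassoc_apply, h3]

theorem coactR_coassoc (x : H) :
    (coactR π).toLinearMap.rTensor (MonoidAlgebra ℂ Γ) (coactR π x) =
      (TensorProduct.assoc ℂ _ _ _).symm
        ((Coalgebra.comul (R := ℂ) (A := MonoidAlgebra ℂ Γ)).lTensor H (coactR π x)) := by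
  have h1 : ∀ t : H ⊗[ℂ] H,
      (coactR π).toLinearMap.rTensor (MonoidAlgebra ℂ Γ) ((piLin π).lTensor H t) =
      TensorProduct.map ((piLin π).lTensor H) (piLin π)
        ((Coalgebra.comul (R := ℂ) (A := H)).rTensor H t) := by
    intro t
    induction t using TensorProduct.induction_on with
    | zero => simp only [LinearMap.map_zero, LinearEquiv.map_zero, coactL_zero, coactR_zero,
        TensorProduct.zero_tmul, TensorProduct.tmul_zero, Finsupp.coe_zero, Pi.zero_apply,
        Finsupp.sum_zero_index, star_zero]
    | tmul a b => simp [coactR_apply]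
    | add t s ht hs => simp only [LinearMap.map_add, LinearEquiv.map_add, coactL_add, coactR_add, ht, hs]
  have h2 : ∀ (s : H ⊗[ℂ] H) (b : H),
      TensorProduct.map ((piLin π).lTensor H) (piLin π)
        ((TensorProduct.assoc ℂ _ _ _).symm (b ⊗ₜ[ℂ] s)) =
      (TensorProduct.assoc ℂ _ _ _).symm (b ⊗ₜ[ℂ] TensorProduct.map (piLin π) (piLin π) s) := by
    intro s b
    induction s using TensorProduct.induction_on with
    | zero => simp only [LinearMap.map_zero, LinearEquiv.map_zero, coactL_zero, coactR_zero,
        TensorProduct.zero_tmul, TensorProduct.tmul_zero, Finsupp.coe_zero, Pi.zero_apply,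
        Finsupp.sum_zero_index, star_zero]
    | tmul a c => simp
    | add t s ht hs => simp only [LinearMap.map_add, LinearEquiv.map_add, coactL_add, coactR_add, TensorProduct.tmul_add, ht, hs]
  have h3 : ∀ t : H ⊗[ℂ] H,
      TensorProduct.map ((piLin π).lTensor H) (piLin π) ((TensorProduct.assoc ℂ _ _ _).symm
        ((Coalgebra.comul (R := ℂ) (A := H)).lTensor H t)) =
      (TensorProduct.assoc ℂ _ _ _).symm
        ((Coalgebra.comul (R := ℂ) (A := MonoidAlgebra ℂ Γ)).lTensor H
        ((piLin π).lTensor H t)) := by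
    intro t
    induction t using TensorProduct.induction_on with
    | zero => simp only [LinearMap.map_zero, LinearEquiv.map_zero, coactL_zero, coactR_zero,
        TensorProduct.zero_tmul, TensorProduct.tmul_zero, Finsupp.coe_zero, Pi.zero_apply,
        Finsupp.sum_zero_index, star_zero]
    | tmul a b => rw [LinearMap.lTensor_tmul, h2, LinearMap.lTensor_tmul, LinearMap.lTensor_tmul,
        comul_piLin]
    | add t s ht hs => simp only [LinearMap.map_add, LinearEquiv.map_add, coactL_add, coactR_add, ht, hs]
  rw [coactR_apply, h1, ← Coalgebra.coassoc_symm_apply, h3]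

theorem coactL_coactR (x : H) :
    (coactL π).toLinearMap.rTensor (MonoidAlgebra ℂ Γ) (coactR π x) =
      (TensorProduct.assoc ℂ _ _ _).symm
        ((coactR π).toLinearMap.lTensor (MonoidAlgebra ℂ Γ) (coactL π x)) := by
  have h1 : ∀ t : H ⊗[ℂ] H,
      (coactL π).toLinearMap.rTensor (MonoidAlgebra ℂ Γ) ((piLin π).lTensor H t) =
      TensorProduct.map ((piLin π).rTensor H) (piLin π)
        ((Coalgebra.comul (R := ℂ) (A := H)).rTensor H t) := by
    intro t
    induction t using TensorProduct.induction_on with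
    | zero => simp only [LinearMap.map_zero, LinearEquiv.map_zero, coactL_zero, coactR_zero,
        TensorProduct.zero_tmul, TensorProduct.tmul_zero, Finsupp.coe_zero, Pi.zero_apply,
        Finsupp.sum_zero_index, star_zero]
    | tmul a b => simp [coactL_apply]
    | add t s ht hs => simp only [LinearMap.map_add, LinearEquiv.map_add, coactL_add, coactR_add, ht, hs]
  have h2 : ∀ (s : H ⊗[ℂ] H) (b : H),
      TensorProduct.map ((piLin π).rTensor H) (piLin π)
        ((TensorProduct.assoc ℂ _ _ _).symm (b ⊗ₜ[ℂ] s)) =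
      (TensorProduct.assoc ℂ _ _ _).symm (piLin π b ⊗ₜ[ℂ] (piLin π).lTensor H s) := by
    intro s b
    induction s using TensorProduct.induction_on with
    | zero => simp only [LinearMap.map_zero, LinearEquiv.map_zero, coactL_zero, coactR_zero,
        TensorProduct.zero_tmul, TensorProduct.tmul_zero, Finsupp.coe_zero, Pi.zero_apply,
        Finsupp.sum_zero_index, star_zero]
    | tmul a c => simp
    | add t s ht hs => simp only [LinearMap.map_add, LinearEquiv.map_add, coactL_add, coactR_add, TensorProduct.tmul_add, ht, hs]
  have h3 : ∀ t : H ⊗[ℂ] H,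
      TensorProduct.map ((piLin π).rTensor H) (piLin π) ((TensorProduct.assoc ℂ _ _ _).symm
        ((Coalgebra.comul (R := ℂ) (A := H)).lTensor H t)) =
      (TensorProduct.assoc ℂ _ _ _).symm
        ((coactR π).toLinearMap.lTensor (MonoidAlgebra ℂ Γ) ((piLin π).rTensor H t)) := by
    intro t
    induction t using TensorProduct.induction_on with
    | zero => simp only [LinearMap.map_zero, LinearEquiv.map_zero, coactL_zero, coactR_zero,
        TensorProduct.zero_tmul, TensorProduct.tmul_zero, Finsupp.coe_zero, Pi.zero_apply,
        Finsupp.sum_zero_index, star_zero]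
    | tmul a b =>
      rw [LinearMap.lTensor_tmul, h2, LinearMap.rTensor_tmul, LinearMap.lTensor_tmul]
      rfl
    | add t s ht hs => simp only [LinearMap.map_add, LinearEquiv.map_add, coactL_add, coactR_add, ht, hs]
  rw [coactR_apply, h1, ← Coalgebra.coassoc_symm_apply, h3, coactL_apply]

theorem coactL_coeffL (x : H) (a : Γ) :
    coactL π (coeffL H (coactL π x) a) = chi a ⊗ₜ[ℂ] coeffL H (coactL π x) a := by
  classical
  have h1 : ∀ t : MonoidAlgebra ℂ Γ ⊗[ℂ] H, coactL π (coeffL H t a) =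
      coeffL (MonoidAlgebra ℂ Γ ⊗[ℂ] H) ((coactL π).toLinearMap.lTensor _ t) a := by
    intro t
    induction t using TensorProduct.induction_on with
    | zero => simp only [LinearMap.map_zero, LinearEquiv.map_zero, coactL_zero, coactR_zero,
        TensorProduct.zero_tmul, TensorProduct.tmul_zero, Finsupp.coe_zero, Pi.zero_apply,
        Finsupp.sum_zero_index, star_zero]
    | tmul k y => simp [coeffL_tmul]
    | add t s ht hs => simp only [LinearMap.map_add, LinearEquiv.map_add, coactL_add, coactR_add, ht, hs, Finsupp.add_apply]
  have h2 : ∀ t : MonoidAlgebra ℂ Γ ⊗[ℂ] H,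
      coeffL (MonoidAlgebra ℂ Γ ⊗[ℂ] H) (TensorProduct.assoc ℂ _ _ _
        ((Coalgebra.comul (R := ℂ) (A := MonoidAlgebra ℂ Γ)).rTensor H t)) a =
      chi a ⊗ₜ[ℂ] coeffL H t a := by
    intro t
    induction t using TensorProduct.induction_on with
    | zero => simp only [LinearMap.map_zero, LinearEquiv.map_zero, coactL_zero, coactR_zero,
        TensorProduct.zero_tmul, TensorProduct.tmul_zero, Finsupp.coe_zero, Pi.zero_apply,
        Finsupp.sum_zero_index, star_zero]
    | tmul k y =>
      induction k using MonoidAlgebra.induction_linear with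
      | zero => simp only [LinearMap.map_zero, LinearEquiv.map_zero, coactL_zero, coactR_zero,
        TensorProduct.zero_tmul, TensorProduct.tmul_zero, Finsupp.coe_zero, Pi.zero_apply,
        Finsupp.sum_zero_index, star_zero]
      | add f g hf hg =>
        simp only [TensorProduct.add_tmul, LinearMap.map_add, LinearEquiv.map_add, Finsupp.add_apply, hf, hg,
          TensorProduct.tmul_add]
      | single b c =>
        rw [single_eq_smul_chi, ← TensorProduct.smul_tmul']
        simp only [LinearMap.map_smul, LinearEquiv.map_smul, LinearMap.rTensor_tmul, comul_chi, TensorProduct.assoc_tmul,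
          coeffL_chi, Finsupp.smul_apply, TensorProduct.tmul_smul]
        by_cases h : b = a
        · subst h; simp
        · simp [Finsupp.single_apply, h]
    | add t s ht hs => simp only [LinearMap.map_add, LinearEquiv.map_add, coactL_add, coactR_add, ht, hs, Finsupp.add_apply, TensorProduct.tmul_add]
  rw [h1, coactL_coassoc, h2]

theorem coactR_coeffR (x : H) (a : Γ) :
    coactR π (coeffR H (coactR π x) a) = coeffR H (coactR π x) a ⊗ₜ[ℂ] chi a := by
  classical
  have h1 : ∀ t : H ⊗[ℂ] MonoidAlgebra ℂ Γ, coactR π (coeffR H t a) =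
      coeffR (H ⊗[ℂ] MonoidAlgebra ℂ Γ) ((coactR π).toLinearMap.rTensor _ t) a := by
    intro t
    induction t using TensorProduct.induction_on with
    | zero => simp only [LinearMap.map_zero, LinearEquiv.map_zero, coactL_zero, coactR_zero,
        TensorProduct.zero_tmul, TensorProduct.tmul_zero, Finsupp.coe_zero, Pi.zero_apply,
        Finsupp.sum_zero_index, star_zero]
    | tmul k y => simp [coeffR_tmul]
    | add t s ht hs => simp only [LinearMap.map_add, LinearEquiv.map_add, coactL_add, coactR_add, ht, hs, Finsupp.add_apply]
  have h2 : ∀ t : H ⊗[ℂ] MonoidAlgebra ℂ Γ,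
      coeffR (H ⊗[ℂ] MonoidAlgebra ℂ Γ) ((TensorProduct.assoc ℂ _ _ _).symm
        ((Coalgebra.comul (R := ℂ) (A := MonoidAlgebra ℂ Γ)).lTensor H t)) a =
      coeffR H t a ⊗ₜ[ℂ] chi a := by
    intro t
    induction t using TensorProduct.induction_on with
    | zero => simp only [LinearMap.map_zero, LinearEquiv.map_zero, coactL_zero, coactR_zero,
        TensorProduct.zero_tmul, TensorProduct.tmul_zero, Finsupp.coe_zero, Pi.zero_apply,
        Finsupp.sum_zero_index, star_zero]
    | tmul y k =>
      induction k using MonoidAlgebra.induction_linear with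
      | zero => simp only [LinearMap.map_zero, LinearEquiv.map_zero, coactL_zero, coactR_zero,
        TensorProduct.zero_tmul, TensorProduct.tmul_zero, Finsupp.coe_zero, Pi.zero_apply,
        Finsupp.sum_zero_index, star_zero]
      | add f g hf hg =>
        simp only [TensorProduct.add_tmul, LinearMap.map_add, LinearEquiv.map_add, Finsupp.add_apply, hf, hg,
          TensorProduct.tmul_add]
      | single b c =>
        rw [single_eq_smul_chi, TensorProduct.tmul_smul]
        simp only [LinearMap.map_smul, LinearEquiv.map_smul, LinearMap.lTensor_tmul, comul_chi, TensorProduct.assoc_symm_tmul,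
          coeffR_chi, Finsupp.smul_apply, ← TensorProduct.smul_tmul']
        by_cases h : b = a
        · subst h; simp
        · simp [Finsupp.single_apply, h]
    | add t s ht hs => simp only [LinearMap.map_add, LinearEquiv.map_add, coactL_add, coactR_add, ht, hs, Finsupp.add_apply, TensorProduct.add_tmul]
  rw [h1, coactR_coassoc, h2]

theorem coactL_coeffR {x : H} {a : Γ} (hx : coactL π x = chi a ⊗ₜ[ℂ] x) (b : Γ) :
    coactL π (coeffR H (coactR π x) b) = chi a ⊗ₜ[ℂ] coeffR H (coactR π x) b := by
  have h1 : ∀ t : H ⊗[ℂ] MonoidAlgebra ℂ Γ, coactL π (coeffR H t b) =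
      coeffR (MonoidAlgebra ℂ Γ ⊗[ℂ] H) ((coactL π).toLinearMap.rTensor _ t) b := by
    intro t
    induction t using TensorProduct.induction_on with
    | zero => simp only [LinearMap.map_zero, LinearEquiv.map_zero, coactL_zero, coactR_zero,
        TensorProduct.zero_tmul, TensorProduct.tmul_zero, Finsupp.coe_zero, Pi.zero_apply,
        Finsupp.sum_zero_index, star_zero]
    | tmul k y => simp [coeffR_tmul]
    | add t s ht hs => simp only [LinearMap.map_add, LinearEquiv.map_add, coactL_add, coactR_add, ht, hs, Finsupp.add_apply]
  have h2 : ∀ t : H ⊗[ℂ] MonoidAlgebra ℂ Γ,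
      coeffR (MonoidAlgebra ℂ Γ ⊗[ℂ] H) ((TensorProduct.assoc ℂ _ _ _).symm (chi a ⊗ₜ[ℂ] t)) b =
      chi a ⊗ₜ[ℂ] coeffR H t b := by
    intro t
    induction t using TensorProduct.induction_on with
    | zero => simp only [LinearMap.map_zero, LinearEquiv.map_zero, coactL_zero, coactR_zero,
        TensorProduct.zero_tmul, TensorProduct.tmul_zero, Finsupp.coe_zero, Pi.zero_apply,
        Finsupp.sum_zero_index, star_zero]
    | tmul y k => simp [coeffR_tmul]
    | add t s ht hs => simp only [LinearMap.map_add, LinearEquiv.map_add, coactL_add, coactR_add, ht, hs, Finsupp.add_apply, TensorProduct.tmul_add]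
  rw [h1, coactL_coactR, hx, LinearMap.lTensor_tmul, h2]
  rfl

theorem components_mem (x : H) (a b : Γ) : components π x (a, b) ∈ bigraded π a b := by
  rw [components_apply]
  exact ⟨coactL_coeffR π (coactL_coeffL π x a) b, coactR_coeffR π _ b⟩

theorem sum_coeffL (x : H) : ((coeffL H (coactL π x)).sum fun _ y => y) = x := by
  classical
  have h1 : ∀ t : MonoidAlgebra ℂ Γ ⊗[ℂ] H, ((coeffL H t).sum fun _ y => y) =
      TensorProduct.lid ℂ H ((Coalgebra.counit (R := ℂ)).rTensor H t) := by
    intro t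
    induction t using TensorProduct.induction_on with
    | zero => simp only [LinearMap.map_zero, LinearEquiv.map_zero, coactL_zero, coactR_zero,
        TensorProduct.zero_tmul, TensorProduct.tmul_zero, Finsupp.coe_zero, Pi.zero_apply,
        Finsupp.sum_zero_index, star_zero]
    | tmul k y =>
      induction k using MonoidAlgebra.induction_linear with
      | zero => simp only [LinearMap.map_zero, LinearEquiv.map_zero, coactL_zero, coactR_zero,
        TensorProduct.zero_tmul, TensorProduct.tmul_zero, Finsupp.coe_zero, Pi.zero_apply,
        Finsupp.sum_zero_index, star_zero]
      | add f g hf hg =>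
        rw [TensorProduct.add_tmul, map_add, Finsupp.sum_add_index' (fun _ => rfl)
          (fun _ _ _ => rfl), hf, hg, map_add, map_add]
      | single b c =>
        rw [single_eq_smul_chi, TensorProduct.smul_tmul, coeffL_chi,
          Finsupp.sum_single_index rfl]
        simp [chi]
    | add t s ht hs =>
      rw [map_add, Finsupp.sum_add_index' (fun _ => rfl) (fun _ _ _ => rfl), ht, hs, map_add,
        map_add]
  have h2 : ∀ t : H ⊗[ℂ] H, (Coalgebra.counit (R := ℂ)).rTensor H ((piLin π).rTensor H t) =
      (Coalgebra.counit (R := ℂ)).rTensor H t := by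
    intro t
    induction t using TensorProduct.induction_on with
    | zero => simp only [LinearMap.map_zero, LinearEquiv.map_zero, coactL_zero, coactR_zero,
        TensorProduct.zero_tmul, TensorProduct.tmul_zero, Finsupp.coe_zero, Pi.zero_apply,
        Finsupp.sum_zero_index, star_zero]
    | tmul k y => simp [counit_piLin]
    | add t s ht hs => simp only [LinearMap.map_add, LinearEquiv.map_add, coactL_add, coactR_add, ht, hs]
  rw [h1, coactL_apply, h2, Coalgebra.rTensor_counit_comul]
  simp

theorem sum_coeffR (x : H) : ((coeffR H (coactR π x)).sum fun _ y => y) = x := by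
  classical
  have h1 : ∀ t : H ⊗[ℂ] MonoidAlgebra ℂ Γ, ((coeffR H t).sum fun _ y => y) =
      TensorProduct.rid ℂ H ((Coalgebra.counit (R := ℂ)).lTensor H t) := by
    intro t
    induction t using TensorProduct.induction_on with
    | zero => simp only [LinearMap.map_zero, LinearEquiv.map_zero, coactL_zero, coactR_zero,
        TensorProduct.zero_tmul, TensorProduct.tmul_zero, Finsupp.coe_zero, Pi.zero_apply,
        Finsupp.sum_zero_index, star_zero]
    | tmul y k =>
      induction k using MonoidAlgebra.induction_linear with
      | zero => simp only [LinearMap.map_zero, LinearEquiv.map_zero, coactL_zero, coactR_zero,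
        TensorProduct.zero_tmul, TensorProduct.tmul_zero, Finsupp.coe_zero, Pi.zero_apply,
        Finsupp.sum_zero_index, star_zero]
      | add f g hf hg =>
        rw [TensorProduct.tmul_add, map_add, Finsupp.sum_add_index' (fun _ => rfl)
          (fun _ _ _ => rfl), hf, hg, map_add, map_add]
      | single b c =>
        rw [single_eq_smul_chi, TensorProduct.tmul_smul, TensorProduct.smul_tmul', coeffR_chi,
          Finsupp.sum_single_index rfl]
        simp [chi]
    | add t s ht hs =>
      rw [map_add, Finsupp.sum_add_index' (fun _ => rfl) (fun _ _ _ => rfl), ht, hs, map_add,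
        map_add]
  have h2 : ∀ t : H ⊗[ℂ] H, (Coalgebra.counit (R := ℂ)).lTensor H ((piLin π).lTensor H t) =
      (Coalgebra.counit (R := ℂ)).lTensor H t := by
    intro t
    induction t using TensorProduct.induction_on with
    | zero => simp only [LinearMap.map_zero, LinearEquiv.map_zero, coactL_zero, coactR_zero,
        TensorProduct.zero_tmul, TensorProduct.tmul_zero, Finsupp.coe_zero, Pi.zero_apply,
        Finsupp.sum_zero_index, star_zero]
    | tmul k y => simp [counit_piLin]
    | add t s ht hs => simp only [LinearMap.map_add, LinearEquiv.map_add, coactL_add, coactR_add, ht, hs]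
  rw [h1, coactR_apply, h2, Coalgebra.lTensor_counit_comul]
  simp

/-- Every element is a sum of homogeneous elements. -/
theorem bigraded_induction {P : H → Prop} (h0 : P 0) (ha : ∀ x y, P x → P y → P (x + y))
    (hh : ∀ a b, ∀ x ∈ bigraded π a b, P x) (x : H) : P x := by
  rw [← sum_coeffL π x]
  refine Finset.sum_induction _ P ha h0 fun a _ => ?_
  change P (coeffL H (coactL π x) a)
  rw [← sum_coeffR π (coeffL H (coactL π x) a)]
  refine Finset.sum_induction _ P ha h0 fun b _ => ?_
  refine hh a b _ ?_
  have := components_mem π x a b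
  rwa [components_apply] at this

theorem one_mem_bigraded : (1 : H) ∈ bigraded π 1 1 := by
  constructor <;> rw [map_one] <;> rfl

theorem mul_mem_bigraded {x y : H} {a b c d : Γ} (hx : x ∈ bigraded π a b)
    (hy : y ∈ bigraded π c d) : x * y ∈ bigraded π (a * c) (b * d) := by
  constructor
  · rw [map_mul, hx.1, hy.1, Algebra.TensorProduct.tmul_mul_tmul, chi_mul]
  · rw [map_mul, hx.2, hy.2, Algebra.TensorProduct.tmul_mul_tmul, chi_mul]

theorem star_mem_bigraded [StarModule ℂ H] [HopfStar H] {x : H} {a b : Γ}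
    (hx : x ∈ bigraded π a b) : star x ∈ bigraded π a⁻¹ b⁻¹ := by
  have hL : ∀ t : H ⊗[ℂ] H, (piLin π).rTensor H (star t) = star ((piLin π).rTensor H t) := by
    intro t
    induction t using TensorProduct.induction_on with
    | zero => simp only [LinearMap.map_zero, LinearEquiv.map_zero, coactL_zero, coactR_zero,
        TensorProduct.zero_tmul, TensorProduct.tmul_zero, Finsupp.coe_zero, Pi.zero_apply,
        Finsupp.sum_zero_index, star_zero]
    | tmul x y =>
      simp only [TensorProduct.star_tmul, LinearMap.rTensor_tmul]
      exact congrArg (· ⊗ₜ[ℂ] star y) (π.map_star x)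
    | add t s ht hs => simp only [LinearMap.map_add, LinearEquiv.map_add, coactL_add, coactR_add, star_add, ht, hs]
  have hR : ∀ t : H ⊗[ℂ] H, (piLin π).lTensor H (star t) = star ((piLin π).lTensor H t) := by
    intro t
    induction t using TensorProduct.induction_on with
    | zero => simp only [LinearMap.map_zero, LinearEquiv.map_zero, coactL_zero, coactR_zero,
        TensorProduct.zero_tmul, TensorProduct.tmul_zero, Finsupp.coe_zero, Pi.zero_apply,
        Finsupp.sum_zero_index, star_zero]
    | tmul x y =>
      simp only [TensorProduct.star_tmul, LinearMap.lTensor_tmul]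
      exact congrArg (star x ⊗ₜ[ℂ] ·) (π.map_star y)
    | add t s ht hs => simp only [LinearMap.map_add, LinearEquiv.map_add, coactL_add, coactR_add, star_add, ht, hs]
  constructor
  · rw [coactL_apply, HopfStar.comul_star, hL, ← coactL_apply, hx.1, TensorProduct.star_tmul,
      star_chi]
  · rw [coactR_apply, HopfStar.comul_star, hR, ← coactR_apply, hx.2, TensorProduct.star_tmul,
      star_chi]

end Bigrading

/-! ### Transmutation -/

theorem bichar_cocycle {Γ G : Type*} [CommGroup Γ] [CommGroup G] (β : Γ →* Γ →* G)
    (a b c d e : Γ) :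
    β (a⁻¹ * b) c⁻¹ * β ((a * c)⁻¹ * (b * d)) e⁻¹ =
      β (c⁻¹ * d) e⁻¹ * β (a⁻¹ * b) (c * e)⁻¹ := by
  apply Additive.ofMul.injective
  simp only [mul_inv, map_mul, map_inv, MonoidHom.mul_apply, MonoidHom.inv_apply, ofMul_mul,
    ofMul_inv]
  abel

theorem bichar_star {Γ G : Type*} [CommGroup Γ] [CommGroup G] (β : Γ →* Γ →* G) (a b c d : Γ) :
    (β (a⁻¹ * b) c⁻¹)⁻¹ * β ((a * c)⁻¹ * (b * d)) (a * c)⁻¹ =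
      β (c⁻¹ * d) c⁻¹ * β (a⁻¹ * b) a⁻¹ * β (c⁻¹⁻¹ * d⁻¹) a⁻¹⁻¹ := by
  apply Additive.ofMul.injective
  simp only [mul_inv, map_mul, map_inv, MonoidHom.mul_apply, MonoidHom.inv_apply, inv_inv,
    ofMul_mul, ofMul_inv]
  abel

section TransmutationFunctions

variable {Γ : Type*} [CommGroup Γ] {H : Type*} [Ring H] [HopfAlgebra ℂ H] [StarRing H]
  (π : HopfStarHom H (MonoidAlgebra ℂ Γ)) (β : Γ →* Γ →* Circle)

/-- The transmuted product: the bilinear extension of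
`x ·_β y = β(a⁻¹b, c⁻¹) x y` for `x ∈ H_{a,b}` and `y ∈ H_{c,d}`. -/
def transMul (x y : H) : H :=
  (components π x).sum fun g x' => (components π y).sum fun h y' =>
    (β (g.1⁻¹ * g.2) h.1⁻¹ : ℂ) • (x' * y')

/-- The transmuted involution: the antilinear extension of
`x ↦ β(a⁻¹b, a⁻¹) x*` for `x ∈ H_{a,b}`. -/
def transStar (x : H) : H :=
  (components π x).sum fun g x' => (β (g.1⁻¹ * g.2) g.1⁻¹ : ℂ) • star x'

/-- The transmuted antipode: the linear extension of
`x ↦ β(a⁻¹b, b) S(x)` for `x ∈ H_{a,b}`. -/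
def transAntipode : H →ₗ[ℂ] H :=
  (Finsupp.lsum ℂ fun g : Γ × Γ =>
    (β (g.1⁻¹ * g.2) g.2 : ℂ) • HopfAlgebra.antipode ℂ (A := H)) ∘ₗ components π

theorem transMul_of_mem {x y : H} {a b c d : Γ} (hx : x ∈ bigraded π a b)
    (hy : y ∈ bigraded π c d) :
    transMul π β x y = (β (a⁻¹ * b) c⁻¹ : ℂ) • (x * y) := by
  rw [transMul, components_of_mem π hx, components_of_mem π hy, Finsupp.sum_single_index,
    Finsupp.sum_single_index]
  · simp
  · rw [Finsupp.sum_single_index] <;> simp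

theorem transStar_of_mem {x : H} {a b : Γ} (hx : x ∈ bigraded π a b) :
    transStar π β x = (β (a⁻¹ * b) a⁻¹ : ℂ) • star x := by
  rw [transStar, components_of_mem π hx, Finsupp.sum_single_index]
  simp

theorem transAntipode_of_mem {x : H} {a b : Γ} (hx : x ∈ bigraded π a b) :
    transAntipode π β x = (β (a⁻¹ * b) b : ℂ) • HopfAlgebra.antipode ℂ x := by
  rw [transAntipode, LinearMap.comp_apply, components_of_mem π hx, Finsupp.lsum_single]
  rfl

theorem transMul_add (x y z : H) :
    transMul π β x (y + z) = transMul π β x y + transMul π β x z := by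
  simp only [transMul, LinearMap.map_add]
  rw [← Finsupp.sum_add]
  refine Finsupp.sum_congr fun g _ => ?_
  rw [Finsupp.sum_add_index'] <;> intros <;> simp [mul_add]

theorem add_transMul (x y z : H) :
    transMul π β (x + y) z = transMul π β x z + transMul π β y z := by
  simp only [transMul, LinearMap.map_add]
  rw [Finsupp.sum_add_index']
  · intro g; simp
  · intro g x y
    rw [← Finsupp.sum_add]
    refine Finsupp.sum_congr fun h _ => ?_
    simp [add_mul]

theorem transMul_zero (x : H) : transMul π β x 0 = 0 := by
  simp [transMul]

theorem zero_transMul (x : H) : transMul π β 0 x = 0 := by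
  simp [transMul]

theorem transMul_smul (c : ℂ) (x y : H) :
    transMul π β x (c • y) = c • transMul π β x y := by
  simp only [transMul, LinearMap.map_smul, Finsupp.smul_sum]
  refine Finsupp.sum_congr fun g _ => ?_
  rw [Finsupp.sum_smul_index' (by simp)]
  refine Finsupp.sum_congr fun h _ => ?_
  rw [mul_smul_comm, smul_comm]

theorem smul_transMul (c : ℂ) (x y : H) :
    transMul π β (c • x) y = c • transMul π β x y := by
  simp only [transMul, LinearMap.map_smul, Finsupp.smul_sum]
  rw [Finsupp.sum_smul_index' (by simp)]
  refine Finsupp.sum_congr fun g _ => Finsupp.sum_congr fun h _ => ?_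
  rw [smul_mul_assoc, smul_comm]

theorem transStar_add (x y : H) : transStar π β (x + y) = transStar π β x + transStar π β y := by
  simp only [transStar, LinearMap.map_add]
  rw [Finsupp.sum_add_index'] <;> intros <;> simp

theorem transStar_zero : transStar π β (0 : H) = 0 := by
  simp [transStar]

theorem transStar_smul [StarModule ℂ H] (c : ℂ) (x : H) :
    transStar π β (c • x) = star c • transStar π β x := by
  simp only [transStar, LinearMap.map_smul, Finsupp.smul_sum]
  rw [Finsupp.sum_smul_index' (by simp)]
  refine Finsupp.sum_congr fun g _ => ?_
  rw [star_smul, smul_comm]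

theorem transMul_assoc (x y z : H) :
    transMul π β (transMul π β x y) z = transMul π β x (transMul π β y z) := by
  induction x using bigraded_induction π with
  | h0 => simp only [zero_transMul]
  | ha x x' hx hx' => simp only [add_transMul, hx, hx']
  | hh a b x hx =>
  induction y using bigraded_induction π with
  | h0 => simp only [zero_transMul, transMul_zero]
  | ha y y' hy hy' => simp only [add_transMul, transMul_add, hy, hy']
  | hh c d y hy =>
  induction z using bigraded_induction π with
  | h0 => simp only [transMul_zero]
  | ha z z' hz hz' => simp only [transMul_add, hz, hz']
  | hh e f z hz =>
  rw [transMul_of_mem π β hx hy, transMul_of_mem π β hy hz, smul_transMul, transMul_smul,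
    transMul_of_mem π β (mul_mem_bigraded π hx hy) hz,
    transMul_of_mem π β hx (mul_mem_bigraded π hy hz), smul_smul, smul_smul, mul_assoc]
  congr 1
  rw [← Circle.coe_mul, ← Circle.coe_mul]
  congr 1
  exact bichar_cocycle β a b c d e

theorem one_transMul (x : H) : transMul π β 1 x = x := by
  induction x using bigraded_induction π with
  | h0 => simp only [transMul_zero]
  | ha x x' hx hx' => simp only [transMul_add, hx, hx']
  | hh a b x hx =>
  rw [transMul_of_mem π β (one_mem_bigraded π) hx]
  simp

theorem transMul_one (x : H) : transMul π β x 1 = x := by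
  induction x using bigraded_induction π with
  | h0 => simp only [zero_transMul]
  | ha x x' hx hx' => simp only [add_transMul, hx, hx']
  | hh a b x hx =>
  rw [transMul_of_mem π β hx (one_mem_bigraded π)]
  simp

variable [StarModule ℂ H] [HopfStar H]

theorem transStar_transStar (x : H) : transStar π β (transStar π β x) = x := by
  induction x using bigraded_induction π with
  | h0 => simp only [transStar_zero]
  | ha x x' hx hx' => simp only [transStar_add, hx, hx']
  | hh a b x hx =>
  rw [transStar_of_mem π β hx, transStar_smul, transStar_of_mem π β (star_mem_bigraded π hx),
    star_star, smul_smul]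
  rw [show star ((β (a⁻¹ * b) a⁻¹ : Circle) : ℂ) = ((β (a⁻¹ * b) a⁻¹)⁻¹ : Circle) from
    (Circle.coe_inv_eq_conj _).symm, ← Circle.coe_mul]
  convert one_smul ℂ x
  rw [Circle.coe_eq_one]
  simp [mul_comm]

theorem transStar_transMul (x y : H) :
    transStar π β (transMul π β x y) = transMul π β (transStar π β y) (transStar π β x) := by
  induction x using bigraded_induction π with
  | h0 => simp only [zero_transMul, transStar_zero, transMul_zero]
  | ha x x' hx hx' => simp only [add_transMul, transMul_add, transStar_add, hx, hx']
  | hh a b x hx =>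
  induction y using bigraded_induction π with
  | h0 => simp only [zero_transMul, transStar_zero, transMul_zero]
  | ha y y' hy hy' => simp only [add_transMul, transMul_add, transStar_add, hy, hy']
  | hh c d y hy =>
  rw [transMul_of_mem π β hx hy, transStar_smul,
    transStar_of_mem π β (mul_mem_bigraded π hx hy), transStar_of_mem π β hx,
    transStar_of_mem π β hy, smul_transMul, transMul_smul,
    transMul_of_mem π β (star_mem_bigraded π hy) (star_mem_bigraded π hx), star_mul,
    smul_smul, smul_smul, smul_smul]
  congr 1
  rw [show star ((β (a⁻¹ * b) c⁻¹ : Circle) : ℂ) = ((β (a⁻¹ * b) c⁻¹)⁻¹ : Circle) from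
    (Circle.coe_inv_eq_conj _).symm, ← Circle.coe_mul, ← Circle.coe_mul, ← Circle.coe_mul]
  congr 1
  exact bichar_star β a b c d

end TransmutationFunctions

/-- The transmutation `H_β` of a Hopf star-algebra `H` along a Hopf star-algebra homomorphism
`π : H → ℂΓ` and a bicharacter `β` of `Γ`: the coalgebra `H` with the transmuted product and
involution. -/
def Transmutation {Γ : Type*} [CommGroup Γ] {H : Type*} [Ring H] [HopfAlgebra ℂ H] [StarRing H]
    (_π : HopfStarHom H (MonoidAlgebra ℂ Γ)) (_β : Γ →* Γ →* Circle) := H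

namespace Transmutation

variable {Γ : Type*} [CommGroup Γ] {H : Type*} [Ring H] [HopfAlgebra ℂ H] [StarRing H]
  (π : HopfStarHom H (MonoidAlgebra ℂ Γ)) (β : Γ →* Γ →* Circle)

instance : AddCommGroup (Transmutation π β) := inferInstanceAs (AddCommGroup H)

instance : Module ℂ (Transmutation π β) := inferInstanceAs (Module ℂ H)

instance : Coalgebra ℂ (Transmutation π β) := inferInstanceAs (Coalgebra ℂ H)

/-- The identity map `H → H_β`. -/
def of : H ≃ₗ[ℂ] Transmutation π β := LinearEquiv.refl ℂ H

instance : Ring (Transmutation π β) :=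
  { (inferInstance : AddCommGroup (Transmutation π β)) with
    mul := fun x y => of π β (transMul π β ((of π β).symm x) ((of π β).symm y))
    one := of π β 1
    left_distrib := fun x y z => transMul_add π β x y z
    right_distrib := fun x y z => add_transMul π β x y z
    zero_mul := fun x => zero_transMul π β x
    mul_zero := fun x => transMul_zero π β x
    mul_assoc := fun x y z => transMul_assoc π β x y z
    one_mul := fun x => one_transMul π β x
    mul_one := fun x => transMul_one π β x }

instance : Algebra ℂ (Transmutation π β) :=
  Algebra.ofModule (fun c x y => smul_transMul π β c x y) (fun c x y => transMul_smul π β c x y)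

theorem of_mul_of (x y : H) : of π β x * of π β y = of π β (transMul π β x y) := rfl

theorem of_one : of π β 1 = 1 := rfl

variable [StarModule ℂ H] [HopfStar H]

instance : StarRing (Transmutation π β) where
  star := fun x => of π β (transStar π β ((of π β).symm x))
  star_involutive := fun x => transStar_transStar π β x
  star_mul := fun x y => transStar_transMul π β x y
  star_add := fun x y => transStar_add π β x y

instance : StarModule ℂ (Transmutation π β) where
  star_smul := fun c x => transStar_smul π β c x

theorem star_of (x : H) : star (of π β x) = of π β (transStar π β x) := rfl

/-- The adjoint coaction `ad(x) = x_(2) ⊗ S(x_(1)) x_(3)`. -/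
def adjointCoact (H : Type*) [Ring H] [HopfAlgebra ℂ H] : H →ₗ[ℂ] H ⊗[ℂ] H :=
  TensorProduct.lift
      (LinearMap.lTensorHom H ∘ₗ LinearMap.mul ℂ H ∘ₗ HopfAlgebra.antipode ℂ (A := H)) ∘ₗ
    (Coalgebra.comul (R := ℂ) (A := H)).lTensor H ∘ₗ Coalgebra.comul (R := ℂ) (A := H)

/-- The coaction `ad_π = (ι ⊗ π) ad` of `ℂΓ` on `H_β`. -/
def coact : Transmutation π β →ₗ[ℂ] Transmutation π β ⊗[ℂ] MonoidAlgebra ℂ Γ :=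
  TensorProduct.map (of π β).toLinearMap (piLin π) ∘ₗ adjointCoact H ∘ₗ (of π β).symm.toLinearMap

/-- The antipode of `H_β`. -/
def antipode : Transmutation π β →ₗ[ℂ] Transmutation π β :=
  (of π β).toLinearMap ∘ₗ transAntipode π β ∘ₗ (of π β).symm.toLinearMap

end Transmutation

/-! ### Comodules and braided tensor products

In this section `K` is a Hopf star-algebra, `R : K ⊗ K → ℂ` is a linear functional (a
coquasitriangular structure in the applications), and all comodules are right `K`-comodules. -/

section Braided

variable {K : Type*} [Ring K] [HopfAlgebra ℂ K]

/-- Coactions of a coalgebra `C` on a vector space. -/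
structure IsCoaction {M C : Type*} [AddCommGroup M] [Module ℂ M] [AddCommGroup C] [Module ℂ C]
    [Coalgebra ℂ C] (δ : M →ₗ[ℂ] M ⊗[ℂ] C) : Prop where
  coassoc : ∀ x, TensorProduct.assoc ℂ M C C (δ.rTensor C (δ x)) =
    (Coalgebra.comul (R := ℂ) (A := C)).lTensor M (δ x)
  counit : ∀ x, TensorProduct.rid ℂ M ((Coalgebra.counit (R := ℂ) (A := C)).lTensor M (δ x)) = x

/-- The tensor product of coactions: `m ⊗ n ↦ m⁽¹⁾ ⊗ n⁽¹⁾ ⊗ m⁽²⁾ n⁽²⁾`. -/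
def tensorCoact {M N : Type*} [AddCommGroup M] [Module ℂ M] [AddCommGroup N] [Module ℂ N]
    (δM : M →ₗ[ℂ] M ⊗[ℂ] K) (δN : N →ₗ[ℂ] N ⊗[ℂ] K) :
    M ⊗[ℂ] N →ₗ[ℂ] (M ⊗[ℂ] N) ⊗[ℂ] K :=
  (LinearMap.mul' ℂ K).lTensor (M ⊗[ℂ] N) ∘ₗ
    (TensorProduct.tensorTensorTensorComm ℂ M K N K).toLinearMap ∘ₗ TensorProduct.map δM δN

/-- The braiding `m ⊗ n ↦ R(m⁽²⁾, n⁽²⁾) n⁽¹⁾ ⊗ m⁽¹⁾`. -/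
def braiding (R : K ⊗[ℂ] K →ₗ[ℂ] ℂ) {M N : Type*} [AddCommGroup M] [Module ℂ M]
    [AddCommGroup N] [Module ℂ N] (δM : M →ₗ[ℂ] M ⊗[ℂ] K) (δN : N →ₗ[ℂ] N ⊗[ℂ] K) :
    M ⊗[ℂ] N →ₗ[ℂ] N ⊗[ℂ] M :=
  (TensorProduct.rid ℂ (N ⊗[ℂ] M)).toLinearMap ∘ₗ
    TensorProduct.map (TensorProduct.comm ℂ M N).toLinearMap R ∘ₗ
      (TensorProduct.tensorTensorTensorComm ℂ M K N K).toLinearMap ∘ₗ TensorProduct.map δM δN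

/-- The product of the braided tensor product `A ⊗_R B`:
`(a ⊗ b)(a' ⊗ b') = R(b⁽²⁾, a'⁽²⁾) a a'⁽¹⁾ ⊗ b⁽¹⁾ b'`. -/
def braidedMul (R : K ⊗[ℂ] K →ₗ[ℂ] ℂ) {A B : Type*} [Ring A] [Algebra ℂ A] [Ring B]
    [Algebra ℂ B] (δA : A →ₗ[ℂ] A ⊗[ℂ] K) (δB : B →ₗ[ℂ] B ⊗[ℂ] K) :
    (A ⊗[ℂ] B) ⊗[ℂ] (A ⊗[ℂ] B) →ₗ[ℂ] A ⊗[ℂ] B :=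
  TensorProduct.map (LinearMap.mul' ℂ A) (LinearMap.mul' ℂ B) ∘ₗ
    (TensorProduct.assoc ℂ A A (B ⊗[ℂ] B)).symm.toLinearMap ∘ₗ
      ((TensorProduct.assoc ℂ A B B).toLinearMap ∘ₗ (braiding R δB δA).rTensor B ∘ₗ
        (TensorProduct.assoc ℂ B A B).symm.toLinearMap).lTensor A ∘ₗ
          (TensorProduct.assoc ℂ A B (A ⊗[ℂ] B)).toLinearMap

/-- The involution of the braided tensor product `A ⊗_R B`:
`(a ⊗ b)* = (1 ⊗ b*)(a* ⊗ 1) = R(b*⁽²⁾, a*⁽²⁾) a*⁽¹⁾ ⊗ b*⁽¹⁾`. -/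
def braidedStar (R : K ⊗[ℂ] K →ₗ[ℂ] ℂ) {A B : Type*} [Ring A] [Algebra ℂ A] [StarRing A]
    [StarModule ℂ A] [Ring B] [Algebra ℂ B] [StarRing B] [StarModule ℂ B]
    (δA : A →ₗ[ℂ] A ⊗[ℂ] K) (δB : B →ₗ[ℂ] B ⊗[ℂ] K) (x : A ⊗[ℂ] B) : A ⊗[ℂ] B :=
  braiding R δB δA (TensorProduct.comm ℂ A B (star x))

theorem braiding_tmul_of_eq (R : K ⊗[ℂ] K →ₗ[ℂ] ℂ) {M N : Type*} [AddCommGroup M] [Module ℂ M]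
    [AddCommGroup N] [Module ℂ N] (δM : M →ₗ[ℂ] M ⊗[ℂ] K) (δN : N →ₗ[ℂ] N ⊗[ℂ] K)
    {m : M} {n : N} {k l : K} (hm : δM m = m ⊗ₜ k) (hn : δN n = n ⊗ₜ l) :
    braiding R δM δN (m ⊗ₜ n) = R (k ⊗ₜ l) • (n ⊗ₜ[ℂ] m) := by
  simp [braiding, hm, hn]

theorem braidedMul_tmul_of_eq (R : K ⊗[ℂ] K →ₗ[ℂ] ℂ) {A B : Type*} [Ring A] [Algebra ℂ A] [Ring B]
    [Algebra ℂ B] (δA : A →ₗ[ℂ] A ⊗[ℂ] K) (δB : B →ₗ[ℂ] B ⊗[ℂ] K)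
    (a a' : A) (b b' : B) {k l : K} (hb : δB b = b ⊗ₜ k) (ha : δA a' = a' ⊗ₜ l) :
    braidedMul R δA δB ((a ⊗ₜ b) ⊗ₜ (a' ⊗ₜ b')) = R (k ⊗ₜ l) • ((a * a') ⊗ₜ[ℂ] (b * b')) := by
  simp [braidedMul, braiding_tmul_of_eq R δB δA hb ha, TensorProduct.smul_tmul']

theorem braidedStar_tmul_of_eq (R : K ⊗[ℂ] K →ₗ[ℂ] ℂ) {A B : Type*} [Ring A] [Algebra ℂ A]
    [StarRing A] [StarModule ℂ A] [Ring B] [Algebra ℂ B] [StarRing B] [StarModule ℂ B]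
    (δA : A →ₗ[ℂ] A ⊗[ℂ] K) (δB : B →ₗ[ℂ] B ⊗[ℂ] K) (a : A) (b : B) {k l : K}
    (hb : δB (star b) = star b ⊗ₜ k) (ha : δA (star a) = star a ⊗ₜ l) :
    braidedStar R δA δB (a ⊗ₜ b) = R (k ⊗ₜ l) • (star a ⊗ₜ[ℂ] star b) := by
  simp [braidedStar, braiding_tmul_of_eq R δB δA hb ha]

/-! ### Braided Hopf star-algebras -/

/-- `A`, with the coaction `δ` of `K`, its coproduct, counit, and the map `S` as the antipode, is
a Hopf star-algebra in the braided monoidal category of `K`-comodules with the braiding defined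
by `R`. -/
structure IsBraidedHopfStar [StarRing K] [StarModule ℂ K] (R : K ⊗[ℂ] K →ₗ[ℂ] ℂ)
    {A : Type*} [Ring A] [Algebra ℂ A] [StarRing A] [StarModule ℂ A] [Coalgebra ℂ A]
    (δ : A →ₗ[ℂ] A ⊗[ℂ] K) (S : A →ₗ[ℂ] A) : Prop where
  /-- `A` is a `K`-comodule star-algebra. -/
  coaction : IsCoaction δ
  coaction_mul : ∀ x y, δ (x * y) = δ x * δ y
  coaction_one : δ 1 = 1
  coaction_star : ∀ x, δ (star x) = star (δ x)
  /-- The coproduct is a comodule map. -/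
  comul_equivariant : ∀ x, tensorCoact δ δ (Coalgebra.comul (R := ℂ) x) =
    (Coalgebra.comul (R := ℂ) (A := A)).rTensor K (δ x)
  /-- The coproduct is a unital star-homomorphism `A → A ⊗_R A`. -/
  comul_mul : ∀ x y : A, Coalgebra.comul (R := ℂ) (x * y) =
    braidedMul R δ δ (Coalgebra.comul (R := ℂ) x ⊗ₜ Coalgebra.comul (R := ℂ) y)
  comul_one : Coalgebra.comul (R := ℂ) (1 : A) = 1 ⊗ₜ 1
  comul_star : ∀ x : A, Coalgebra.comul (R := ℂ) (star x) =
    braidedStar R δ δ (Coalgebra.comul (R := ℂ) x)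
  /-- The counit is a comodule map. -/
  counit_equivariant : ∀ x, TensorProduct.lid ℂ K
    ((Coalgebra.counit (R := ℂ) (A := A)).rTensor K (δ x)) =
      algebraMap ℂ K (Coalgebra.counit (R := ℂ) x)
  /-- The counit is a unital star-homomorphism. -/
  counit_mul : ∀ x y : A, Coalgebra.counit (R := ℂ) (x * y) =
    Coalgebra.counit (R := ℂ) x * Coalgebra.counit (R := ℂ) y
  counit_one : Coalgebra.counit (R := ℂ) (1 : A) = 1
  counit_star : ∀ x : A, Coalgebra.counit (R := ℂ) (star x) = star (Coalgebra.counit (R := ℂ) x)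
  /-- The antipode is a comodule map. -/
  antipode_equivariant : ∀ x, δ (S x) = S.rTensor K (δ x)
  antipode_left : ∀ x : A, LinearMap.mul' ℂ A (S.rTensor A (Coalgebra.comul (R := ℂ) x)) =
    algebraMap ℂ A (Coalgebra.counit (R := ℂ) x)
  antipode_right : ∀ x : A, LinearMap.mul' ℂ A (S.lTensor A (Coalgebra.comul (R := ℂ) x)) =
    algebraMap ℂ A (Coalgebra.counit (R := ℂ) x)

/-! ### Comodules over braided Hopf star-algebras -/

/-- The coaction `δ_U(e_j) = ∑_i e_i ⊗ u_ij` defined by a matrix `U`. -/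
def matCoact {n C : Type*} [Fintype n] [DecidableEq n] [AddCommGroup C] [Module ℂ C]
    (U : Matrix n n C) : (n → ℂ) →ₗ[ℂ] (n → ℂ) ⊗[ℂ] C :=
  (Pi.basisFun ℂ n).constr ℂ fun j => ∑ i, Pi.single i (1 : ℂ) ⊗ₜ[ℂ] U i j

theorem matCoact_single {n C : Type*} [Fintype n] [DecidableEq n] [AddCommGroup C] [Module ℂ C]
    (U : Matrix n n C) (j : n) :
    matCoact U (Pi.single j 1) = ∑ i, Pi.single i (1 : ℂ) ⊗ₜ[ℂ] U i j := by
  rw [matCoact, ← Pi.basisFun_apply, Module.Basis.constr_basis]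

/-- The conjugate matrix `Ū_Z` with entries `∑_{s,l,t} R(z_tj* z_sl, z_il*) u_st*`. -/
def barZ [StarRing K] (R : K ⊗[ℂ] K →ₗ[ℂ] ℂ) {n B : Type*} [Fintype n] [AddCommGroup B]
    [Module ℂ B] [Star B] (Z : Matrix n n K) (U : Matrix n n B) : Matrix n n B :=
  Matrix.of fun i j => ∑ s, ∑ l, ∑ t, R ((star (Z t j) * Z s l) ⊗ₜ star (Z i l)) • star (U s t)

variable {n : Type*} [Fintype n] [DecidableEq n]

/-- The pair `(Z, U)` defines an `A`-comodule with underlying vector space `ℂⁿ`: `δ_Z` is a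
`K`-comodule, `δ_U` is a comodule over the coalgebra `A`, and `δ_U : M → M ⊗ A` is a map of
`K`-comodules. -/
structure IsComodulePair {A : Type*} [Ring A] [Algebra ℂ A] [Coalgebra ℂ A]
    (δ : A →ₗ[ℂ] A ⊗[ℂ] K) (Z : Matrix n n K) (U : Matrix n n A) : Prop where
  corep_left : IsCorepMatrix Z
  corep_right : IsCorepMatrix U
  equivariant : (matCoact U).rTensor K ∘ₗ matCoact Z = tensorCoact (matCoact Z) δ ∘ₗ matCoact U

/-- The pair `(Z, U)` defines a unitary `A`-comodule: the corepresentation matrix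
`W = (∑_k z_ik # u_kj)` of the smash product `K # A = K ⊗_R A` is unitary. -/
structure IsUnitaryPair [StarRing K] [StarModule ℂ K] (R : K ⊗[ℂ] K →ₗ[ℂ] ℂ)
    {A : Type*} [Ring A] [Algebra ℂ A] [StarRing A] [StarModule ℂ A] [Coalgebra ℂ A]
    (δ : A →ₗ[ℂ] A ⊗[ℂ] K) (Z : Matrix n n K) (U : Matrix n n A) : Prop where
  comodule : IsComodulePair δ Z U
  star_mul : ∀ i j, ∑ k, braidedMul R (Coalgebra.comul (R := ℂ) (A := K)) δ
    (braidedStar R (Coalgebra.comul (R := ℂ) (A := K)) δ (FreeUnitary.tensorMat Z U k i) ⊗ₜ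
      FreeUnitary.tensorMat Z U k j) = if i = j then 1 ⊗ₜ 1 else 0
  mul_star : ∀ i j, ∑ k, braidedMul R (Coalgebra.comul (R := ℂ) (A := K)) δ
    (FreeUnitary.tensorMat Z U i k ⊗ₜ
      braidedStar R (Coalgebra.comul (R := ℂ) (A := K)) δ (FreeUnitary.tensorMat Z U j k)) =
        if i = j then 1 ⊗ₜ 1 else 0

/-- The pair `(Z, U)` defines a unitarizable `A`-comodule: it becomes unitary in some basis. -/
def IsUnitarizablePair [StarRing K] [StarModule ℂ K] (R : K ⊗[ℂ] K →ₗ[ℂ] ℂ)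
    {A : Type*} [Ring A] [Algebra ℂ A] [StarRing A] [StarModule ℂ A] [Coalgebra ℂ A]
    (δ : A →ₗ[ℂ] A ⊗[ℂ] K) (Z : Matrix n n K) (U : Matrix n n A) : Prop :=
  IsComodulePair δ Z U ∧ ∃ G : GL n ℂ, IsUnitaryPair R δ (conjBy G Z) (conjBy G U)

end Braided

/-! ### Braided compact matrix quantum groups -/

/-- The linear extension `ℂΓ ⊗ ℂΓ → ℂ` of a bicharacter of `Γ`. -/
def bicharForm {Γ : Type*} [CommGroup Γ] (β : Γ →* Γ →* Circle) :
    MonoidAlgebra ℂ Γ ⊗[ℂ] MonoidAlgebra ℂ Γ →ₗ[ℂ] ℂ :=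
  (Finsupp.lsum ℂ fun a : Γ => (Finsupp.lsum ℂ fun b : Γ => (β a b : ℂ) • LinearMap.id) ∘ₗ
      (MonoidAlgebra.coeffLinearEquiv ℂ).toLinearMap) ∘ₗ coeffL (MonoidAlgebra ℂ Γ)

theorem bicharForm_chi {Γ : Type*} [CommGroup Γ] (β : Γ →* Γ →* Circle) (a b : Γ) :
    bicharForm β (chi a ⊗ₜ chi b) = β a b := by
  rw [bicharForm, LinearMap.comp_apply, coeffL_chi, Finsupp.lsum_single]
  simp [chi]

/-- `A`, with the coaction `δ` of `ℂ[T] = ℂΓ`, where `Γ` is the dual of `T`, the antipode `S` and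
the matrix `U`, is a braided compact matrix quantum group over `(T, Z, β)` with fundamental
unitary `U`. -/
structure IsBraidedCMQG {Γ : Type*} [CommGroup Γ] (β : Γ →* Γ →* Circle)
    {n : Type*} [Fintype n] [DecidableEq n] (Z : Matrix n n (MonoidAlgebra ℂ Γ))
    {A : Type*} [Ring A] [Algebra ℂ A] [StarRing A] [StarModule ℂ A] [Coalgebra ℂ A]
    (δ : A →ₗ[ℂ] A ⊗[ℂ] MonoidAlgebra ℂ Γ) (S : A →ₗ[ℂ] A) (U : Matrix n n A) : Prop where
  hopf : IsBraidedHopfStar (bicharForm β) δ S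
  generated : StarAlgebra.adjoin ℂ {x | ∃ i j, x = U i j} = ⊤
  unitary : IsUnitaryPair (bicharForm β) δ Z U
  conjugate : IsUnitarizablePair (bicharForm β) δ (barMat Z) (barZ (bicharForm β) Z U)

/-! ### Braided free unitary quantum groups -/

section BraidedFreeUnitary

variable {Γ : Type*} [CommGroup Γ] {n : Type*} [Fintype n] [DecidableEq n]

/-- The transmutation `ℂ[U_F⁺]_β` along the homomorphism `ℂ[U_F⁺] → ℂΓ` mapping the fundamental
unitary to `Z`. -/
abbrev BraidedFreeUnitary (F : GL n ℂ) (Z : Matrix n n (MonoidAlgebra ℂ Γ)) (hc : IsCorepMatrix Z)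
    (hZ : Z ∈ unitary (Matrix n n (MonoidAlgebra ℂ Γ)))
    (hFZ : conjBy F (barMat Z) ∈ unitary (Matrix n n (MonoidAlgebra ℂ Γ)))
    (β : Γ →* Γ →* Circle) : Type _ :=
  Transmutation (FreeUnitary.toHopf (F := F) Z hc hZ hFZ) β

/-- The matrix `U` of the generators of `ℂ[U_F⁺]`, viewed as a matrix over the transmutation. -/
def BraidedFreeUnitary.U (F : GL n ℂ) (Z : Matrix n n (MonoidAlgebra ℂ Γ)) (hc : IsCorepMatrix Z)
    (hZ : Z ∈ unitary (Matrix n n (MonoidAlgebra ℂ Γ)))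
    (hFZ : conjBy F (barMat Z) ∈ unitary (Matrix n n (MonoidAlgebra ℂ Γ)))
    (β : Γ →* Γ →* Circle) : Matrix n n (BraidedFreeUnitary F Z hc hZ hFZ β) :=
  (FreeUnitary.U F).map (Transmutation.of _ β)

end BraidedFreeUnitary

end

set_option linter.unusedVariables false

noncomputable section

/-! ### Diagonalization of unitary corepresentations of group algebras -/

section Diagonalization

variable {Γ : Type*} [CommGroup Γ] {n : Type*} [Fintype n] [DecidableEq n]

/-! Write H for ℂ[U_F⁺] and Γ for the dual of T. The map π grades H by Γ × Γ, and the transmutation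
multiplies the product of elements of degrees (a, b) and (c, d) by β(a⁻¹b, c⁻¹). This scalar is a
bicharacter of Γ × Γ, hence a 2-cocycle, so H_β is a cocycle twist of a graded algebra. Statements
about H_β reduce to homogeneous elements, where they become identities between values of β. A
relation Σ x_k y_k = c of H survives the twist when the scalar is the same for all terms of the sum
and is 1 whenever c ≠ 0.

Homogeneous generators come from diagonalizing Z. The coefficient matrices of a unitary
corepresentation of Γ are orthogonal projections with sum 1 (`exists_diagonalization`), so in a
suitable orthonormal basis, with change of basis g, Z is diagonal with entries a_i, and U' = g⁻¹Ug
has entries of degree (a_i, a_j) (`conjBy_inv_mem_bigraded`). Properties of homogeneous elements are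
then proved on the u'_ij and their adjoints (`homogeneous_induction`).

The braided Hopf axioms use two facts: Δ maps H_{a,b} into ⨁_e H_{a,e} ⊗ H_{e,b}, and S maps H_{a,b}
into H_{b⁻¹,a⁻¹}. They make the coaction on H_{a,b} the multiplication by the single degree a⁻¹b,
and in Δ(x)Δ(y) the braiding scalar and the two transmutation scalars combine to a value that does
not depend on the intermediate degrees (`braidedMul_ofTwo`). The fact about S needs that F Z̄ F⁻¹ is
unitary: this makes F*F block diagonal in the basis that diagonalizes Z
(`blockDiagonal_of_conjBy_mem_unitary`).

For unitarity of comodules, the assignment x ↦ χ_b ⊗ x for x ∈ H_{b,c} respects products and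
adjoints when its target is ℂΓ ⊗_β H_β: all scalars cancel. So every unitary corepresentation matrix
of H gives a unitary comodule over H_β (`isUnitaryPair`). Moreover Ū_Z computed in H_β is Ū computed
in H (`barZ_map_of`), so the conjugate comodule is handled by the unitary corepresentation F Ū F⁻¹
of H.

For the universal property the twist has to be undone, but the target B has no grading. Operators on
functions Γ → B that shift the argument and multiply by characters supply one: `twistOp` satisfies
the inverse cocycle relation (`twistOp_mul`). A matrix V over B with the relations of H_β then
yields operators with the relations of H, hence a representation of H by operators, and reading off
the B-component of each homogeneous element gives the homomorphism H_β → B. -/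

theorem coeff_star_groupAlg (k : MonoidAlgebra ℂ Γ) (a : Γ) :
    (star k).coeff a = star (k.coeff a⁻¹) := by
  classical
  induction k using MonoidAlgebra.induction_linear with
  | zero => simp
  | add f g hf hg => simp [star_add, hf, hg]
  | single b c =>
    simp only [GroupAlg.star_single, MonoidAlgebra.coeff_single, Finsupp.single_apply,
      inv_eq_iff_eq_inv]
    split_ifs <;> simp

theorem coeff_antipode_groupAlg (k : MonoidAlgebra ℂ Γ) (a : Γ) :
    (HopfAlgebra.antipode ℂ k).coeff a = k.coeff a⁻¹ := by
  classical
  induction k using MonoidAlgebra.induction_linear with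
  | zero => simp
  | add f g hf hg => simp [hf, hg]
  | single b c =>
    simp [MonoidAlgebra.antipode_single, Finsupp.single_apply, inv_eq_iff_eq_inv]

theorem sum_antipode_mul_of_isCorepMatrix {K : Type*} [Ring K] [HopfAlgebra ℂ K]
    {X : Matrix n n K} (hX : IsCorepMatrix X) (i j : n) :
    ∑ k, HopfAlgebra.antipode ℂ (X i k) * X k j = (1 : Matrix n n K) i j := by
  have h := HopfAlgebra.mul_antipode_rTensor_comul_apply (R := ℂ) (X i j)
  rw [hX.comul, hX.counit] at h
  simp only [map_sum, LinearMap.rTensor_tmul, LinearMap.mul'_apply] at h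
  rw [h]
  by_cases hij : i = j
  · subst hij; simp
  · simp [hij]

theorem sum_mul_antipode_of_isCorepMatrix {K : Type*} [Ring K] [HopfAlgebra ℂ K]
    {X : Matrix n n K} (hX : IsCorepMatrix X) (i j : n) :
    ∑ k, X i k * HopfAlgebra.antipode ℂ (X k j) = (1 : Matrix n n K) i j := by
  have h := HopfAlgebra.mul_antipode_lTensor_comul_apply (R := ℂ) (X i j)
  rw [hX.comul, hX.counit] at h
  simp only [map_sum, LinearMap.lTensor_tmul, LinearMap.mul'_apply] at h
  rw [h]
  by_cases hij : i = j
  · subst hij; simp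
  · simp [hij]

/-- The antipode on the entries of a unitary corepresentation matrix. -/
theorem antipode_of_isCorepMatrix {K : Type*} [Ring K] [HopfAlgebra ℂ K] [StarRing K]
    {X : Matrix n n K} (hX : IsCorepMatrix X) (hu : X ∈ unitary (Matrix n n K)) (i j : n) :
    HopfAlgebra.antipode ℂ (X i j) = star (X j i) := by
  have h : X.map (HopfAlgebra.antipode ℂ) * X = 1 := by
    ext i j
    rw [Matrix.mul_apply]
    exact sum_antipode_mul_of_isCorepMatrix hX i j
  have h' : X.map (HopfAlgebra.antipode ℂ) = star X := by
    calc _ = X.map (HopfAlgebra.antipode ℂ) * (X * star X) := by rw [hu.2, mul_one]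
      _ = star X := by rw [← mul_assoc, h, one_mul]
  exact congrFun (congrFun h' i) j

/-- The coefficients of the coproduct of an element of the group algebra. -/
def coeffTwo (a b : Γ) : MonoidAlgebra ℂ Γ ⊗[ℂ] MonoidAlgebra ℂ Γ →ₗ[ℂ] ℂ :=
  TensorProduct.lift ((LinearMap.mul ℂ ℂ).compl₁₂
    (Finsupp.lapply a ∘ₗ (MonoidAlgebra.coeffLinearEquiv ℂ).toLinearMap)
    (Finsupp.lapply b ∘ₗ (MonoidAlgebra.coeffLinearEquiv ℂ).toLinearMap))

theorem coeffTwo_tmul (a b : Γ) (k l : MonoidAlgebra ℂ Γ) :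
    coeffTwo a b (k ⊗ₜ l) = k.coeff a * l.coeff b := by
  simp [coeffTwo]

open scoped Classical in
theorem coeffTwo_comul (a b : Γ) (k : MonoidAlgebra ℂ Γ) :
    coeffTwo a b (Coalgebra.comul (R := ℂ) k) = if a = b then k.coeff a else 0 := by
  induction k using MonoidAlgebra.induction_linear with
  | zero => simp
  | add f g hf hg =>
    simp only [map_add, hf, hg, MonoidAlgebra.coeff_add, Finsupp.add_apply]
    split_ifs <;> simp
  | single c z =>
    rw [single_eq_smul_chi, map_smul, comul_chi, map_smul, coeffTwo_tmul]
    simp only [chi, MonoidAlgebra.coeff_single, Finsupp.single_apply, MonoidAlgebra.coeff_smul,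
      Finsupp.smul_apply]
    by_cases hab : a = b <;> by_cases hc : c = a
    · subst hab hc; simp
    · subst hab; simp [hc]
    · subst hc; simp [hab]
    · simp [hab, hc]

open scoped Classical in
-- Compare the coefficients of a ⊗ b on the two sides of Δ(z_ij) = Σ_k z_ik ⊗ z_kj. Group elements
-- are group-like, so only the diagonal coefficients a = b occur on the left. Thus the coefficient
-- matrices of Z are mutually orthogonal idempotents.
theorem coeff_mul_coeff_of_isCorepMatrix {Z : Matrix n n (MonoidAlgebra ℂ Γ)}
    (hc : IsCorepMatrix Z) (a b : Γ) :
    Z.map (fun k => k.coeff a) * Z.map (fun k => k.coeff b) =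
      if a = b then Z.map (fun k => k.coeff a) else 0 := by
  ext i j
  have h := coeffTwo_comul a b (Z i j)
  rw [hc.comul, map_sum] at h
  simp only [coeffTwo_tmul] at h
  rw [Matrix.mul_apply]
  simp only [Matrix.map_apply]
  rw [h]
  split_ifs <;> simp

theorem counit_eq_sum_coeff (k : MonoidAlgebra ℂ Γ) (s : Finset Γ) (hs : k.coeff.support ⊆ s) :
    Coalgebra.counit (R := ℂ) k = ∑ a ∈ s, k.coeff a := by
  have h : Coalgebra.counit (R := ℂ) k = k.coeff.sum fun _ c => c := by
    clear hs
    induction k using MonoidAlgebra.induction_linear with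
    | zero => simp
    | add f g hf hg =>
      rw [map_add, MonoidAlgebra.coeff_add,
        Finsupp.sum_add_index' (fun _ => rfl) (fun _ _ _ => rfl)]
      rw [hf, hg]
    | single c z => simp
  rw [h, Finsupp.sum_of_support_subset _ hs _ (fun _ _ => rfl)]

/-- A unitary corepresentation matrix of a group algebra is diagonal in some orthonormal basis. -/
theorem exists_diagonalization {Z : Matrix n n (MonoidAlgebra ℂ Γ)} (hc : IsCorepMatrix Z)
    (hZ : Z ∈ unitary (Matrix n n (MonoidAlgebra ℂ Γ))) :
    ∃ w ∈ unitary (Matrix n n ℂ), ∃ a : n → Γ,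
      Z = scalarMat _ w * Matrix.diagonal (fun i => chi (a i)) * scalarMat _ (star w) := by
  classical
  set P : Γ → Matrix n n ℂ := fun a => Z.map (fun k => k.coeff a) with hP
  set s : Finset Γ := Finset.univ.biUnion fun i => Finset.univ.biUnion fun j =>
    (Z i j).coeff.support with hs
  have hsub : ∀ i j, (Z i j).coeff.support ⊆ s := fun i j =>
    (Finset.subset_biUnion_of_mem (fun j => (Z i j).coeff.support) (Finset.mem_univ j)).trans
      (Finset.subset_biUnion_of_mem (fun i => Finset.univ.biUnion fun j =>
        (Z i j).coeff.support) (Finset.mem_univ i))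
  have hP0 : ∀ a, a ∉ s → P a = 0 := fun a ha => by
    ext i j
    exact Finsupp.notMem_support_iff.1 fun h => ha (hsub i j h)
  have hPP : ∀ a b, P a * P b = if a = b then P a else 0 :=
    coeff_mul_coeff_of_isCorepMatrix hc
  have hsum : ∑ a ∈ s, P a = 1 := by
    ext i j
    rw [Matrix.sum_apply, ← hc.counit i j, counit_eq_sum_coeff _ s (hsub i j)]
    rfl
  -- Unitarity enters here: S(z_ij) = z_ji*, and both the antipode and the star invert group
  -- elements, so the idempotents are self-adjoint.
  have hherm : ∀ a, star (P a) = P a := fun a => by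
    ext i j
    have h := congrArg (fun k => k.coeff a⁻¹) (antipode_of_isCorepMatrix hc hZ i j)
    simp only [coeff_antipode_groupAlg, coeff_star_groupAlg, inv_inv] at h
    simp [Matrix.star_apply, hP, h]
  -- Distinct natural numbers label the finitely many group elements in Z. The Hermitian matrix Σ
  -- f(a) P_a then separates the projections P_a, and one application of the spectral theorem
  -- diagonalizes all of them at once.
  obtain ⟨f, hf⟩ := Set.countable_iff_exists_injOn.1 s.countable_toSet
  set N : Matrix n n ℂ := ∑ a ∈ s, (f a : ℂ) • P a with hN
  have hNP : ∀ a ∈ s, N * P a = (f a : ℂ) • P a := fun a ha => by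
    rw [hN, Finset.sum_mul, Finset.sum_eq_single a]
    · rw [smul_mul_assoc, hPP, if_pos rfl]
    · intro b _ hb
      rw [smul_mul_assoc, hPP, if_neg hb, smul_zero]
    · exact fun h => absurd ha h
  have hNh : N.IsHermitian := by
    rw [Matrix.IsHermitian, ← Matrix.star_eq_conjTranspose, hN, star_sum]
    simp [star_smul, hherm]
  set w : Matrix n n ℂ := hNh.eigenvectorUnitary.1 with hw
  have hwu : w ∈ unitary (Matrix n n ℂ) := hNh.eigenvectorUnitary.2
  set μ : n → ℂ := fun i => (hNh.eigenvalues i : ℂ) with hμ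
  have hdiag : N = w * Matrix.diagonal μ * star w := hNh.spectral_theorem
  set Q : Γ → Matrix n n ℂ := fun a => star w * P a * w with hQ
  have hQsum : ∑ a ∈ s, Q a = 1 := by
    rw [← Finset.sum_mul, ← Finset.mul_sum, hsum, mul_one, hwu.1]
  have hμQ : ∀ a ∈ s, Matrix.diagonal μ * Q a = (f a : ℂ) • Q a := fun a ha => by
    calc _ = star w * (w * Matrix.diagonal μ * star w) * P a * w := by
          simp only [hQ, ← mul_assoc, hwu.1, one_mul]
      _ = star w * (N * P a) * w := by rw [← hdiag, mul_assoc (star w)]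
      _ = _ := by rw [hNP a ha, mul_smul_comm, smul_mul_assoc]
  have hent : ∀ a ∈ s, ∀ i j, (μ i - f a) * Q a i j = 0 := fun a ha i j => by
    have h := congrFun (congrFun (hμQ a ha) i) j
    rw [Matrix.diagonal_mul, Matrix.smul_apply, smul_eq_mul] at h
    rw [sub_mul, h, sub_self]
  -- The matrices Q_a sum to 1, so some Q_a has a nonzero (i, i) entry, and `hent` forces the i-th
  -- eigenvalue to be f(a).
  have hex : ∀ i, ∃ a ∈ s, μ i = f a := fun i => by
    by_contra! h
    have h1 : ∀ a ∈ s, Q a i i = 0 := fun a ha =>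
      (mul_eq_zero.1 (hent a ha i i)).resolve_left (sub_ne_zero.2 (h a ha))
    have h2 := congrFun (congrFun hQsum i) i
    rw [Matrix.sum_apply, Finset.sum_eq_zero h1, Matrix.one_apply_eq] at h2
    exact zero_ne_one h2
  choose a ha hμa using hex
  have hQ0 : ∀ b, ∀ i j, b ≠ a i → Q b i j = 0 := fun b i j hb => by
    by_cases hbs : b ∈ s
    · refine (mul_eq_zero.1 (hent b hbs i j)).resolve_left (sub_ne_zero.2 ?_)
      rw [hμa]
      exact fun h => hb (hf hbs (ha i) (Nat.cast_injective h).symm)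
    · simp [hQ, hP0 b hbs]
  -- Row i of Σ_b Q_b = 1 has a single contribution, from b = a_i, so that row of Q_{a_i} is the row
  -- of the identity matrix.
  have hQ1 : ∀ b, Q b = Matrix.diagonal fun i => if a i = b then (1 : ℂ) else 0 := fun b => by
    ext i j
    by_cases hb : b = a i
    · have h := congrFun (congrFun hQsum i) j
      rw [Matrix.sum_apply, Finset.sum_eq_single (a i) (fun c _ hc => hQ0 c i j hc)
        (fun h => absurd (ha i) h)] at h
      rw [hb, h, Matrix.one_apply, Matrix.diagonal_apply]
      simp
    · rw [hQ0 b i j hb, Matrix.diagonal_apply]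
      simp [Ne.symm hb]
  refine ⟨w, hwu, a, ?_⟩
  refine Matrix.ext fun i j => MonoidAlgebra.ext (Finsupp.ext fun b => ?_)
  have h1 : P b = w * Q b * star w := by
    calc P b = (w * star w) * P b * (w * star w) := by rw [hwu.2, one_mul, mul_one]
      _ = _ := by simp only [hQ, mul_assoc]
  have h2 : (Z i j).coeff b = P b i j := rfl
  have h3 : ∀ (c d : ℂ) (k : MonoidAlgebra ℂ Γ),
      (algebraMap ℂ _ c * k * algebraMap ℂ _ d).coeff b = c * k.coeff b * d := fun c d k => by
    rw [← Algebra.commutes, ← Algebra.smul_def, ← Algebra.smul_def]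
    simp [mul_comm, mul_left_comm]
  rw [h2, h1, hQ1, Matrix.mul_apply, Matrix.mul_apply]
  simp only [Matrix.mul_diagonal, scalarMat, Matrix.map_apply, MonoidAlgebra.coeff_sum,
    Finsupp.finsetSum_apply, h3, chi, MonoidAlgebra.coeff_single, Finsupp.single_apply]

end Diagonalization

/-! ### Scalar changes of basis -/

section ConjBy

variable {n : Type*} [Fintype n] [DecidableEq n] {A : Type*} [Ring A] [Algebra ℂ A]

theorem conjBy_apply (g : GL n ℂ) (V : Matrix n n A) (i j : n) :
    conjBy g V i j = ∑ q, ∑ p, (g.val i p * g⁻¹.val q j) • V p q := by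
  simp only [conjBy, Matrix.mul_apply, scalarMat, Matrix.map_apply, Finset.sum_mul]
  refine Finset.sum_congr rfl fun q _ => Finset.sum_congr rfl fun p _ => ?_
  rw [← Algebra.commutes, ← Algebra.smul_def, ← Algebra.smul_def, smul_smul, mul_comm]

theorem conjBy_conjBy (g h : GL n ℂ) (V : Matrix n n A) :
    conjBy g (conjBy h V) = conjBy (g * h) V := by
  simp only [conjBy, mul_inv_rev, Units.val_mul, scalarMat_mul, mul_assoc]

theorem one_conjBy (V : Matrix n n A) : conjBy (1 : GL n ℂ) V = V := by
  simp [conjBy, scalarMat_one]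

theorem conjBy_inv_conjBy (g : GL n ℂ) (V : Matrix n n A) : conjBy g⁻¹ (conjBy g V) = V := by
  rw [conjBy_conjBy, inv_mul_cancel, one_conjBy]

theorem conjBy_conjBy_inv (g : GL n ℂ) (V : Matrix n n A) : conjBy g (conjBy g⁻¹ V) = V := by
  rw [conjBy_conjBy, mul_inv_cancel, one_conjBy]

theorem conjBy_apply_mem (S : Submodule ℂ A) (g : GL n ℂ) {V : Matrix n n A}
    (h : ∀ i j, V i j ∈ S) (i j : n) : conjBy g V i j ∈ S := by
  rw [conjBy_apply]
  exact S.sum_mem fun q _ => S.sum_mem fun p _ => S.smul_mem _ (h p q)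

/-- The entries of g are scalars, so linearity of f suffices. This allows maps that are not
multiplicative: the antipode, and the identity map from H to its transmutation. -/
theorem conjBy_map_linear {B : Type*} [Ring B] [Algebra ℂ B] (f : A →ₗ[ℂ] B) (g : GL n ℂ)
    (V : Matrix n n A) : (conjBy g V).map f = conjBy g (V.map f) := by
  ext i j
  simp [conjBy_apply]

variable [StarRing A] [StarModule ℂ A]

theorem star_conjBy {g : GL n ℂ} (hg : star g.val = g⁻¹.val) (V : Matrix n n A) :
    star (conjBy g V) = conjBy g (star V) := by
  have hg' : star g⁻¹.val = g.val := by rw [← hg, star_star]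
  rw [conjBy, conjBy, star_mul, star_mul, star_scalarMat, star_scalarMat, hg, hg', mul_assoc]

theorem conjBy_mem_unitary {g : GL n ℂ} (hg : star g.val = g⁻¹.val) {V : Matrix n n A}
    (hV : V ∈ unitary (Matrix n n A)) : conjBy g V ∈ unitary (Matrix n n A) := by
  rw [Unitary.mem_iff, star_conjBy hg, conjBy_mul, conjBy_mul, hV.1, hV.2, conjBy_one]
  exact ⟨rfl, rfl⟩

theorem conjBy_inv_mem_unitary {g : GL n ℂ} (hg : star g.val = g⁻¹.val) {V : Matrix n n A}
    (hV : V ∈ unitary (Matrix n n A)) : conjBy g⁻¹ V ∈ unitary (Matrix n n A) :=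
  conjBy_mem_unitary (by rw [inv_inv, ← hg, star_star]) hV

end ConjBy

/-! ### Corepresentation matrices under base change, conjugation and Hopf maps -/

section Corep

variable {n : Type*} [Fintype n] [DecidableEq n] {H : Type*} [Ring H] [HopfAlgebra ℂ H]
  [StarRing H] [StarModule ℂ H]

theorem IsCorepMatrix.map_comul {X : Matrix n n H} (hX : IsCorepMatrix X) :
    X.map (Bialgebra.comulAlgHom ℂ H) =
      X.map (FreeUnitary.inclL H H) * X.map (FreeUnitary.inclR H H) := by
  rw [← FreeUnitary.tensorMat_eq]
  ext i j
  exact hX.comul i j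

theorem IsCorepMatrix.conjBy {X : Matrix n n H} (hX : IsCorepMatrix X) (g : GL n ℂ) :
    IsCorepMatrix (conjBy g X) where
  comul := by
    have h : (_root_.conjBy g X).map (Bialgebra.comulAlgHom ℂ H) =
        FreeUnitary.tensorMat (_root_.conjBy g X) (_root_.conjBy g X) := by
      rw [map_conjBy, hX.map_comul, ← conjBy_mul, FreeUnitary.tensorMat_eq]
      congr 1
      · exact (map_conjBy (FreeUnitary.inclL H H : H →ₐ[ℂ] H ⊗[ℂ] H) g X).symm
      · exact (map_conjBy (FreeUnitary.inclR H H : H →ₐ[ℂ] H ⊗[ℂ] H) g X).symm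
    exact fun i j => congrFun (congrFun h i) j
  counit := by
    have h : (_root_.conjBy g X).map (Bialgebra.counitAlgHom ℂ H) = 1 := by
      rw [map_conjBy]
      have : X.map (Bialgebra.counitAlgHom ℂ H) = 1 := by
        ext i j
        exact hX.counit i j
      rw [this, conjBy_one]
    exact fun i j => congrFun (congrFun h i) j

theorem IsCorepMatrix.barMat [HopfStar H] {X : Matrix n n H} (hX : IsCorepMatrix X) :
    IsCorepMatrix (barMat X) where
  comul i j := by
    rw [barMat_apply, HopfStar.comul_star, hX.comul, star_sum]
    simp [barMat_apply]
  counit i j := by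
    rw [barMat_apply, HopfStar.counit_star, hX.counit]
    by_cases h : i = j
    · subst h; simp
    · simp [h]

theorem IsCorepMatrix.map_hom {K : Type*} [Ring K] [HopfAlgebra ℂ K] [StarRing K]
    (π : HopfStarHom H K) {X : Matrix n n H} (hX : IsCorepMatrix X) :
    IsCorepMatrix (X.map π.hom) where
  comul i j := by
    rw [Matrix.map_apply, ← CoalgHomClass.map_comp_comul_apply, hX.comul, map_sum]
    simp
  counit i j := by
    rw [Matrix.map_apply, CoalgHomClass.counit_comp_apply, hX.counit]

end Corep

/-- The matrix `Z` is diagonal in the orthonormal basis formed by the columns of `g`, with diagonal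
entries given by the group elements `a i`. -/
structure Diagonalizes {Γ : Type*} [CommGroup Γ] {n : Type*} [Fintype n] [DecidableEq n]
    (g : GL n ℂ) (a : n → Γ) (Z : Matrix n n (MonoidAlgebra ℂ Γ)) : Prop where
  star_eq : star g.val = g⁻¹.val
  conj_eq : conjBy g⁻¹ Z = Matrix.diagonal fun i => chi (a i)

/-! ### Homogeneous matrix coefficients -/

section Homogeneous

variable {Γ : Type*} [CommGroup Γ] {n : Type*} [Fintype n] [DecidableEq n]

theorem exists_diagonalizes {Z : Matrix n n (MonoidAlgebra ℂ Γ)} (hc : IsCorepMatrix Z)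
    (hZ : Z ∈ unitary (Matrix n n (MonoidAlgebra ℂ Γ))) :
    ∃ (g : GL n ℂ) (a : n → Γ), Diagonalizes g a Z := by
  obtain ⟨w, hw, a, h⟩ := exists_diagonalization hc hZ
  refine ⟨⟨w, star w, hw.2, hw.1⟩, a, rfl, ?_⟩
  have h' : Z = conjBy ⟨w, star w, hw.2, hw.1⟩ (Matrix.diagonal fun i => chi (a i)) := h
  rw [h', conjBy_inv_conjBy]

variable {H : Type*} [Ring H] [HopfAlgebra ℂ H] [StarRing H] [StarModule ℂ H]
  (π : HopfStarHom H (MonoidAlgebra ℂ Γ))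

/-- In the new basis π(x'_ik) = δ_ik a_i, so applying π to one leg of Δ(x'_ij) = Σ_k x'_ik ⊗ x'_kj
leaves a single term, with a_i on the left or a_j on the right. -/
theorem conjBy_inv_mem_bigraded {X : Matrix n n H} (hX : IsCorepMatrix X) {g : GL n ℂ} {a : n → Γ}
    (hg : Diagonalizes g a (X.map π.hom)) (i j : n) :
    conjBy g⁻¹ X i j ∈ bigraded π (a i) (a j) := by
  have hX' := hX.conjBy g⁻¹
  have hπ : ∀ i j, π.hom (conjBy g⁻¹ X i j) = if i = j then chi (a i) else 0 := fun i j => by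
    have h := map_conjBy (π.hom : H →ₐ[ℂ] MonoidAlgebra ℂ Γ) g⁻¹ X
    have h' := congrFun (congrFun (h.trans hg.conj_eq) i) j
    rw [Matrix.diagonal_apply] at h'
    exact h'
  constructor
  · rw [coactL_apply, hX'.comul, map_sum, Finset.sum_eq_single i]
    · rw [LinearMap.rTensor_tmul]
      exact congrArg (· ⊗ₜ[ℂ] _) ((hπ i i).trans (if_pos rfl))
    · intro k _ hk
      rw [LinearMap.rTensor_tmul]
      refine (congrArg (· ⊗ₜ[ℂ] _) ((hπ i k).trans (if_neg (Ne.symm hk)))).trans ?_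
      exact TensorProduct.zero_tmul _ _
    · simp
  · rw [coactR_apply, hX'.comul, map_sum, Finset.sum_eq_single j]
    · rw [LinearMap.lTensor_tmul]
      exact congrArg (_ ⊗ₜ[ℂ] ·) ((hπ j j).trans (if_pos rfl))
    · intro k _ hk
      rw [LinearMap.lTensor_tmul]
      refine (congrArg (_ ⊗ₜ[ℂ] ·) ((hπ k j).trans (if_neg hk))).trans ?_
      exact TensorProduct.tmul_zero _ _
    · simp

end Homogeneous

/-! ### Reduction of homogeneous elements to generators -/

namespace FreeUnitary

variable {Γ : Type*} [CommGroup Γ] {n : Type*} [Fintype n] [DecidableEq n] {F : GL n ℂ}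
  {π : HopfStarHom (FreeUnitary F) (MonoidAlgebra ℂ Γ)} {g : GL n ℂ} {a : n → Γ}
  {P : Γ → Γ → FreeUnitary F → Prop}

/-- The algebra `ℂ[U_F⁺]` is spanned by any set of homogeneous elements that is closed under
products and contains the unit, the homogeneous generators and their adjoints. -/
theorem span_homogeneous_eq_top (hg : Diagonalizes g a ((U F).map π.hom)) (h1 : P 1 1 1)
    (hmul : ∀ a b c d, ∀ x ∈ bigraded π a b, ∀ y ∈ bigraded π c d, P a b x → P c d y →
      P (a * c) (b * d) (x * y))
    (hu : ∀ i j, P (a i) (a j) (conjBy g⁻¹ (U F) i j))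
    (hus : ∀ i j, P (a i)⁻¹ (a j)⁻¹ (star (conjBy g⁻¹ (U F) i j))) :
    Submodule.span ℂ {x | ∃ a b, x ∈ bigraded π a b ∧ P a b x} = ⊤ := by
  have hmem := conjBy_inv_mem_bigraded π isCorepMatrix_U hg
  set S := Submodule.span ℂ {x | ∃ a b, x ∈ bigraded π a b ∧ P a b x} with hS
  have hS1 : (1 : FreeUnitary F) ∈ S := Submodule.subset_span ⟨1, 1, one_mem_bigraded π, h1⟩
  have hU : ∀ i j, conjBy g⁻¹ (U F) i j ∈ S := fun i j =>
    Submodule.subset_span ⟨_, _, hmem i j, hu i j⟩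
  have hUs : ∀ i j, star (conjBy g⁻¹ (U F) i j) ∈ S := fun i j =>
    Submodule.subset_span ⟨_, _, star_mem_bigraded π (hmem i j), hus i j⟩
  have hSS : S * S ≤ S := by
    rw [hS, Submodule.span_mul_span, Submodule.span_le]
    rintro _ ⟨x, ⟨c, d, hx, hxP⟩, y, ⟨e, f, hy, hyP⟩, rfl⟩
    exact Submodule.subset_span
      ⟨_, _, mul_mem_bigraded π hx hy, hmul _ _ _ _ x hx y hy hxP hyP⟩
  refine Submodule.eq_top_iff'.2 fun x => ?_
  induction x using FreeUnitary.induction with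
  | h0 c => rw [Algebra.algebraMap_eq_smul_one]; exact S.smul_mem _ hS1
  | h1 i j =>
    rw [← conjBy_conjBy_inv g (U F)]
    exact conjBy_apply_mem S g hU i j
  | h1' i j =>
    rw [← conjBy_conjBy_inv g (U F), conjBy_apply, star_sum]
    refine S.sum_mem fun q _ => ?_
    rw [star_sum]
    refine S.sum_mem fun p _ => ?_
    rw [star_smul]
    exact S.smul_mem _ (hUs p q)
  | h2 x y hx hy => exact hSS (Submodule.mul_mem_mul hx hy)
  | h3 x y hx hy => exact S.add_mem hx hy

/-- Induction principle for homogeneous elements. -/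
theorem homogeneous_induction (hg : Diagonalizes g a ((U F).map π.hom)) (h0 : ∀ a b, P a b 0)
    (hadd : ∀ a b x y, P a b x → P a b y → P a b (x + y))
    (hsmul : ∀ a b (c : ℂ) x, P a b x → P a b (c • x)) (h1 : P 1 1 1)
    (hmul : ∀ a b c d, ∀ x ∈ bigraded π a b, ∀ y ∈ bigraded π c d, P a b x → P c d y →
      P (a * c) (b * d) (x * y))
    (hu : ∀ i j, P (a i) (a j) (conjBy g⁻¹ (U F) i j))
    (hus : ∀ i j, P (a i)⁻¹ (a j)⁻¹ (star (conjBy g⁻¹ (U F) i j)))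
    {b c : Γ} {x : FreeUnitary F} (hx : x ∈ bigraded π b c) : P b c x := by
  classical
  -- A homogeneous x may be a combination of good elements of other degrees. The statement is
  -- therefore proved for the (b, c)-component of an arbitrary y, which is compatible with linear
  -- combinations and equals x when y = x.
  have key : ∀ y : FreeUnitary F, P b c (components π y (b, c)) := fun y => by
    have hy : y ∈ Submodule.span ℂ {x | ∃ a b, x ∈ bigraded π a b ∧ P a b x} := by
      rw [span_homogeneous_eq_top hg h1 hmul hu hus]; trivial
    induction hy using Submodule.span_induction with
    | mem y hy =>
      obtain ⟨d, e, hy, hP⟩ := hy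
      rw [components_of_mem π hy, Finsupp.single_apply]
      split_ifs with h
      · simp only [Prod.mk.injEq] at h
        rw [← h.1, ← h.2]
        exact hP
      · exact h0 b c
    | zero => rw [map_zero]; exact h0 b c
    | add x y _ _ hx hy => rw [map_add]; exact hadd _ _ _ _ hx hy
    | smul k x _ hx => rw [map_smul]; exact hsmul _ _ _ _ hx
  have h := key x
  rwa [components_of_mem π hx, Finsupp.single_eq_same] at h

end FreeUnitary

/-! ### The transmutation is a braided Hopf star-algebra -/

section BraidedHopf

variable {Γ : Type*} [CommGroup Γ] {H : Type*} [Ring H] [HopfAlgebra ℂ H] [StarRing H]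
  (π : HopfStarHom H (MonoidAlgebra ℂ Γ)) (β : Γ →* Γ →* Circle)

/-- The subspace `⨁_e H_{a,e} ⊗ H_{e,b}` of `H ⊗ H`. -/
def comulSpan (a b : Γ) : Submodule ℂ (H ⊗[ℂ] H) :=
  Submodule.span ℂ {t | ∃ e, ∃ y ∈ bigraded π a e, ∃ z ∈ bigraded π e b, t = y ⊗ₜ[ℂ] z}

theorem tmul_mem_comulSpan {a e b : Γ} {y z : H} (hy : y ∈ bigraded π a e)
    (hz : z ∈ bigraded π e b) : y ⊗ₜ[ℂ] z ∈ comulSpan π a b :=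
  Submodule.subset_span ⟨e, y, hy, z, hz, rfl⟩

theorem comulSpan_induction {a b : Γ} {P : H ⊗[ℂ] H → Prop} (h0 : P 0)
    (hadd : ∀ s t, P s → P t → P (s + t)) (hsmul : ∀ (c : ℂ) t, P t → P (c • t))
    (h : ∀ e, ∀ y ∈ bigraded π a e, ∀ z ∈ bigraded π e b, P (y ⊗ₜ[ℂ] z)) {t : H ⊗[ℂ] H}
    (ht : t ∈ comulSpan π a b) : P t := by
  induction ht using Submodule.span_induction with
  | mem t ht =>
    obtain ⟨e, y, hy, z, hz, rfl⟩ := ht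
    exact h e y hy z hz
  | zero => exact h0
  | add s t _ _ hs ht => exact hadd s t hs ht
  | smul c t _ ht => exact hsmul c t ht

/-- Linear maps that agree on `H_{a,e} ⊗ H_{e,b}` for all `e` agree on their sum. -/
theorem comulSpan_ext {a b : Γ} {M : Type*} [AddCommGroup M] [Module ℂ M]
    {f g : H ⊗[ℂ] H →ₗ[ℂ] M}
    (h : ∀ e, ∀ y ∈ bigraded π a e, ∀ z ∈ bigraded π e b, f (y ⊗ₜ[ℂ] z) = g (y ⊗ₜ[ℂ] z))
    {t : H ⊗[ℂ] H} (ht : t ∈ comulSpan π a b) : f t = g t := by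
  refine comulSpan_induction π (P := fun t => f t = g t) ?_ (fun s t hs ht => ?_)
    (fun c t ht => ?_) h ht
  · simp only [map_zero]
  · rw [map_add, map_add, hs, ht]
  · rw [map_smul, map_smul, ht]

/-- Apply ε to the first leg of (ι ⊗ π)Δ(x) = x ⊗ b. -/
theorem piLin_of_mem_right {a b : Γ} {x : H} (hx : x ∈ bigraded π a b) :
    piLin π x = Coalgebra.counit (R := ℂ) x • chi b := by
  have h := congrArg (TensorProduct.lid ℂ _ ∘
    (Coalgebra.counit (R := ℂ) (A := H)).rTensor (MonoidAlgebra ℂ Γ)) hx.2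
  have h' : ∀ t : H ⊗[ℂ] H, (Coalgebra.counit (R := ℂ)).rTensor (MonoidAlgebra ℂ Γ)
      ((piLin π).lTensor H t) =
      (piLin π).lTensor ℂ ((Coalgebra.counit (R := ℂ)).rTensor H t) := fun t => by
    rw [← LinearMap.comp_apply, ← LinearMap.comp_apply, LinearMap.rTensor_comp_lTensor,
      LinearMap.lTensor_comp_rTensor]
  rw [Function.comp_apply, coactR_apply, h', Coalgebra.rTensor_counit_comul] at h
  simpa using h

theorem piLin_of_mem_left {a b : Γ} {x : H} (hx : x ∈ bigraded π a b) :
    piLin π x = Coalgebra.counit (R := ℂ) x • chi a := by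
  have h := congrArg (TensorProduct.rid ℂ _ ∘
    (Coalgebra.counit (R := ℂ) (A := H)).lTensor (MonoidAlgebra ℂ Γ)) hx.1
  have h' : ∀ t : H ⊗[ℂ] H, (Coalgebra.counit (R := ℂ)).lTensor (MonoidAlgebra ℂ Γ)
      ((piLin π).rTensor H t) =
      (piLin π).rTensor ℂ ((Coalgebra.counit (R := ℂ)).lTensor H t) := fun t => by
    rw [← LinearMap.comp_apply, ← LinearMap.comp_apply, LinearMap.rTensor_comp_lTensor,
      LinearMap.lTensor_comp_rTensor]
  rw [Function.comp_apply, coactL_apply, h', Coalgebra.lTensor_counit_comul] at h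
  simpa using h

/-- Both ε(x)a and ε(x)b equal π(x). The consequence used below: wherever a counit appears, either
it vanishes or a⁻¹b = 1, and in the latter case the scalars β(a⁻¹b, ·) are trivial. -/
theorem counit_eq_zero_or_eq {a b : Γ} {x : H} (hx : x ∈ bigraded π a b) :
    Coalgebra.counit (R := ℂ) x = 0 ∨ a = b := by
  classical
  by_cases hab : a = b
  · exact Or.inr hab
  · left
    have h := (piLin_of_mem_left π hx).symm.trans (piLin_of_mem_right π hx)
    have h' := congrArg (fun k => k.coeff a) h
    simpa [chi, Finsupp.single_apply, Ne.symm hab] using h'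

namespace Transmutation

theorem of_mul_of_of_mem {x y : H} {a b c d : Γ} (hx : x ∈ bigraded π a b)
    (hy : y ∈ bigraded π c d) :
    of π β x * of π β y = (β (a⁻¹ * b) c⁻¹ : ℂ) • of π β (x * y) := by
  rw [of_mul_of, transMul_of_mem π β hx hy, map_smul]

theorem star_of_of_mem [StarModule ℂ H] [HopfStar H] {x : H} {a b : Γ}
    (hx : x ∈ bigraded π a b) :
    star (of π β x) = (β (a⁻¹ * b) a⁻¹ : ℂ) • of π β (star x) := by
  rw [star_of, transStar_of_mem π β hx, map_smul]

theorem antipode_of_of_mem {x : H} {a b : Γ} (hx : x ∈ bigraded π a b) :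
    antipode π β (of π β x) =
      (β (a⁻¹ * b) b : ℂ) • of π β (HopfAlgebra.antipode ℂ x) := by
  have h : antipode π β (of π β x) = of π β (transAntipode π β x) := rfl
  rw [h, transAntipode_of_mem π β hx, map_smul]

/-- The identity map `H ⊗ H → H_β ⊗ H_β`. -/
def ofTwo : H ⊗[ℂ] H →ₗ[ℂ] Transmutation π β ⊗[ℂ] Transmutation π β :=
  TensorProduct.map (of π β).toLinearMap (of π β).toLinearMap

theorem ofTwo_tmul (x y : H) : ofTwo π β (x ⊗ₜ y) = of π β x ⊗ₜ of π β y := rfl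

theorem comul_of (x : H) :
    Coalgebra.comul (R := ℂ) (of π β x) = ofTwo π β (Coalgebra.comul (R := ℂ) x) := by
  have h : ofTwo π β = (LinearMap.id : H ⊗[ℂ] H →ₗ[ℂ] H ⊗[ℂ] H) := TensorProduct.map_id
  exact (LinearMap.congr_fun h _).symm

theorem counit_of (x : H) :
    Coalgebra.counit (R := ℂ) (of π β x) = Coalgebra.counit (R := ℂ) x := rfl

/-- Induction on homogeneous elements. -/
theorem induction {P : Transmutation π β → Prop} (h0 : P 0)
    (ha : ∀ x y, P x → P y → P (x + y))
    (hh : ∀ a b, ∀ x ∈ bigraded π a b, P (of π β x)) (x : Transmutation π β) : P x :=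
  bigraded_induction π (P := fun x => P (of π β x)) h0 (fun _ _ hx hy => ha _ _ hx hy) hh x

-- The two compatibilities of the Hopf structure with the bigrading on which the braided axioms
-- rest. They are kept as hypotheses here and verified on generators for ℂ[U_F⁺] in
-- `comul_mem_comulSpan` and `antipode_mem_bigraded`.
variable
  (hΔ : ∀ a b, ∀ x ∈ bigraded π a b, Coalgebra.comul (R := ℂ) x ∈ comulSpan π a b)
  (hS : ∀ a b, ∀ x ∈ bigraded π a b, HopfAlgebra.antipode ℂ x ∈ bigraded π b⁻¹ a⁻¹)

include hS in
theorem piLin_antipode_of_mem {a b : Γ} {x : H} (hx : x ∈ bigraded π a b) :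
    piLin π (HopfAlgebra.antipode ℂ x) = Coalgebra.counit (R := ℂ) x • chi a⁻¹ := by
  rw [piLin_of_mem_right π (hS a b x hx), HopfAlgebra.counit_antipode]

include hΔ hS in
-- In x_(2) ⊗ π(S(x_(1)) x_(3)), the left leg contributes π(S(x_(1))) = ε(x_(1)) a⁻¹ and the right
-- leg contributes b, so the adjoint coaction of x is ε(x_(1)) x_(2) ⊗ a⁻¹b.
theorem coact_of_mem {a b : Γ} {x : H} (hx : x ∈ bigraded π a b) :
    coact π β (of π β x) = of π β x ⊗ₜ chi (a⁻¹ * b) := by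
  -- Here f is the adjoint coaction without its first coproduct, and g is y ⊗ z ↦ ε(y) z ⊗ a⁻¹b.
  -- They agree on H_{a,e} ⊗ H_{e,b} for every e, hence on Δ(x).
  have key := comulSpan_ext π (a := a) (b := b) (M := Transmutation π β ⊗[ℂ] MonoidAlgebra ℂ Γ)
    (f := TensorProduct.map (of π β).toLinearMap (piLin π) ∘ₗ
      TensorProduct.lift (LinearMap.lTensorHom H ∘ₗ LinearMap.mul ℂ H ∘ₗ
        HopfAlgebra.antipode ℂ (A := H)) ∘ₗ (Coalgebra.comul (R := ℂ) (A := H)).lTensor H)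
    (g := (TensorProduct.mk ℂ _ _).flip (chi (a⁻¹ * b)) ∘ₗ (of π β).toLinearMap ∘ₗ
      (TensorProduct.lid ℂ H).toLinearMap ∘ₗ (Coalgebra.counit (R := ℂ) (A := H)).rTensor H)
    (fun e y hy z hz => by
      have h : ∀ t : H ⊗[ℂ] H, TensorProduct.map (of π β).toLinearMap (piLin π)
          ((LinearMap.mul ℂ H (HopfAlgebra.antipode ℂ y)).lTensor H t) =
          TensorProduct.map (of π β).toLinearMap
            (LinearMap.mul ℂ _ (Coalgebra.counit (R := ℂ) y • chi a⁻¹))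
            ((piLin π).lTensor H t) := fun t => by
        induction t using TensorProduct.induction_on with
        | zero => simp only [map_zero]
        | tmul p q =>
          have h2 : piLin π (HopfAlgebra.antipode ℂ y * q) =
              piLin π (HopfAlgebra.antipode ℂ y) * piLin π q :=
            map_mul (π.hom : H →ₐ[ℂ] MonoidAlgebra ℂ Γ) _ _
          simp only [LinearMap.lTensor_tmul, TensorProduct.map_tmul, LinearMap.mul_apply', h2,
            piLin_antipode_of_mem π hS hy]
        | add s t hs ht => simp only [map_add, hs, ht]
      have h3 : (piLin π).lTensor H (Coalgebra.comul (R := ℂ) z) = z ⊗ₜ chi b := hz.2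
      simp only [LinearMap.comp_apply, LinearMap.lTensor_tmul, TensorProduct.lift.tmul,
        LinearMap.coe_lTensorHom, h, h3, TensorProduct.map_tmul, LinearMap.smul_apply, LinearMap.mul_apply',
        smul_mul_assoc, chi_mul, LinearMap.rTensor_tmul, LinearEquiv.coe_coe,
        TensorProduct.lid_tmul, map_smul, LinearMap.flip_apply, TensorProduct.mk_apply,
        TensorProduct.tmul_smul, TensorProduct.smul_tmul'])
    (hΔ a b x hx)
  refine (show _ = _ from key).trans ?_
  simp only [LinearMap.comp_apply, Coalgebra.rTensor_counit_comul]
  simp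

include hΔ hS in
theorem isCoaction_coact : IsCoaction (coact π β) where
  coassoc x := by
    induction x using Transmutation.induction with
    | h0 => simp only [LinearMap.map_zero, LinearEquiv.map_zero]
    | ha x y hx hy => simp only [LinearMap.map_add, LinearEquiv.map_add, hx, hy]
    | hh a b x hx =>
      simp only [coact_of_mem π β hΔ hS hx, LinearMap.rTensor_tmul, LinearMap.lTensor_tmul,
        TensorProduct.assoc_tmul, comul_chi]
  counit x := by
    induction x using Transmutation.induction with
    | h0 => simp only [map_zero]
    | ha x y hx hy => simp only [map_add, hx, hy]
    | hh a b x hx => simp [coact_of_mem π β hΔ hS hx, chi]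

include hΔ hS in
theorem coact_mul (x y : Transmutation π β) :
    coact π β (x * y) = coact π β x * coact π β y := by
  induction x using Transmutation.induction with
  | h0 => simp only [map_zero, zero_mul]
  | ha x x' hx hx' => simp only [map_add, add_mul, hx, hx']
  | hh a b x hx =>
  induction y using Transmutation.induction with
  | h0 => simp only [map_zero, mul_zero]
  | ha y y' hy hy' => simp only [map_add, mul_add, hy, hy']
  | hh c d y hy =>
  rw [of_mul_of_of_mem π β hx hy, map_smul,
    coact_of_mem π β hΔ hS (mul_mem_bigraded π hx hy), coact_of_mem π β hΔ hS hx,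
    coact_of_mem π β hΔ hS hy, Algebra.TensorProduct.tmul_mul_tmul,
    of_mul_of_of_mem π β hx hy, chi_mul, TensorProduct.smul_tmul']
  congr 2
  rw [mul_inv, mul_mul_mul_comm]

include hΔ hS in
-- The degrees a⁻¹e and e⁻¹b of the two legs telescope to a⁻¹b.
theorem tensorCoact_ofTwo {a b : Γ} {t : H ⊗[ℂ] H} (ht : t ∈ comulSpan π a b) :
    tensorCoact (coact π β) (coact π β) (ofTwo π β t) = ofTwo π β t ⊗ₜ chi (a⁻¹ * b) := by
  refine comulSpan_ext π (f := tensorCoact (coact π β) (coact π β) ∘ₗ ofTwo π β)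
    (g := (TensorProduct.mk ℂ _ _).flip (chi (a⁻¹ * b)) ∘ₗ ofTwo π β) (fun e y hy z hz => ?_) ht
  have he : a⁻¹ * e * (e⁻¹ * b) = a⁻¹ * b := by group
  simp [tensorCoact, ofTwo_tmul, coact_of_mem π β hΔ hS hy, coact_of_mem π β hΔ hS hz, chi_mul, he]

include hΔ hS in
theorem braidedMul_ofTwo {a b c d : Γ} {s t : H ⊗[ℂ] H} (hs : s ∈ comulSpan π a b)
    -- For y ⊗ z of degrees (a, e), (e, b) and y' ⊗ z' of degrees (c, f), (f, d), the braiding gives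
    -- β(e⁻¹b, c⁻¹f) and the products y·y' and z·z' give β(a⁻¹e, c⁻¹) and β(e⁻¹b, f⁻¹). The
    -- intermediate degrees e and f drop out, and what remains is the scalar of the transmuted
    -- product in degrees (a, b), (c, d). This is why Δ is multiplicative for the braided tensor
    -- product.
    (ht : t ∈ comulSpan π c d) :
    braidedMul (bicharForm β) (coact π β) (coact π β) (ofTwo π β s ⊗ₜ ofTwo π β t) =
      (β (a⁻¹ * b) c⁻¹ : ℂ) • ofTwo π β (s * t) := by
  refine comulSpan_ext π
    (f := braidedMul (bicharForm β) (coact π β) (coact π β) ∘ₗ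
      (TensorProduct.mk ℂ _ _).flip (ofTwo π β t) ∘ₗ ofTwo π β)
    (g := (β (a⁻¹ * b) c⁻¹ : ℂ) • ofTwo π β ∘ₗ LinearMap.mulRight ℂ t)
    (fun e y hy z hz => ?_) hs
  refine comulSpan_ext π
    (f := braidedMul (bicharForm β) (coact π β) (coact π β) ∘ₗ
      TensorProduct.mk ℂ _ _ (ofTwo π β (y ⊗ₜ z)) ∘ₗ ofTwo π β)
    (g := (β (a⁻¹ * b) c⁻¹ : ℂ) • ofTwo π β ∘ₗ LinearMap.mulLeft ℂ (y ⊗ₜ z))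
    (fun f y' hy' z' hz' => ?_) ht
  have hβ : β (e⁻¹ * b) (c⁻¹ * f) * (β (a⁻¹ * e) c⁻¹ * β (e⁻¹ * b) f⁻¹) =
      β (a⁻¹ * b) c⁻¹ := by
    apply Additive.ofMul.injective
    simp only [map_mul, map_inv, MonoidHom.mul_apply, MonoidHom.inv_apply, ofMul_mul, ofMul_inv]
    abel
  simp only [LinearMap.comp_apply, TensorProduct.mk_apply, ofTwo_tmul, LinearMap.smul_apply,
    LinearMap.mulLeft_apply, Algebra.TensorProduct.tmul_mul_tmul]
  rw [braidedMul_tmul_of_eq _ _ _ _ _ _ _ (coact_of_mem π β hΔ hS hz)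
    (coact_of_mem π β hΔ hS hy'), of_mul_of_of_mem π β hy hy', of_mul_of_of_mem π β hz hz',
    bicharForm_chi, TensorProduct.smul_tmul_smul, smul_smul, ← Circle.coe_mul, ← Circle.coe_mul,
    hβ]

variable [StarModule ℂ H] [HopfStar H]

include hΔ hS in
theorem coact_star (x : Transmutation π β) : coact π β (star x) = star (coact π β x) := by
  induction x using Transmutation.induction with
  | h0 => simp only [map_zero, star_zero]
  | ha x x' hx hx' => simp only [map_add, star_add, hx, hx']
  | hh a b x hx =>
  rw [star_of_of_mem π β hx, map_smul, coact_of_mem π β hΔ hS (star_mem_bigraded π hx),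
    coact_of_mem π β hΔ hS hx, TensorProduct.star_tmul, star_of_of_mem π β hx, star_chi,
    TensorProduct.smul_tmul']
  congr 2
  rw [mul_inv]

include hΔ hS in
theorem braidedStar_ofTwo {a b : Γ} {t : H ⊗[ℂ] H} (ht : t ∈ comulSpan π a b) :
    braidedStar (bicharForm β) (coact π β) (coact π β) (ofTwo π β t) =
      (β (a⁻¹ * b) a⁻¹ : ℂ) • ofTwo π β (star t) := by
  -- Both sides are antilinear in t, so `comulSpan_ext`, which compares linear maps, does not apply.
  -- On y ⊗ z the intermediate degree e again cancels.
  refine comulSpan_induction π (P := fun t =>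
    braidedStar (bicharForm β) (coact π β) (coact π β) (ofTwo π β t) =
      (β (a⁻¹ * b) a⁻¹ : ℂ) • ofTwo π β (star t)) ?_ (fun s t hs ht => ?_)
    (fun c t ht => ?_) (fun e y hy z hz => ?_) ht
  · simp [braidedStar]
  · rw [star_add, map_add, map_add, smul_add, ← hs, ← ht]
    simp only [braidedStar, star_add, map_add]
  · rw [star_smul, map_smul, map_smul, smul_comm, ← ht]
    simp only [braidedStar, star_smul, map_smul]
  · have h1 : ∀ {a b : Γ} {x : H}, x ∈ bigraded π a b → coact π β (star (of π β x)) =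
        star (of π β x) ⊗ₜ chi (a * b⁻¹) := fun hx => by
      rw [coact_star π β hΔ hS, coact_of_mem π β hΔ hS hx, TensorProduct.star_tmul, star_chi,
        mul_inv, inv_inv]
    have hβ : β (e * b⁻¹) (a * e⁻¹) * (β (a⁻¹ * e) a⁻¹ * β (e⁻¹ * b) e⁻¹) =
        β (a⁻¹ * b) a⁻¹ := by
      apply Additive.ofMul.injective
      simp only [map_mul, map_inv, MonoidHom.mul_apply, MonoidHom.inv_apply, ofMul_mul, ofMul_inv]
      abel
    rw [ofTwo_tmul, braidedStar_tmul_of_eq _ _ _ _ _ (h1 hz) (h1 hy), star_of_of_mem π β hy,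
      star_of_of_mem π β hz, bicharForm_chi, TensorProduct.smul_tmul_smul, smul_smul,
      ← Circle.coe_mul, ← Circle.coe_mul, hβ, TensorProduct.star_tmul, ofTwo_tmul]

include hΔ hS in
/-- The transmutation of a Hopf star-algebra is a braided Hopf star-algebra. -/
theorem isBraidedHopfStar :
    IsBraidedHopfStar (bicharForm β) (coact π β) (antipode π β) where
  coaction := isCoaction_coact π β hΔ hS
  coaction_mul := coact_mul π β hΔ hS
  coaction_one := by
    rw [← of_one, coact_of_mem π β hΔ hS (one_mem_bigraded π)]
    simp [of_one, chi_one, Algebra.TensorProduct.one_def]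
  coaction_star := coact_star π β hΔ hS
  comul_equivariant x := by
    induction x using Transmutation.induction with
    | h0 => simp only [map_zero]
    | ha x y hx hy => simp only [map_add, hx, hy]
    | hh a b x hx =>
      rw [comul_of, tensorCoact_ofTwo π β hΔ hS (hΔ a b x hx), coact_of_mem π β hΔ hS hx,
        LinearMap.rTensor_tmul, comul_of]
  comul_mul x y := by
    induction x using Transmutation.induction with
    | h0 => simp only [map_zero, zero_mul, TensorProduct.zero_tmul]
    | ha x x' hx hx' => simp only [map_add, add_mul, TensorProduct.add_tmul, hx, hx']
    | hh a b x hx =>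
    induction y using Transmutation.induction with
    | h0 => simp only [map_zero, mul_zero, TensorProduct.tmul_zero]
    | ha y y' hy hy' => simp only [map_add, mul_add, TensorProduct.tmul_add, hy, hy']
    | hh c d y hy =>
      rw [of_mul_of_of_mem π β hx hy, map_smul, comul_of, comul_of, comul_of,
        braidedMul_ofTwo π β hΔ hS (hΔ a b x hx) (hΔ c d y hy), Bialgebra.comul_mul]
  comul_one := by
    rw [← of_one, comul_of, Bialgebra.comul_one, Algebra.TensorProduct.one_def, ofTwo_tmul]
  comul_star x := by
    induction x using Transmutation.induction with
    | h0 => simp [braidedStar]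
    | ha x y hx hy => simp only [star_add, map_add, hx, hy, braidedStar]
    | hh a b x hx =>
      rw [star_of_of_mem π β hx, map_smul, comul_of, comul_of,
        braidedStar_ofTwo π β hΔ hS (hΔ a b x hx), HopfStar.comul_star]
  counit_equivariant x := by
    induction x using Transmutation.induction with
    | h0 => simp only [map_zero]
    | ha x y hx hy => simp only [map_add, hx, hy]
    | hh a b x hx =>
      rw [coact_of_mem π β hΔ hS hx, LinearMap.rTensor_tmul, TensorProduct.lid_tmul, counit_of]
      rcases counit_eq_zero_or_eq π hx with h | rfl
      · simp [h]
      · rw [inv_mul_cancel, chi_one, Algebra.algebraMap_eq_smul_one]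
  counit_mul x y := by
    induction x using Transmutation.induction with
    | h0 => simp only [map_zero, zero_mul]
    | ha x x' hx hx' => simp only [map_add, add_mul, hx, hx']
    | hh a b x hx =>
    induction y using Transmutation.induction with
    | h0 => simp only [map_zero, mul_zero]
    | ha y y' hy hy' => simp only [map_add, mul_add, hy, hy']
    | hh c d y hy =>
      rw [of_mul_of_of_mem π β hx hy, map_smul, counit_of, counit_of, counit_of,
        Bialgebra.counit_mul]
      -- The scalar β(a⁻¹b, c⁻¹) matters only if ε(x) ≠ 0, and then a = b makes it 1.
      rcases counit_eq_zero_or_eq π hx with h | rfl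
      · simp [h]
      · simp
  counit_one := by rw [← of_one, counit_of, Bialgebra.counit_one]
  counit_star x := by
    induction x using Transmutation.induction with
    | h0 => simp only [map_zero, star_zero]
    | ha x y hx hy => simp only [star_add, map_add, hx, hy]
    | hh a b x hx =>
      rw [star_of_of_mem π β hx, map_smul, counit_of, counit_of, HopfStar.counit_star]
      rcases counit_eq_zero_or_eq π hx with h | rfl
      · simp [h]
      · simp
  antipode_equivariant x := by
    induction x using Transmutation.induction with
    | h0 => simp only [map_zero]
    | ha x y hx hy => simp only [map_add, hx, hy]
    | hh a b x hx =>
      rw [antipode_of_of_mem π β hx, map_smul, coact_of_mem π β hΔ hS (hS a b x hx),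
        coact_of_mem π β hΔ hS hx, LinearMap.rTensor_tmul, antipode_of_of_mem π β hx,
        TensorProduct.smul_tmul', inv_inv, mul_comm b]
  antipode_left x := by
    induction x using Transmutation.induction with
    | h0 => simp only [map_zero]
    | ha x y hx hy => simp only [map_add, hx, hy]
    | hh a b x hx =>
      have h := comulSpan_ext π
        (f := LinearMap.mul' ℂ (Transmutation π β) ∘ₗ
          (antipode π β).rTensor (Transmutation π β) ∘ₗ ofTwo π β)
        (g := (of π β).toLinearMap ∘ₗ LinearMap.mul' ℂ H ∘ₗ
          (HopfAlgebra.antipode ℂ (A := H)).rTensor H)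
        (fun e y hy z hz => by
          -- S(y) has degree (e⁻¹, a⁻¹), so multiplying it by z in the transmutation produces
          -- exactly the inverse of the scalar in S_β(y). Hence S_β(y) ·_β z = S(y) z.
          have hβ : β (a⁻¹ * e) e * β (e⁻¹⁻¹ * a⁻¹) e⁻¹ = 1 := by
            rw [inv_inv, mul_comm e, ← map_mul, mul_inv_cancel, map_one]
          simp only [LinearMap.comp_apply, ofTwo_tmul, LinearMap.rTensor_tmul,
            LinearMap.mul'_apply, antipode_of_of_mem π β hy, smul_mul_assoc,
            of_mul_of_of_mem π β (hS _ _ y hy) hz, smul_smul, ← Circle.coe_mul, hβ,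
            Circle.coe_one, one_smul]
          rfl) (hΔ a b x hx)
      rw [comul_of, counit_of]
      refine (show _ = _ from h).trans ?_
      rw [LinearMap.comp_apply, LinearMap.comp_apply,
        HopfAlgebra.mul_antipode_rTensor_comul_apply, Algebra.algebraMap_eq_smul_one, map_smul,
        Algebra.algebraMap_eq_smul_one]
      rfl
  antipode_right x := by
    induction x using Transmutation.induction with
    | h0 => simp only [map_zero]
    | ha x y hx hy => simp only [map_add, hx, hy]
    | hh a b x hx =>
      have h := comulSpan_ext π
        (f := LinearMap.mul' ℂ (Transmutation π β) ∘ₗ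
          (antipode π β).lTensor (Transmutation π β) ∘ₗ ofTwo π β)
        (g := (β (a⁻¹ * b) b : ℂ) • (of π β).toLinearMap ∘ₗ LinearMap.mul' ℂ H ∘ₗ
          (HopfAlgebra.antipode ℂ (A := H)).lTensor H)
        (fun e y hy z hz => by
          -- On this side the scalars do not cancel, but their product β(a⁻¹b, b) is the same for
          -- all e. It can be pulled out of the sum and is harmless, because ε(x) = 0 unless a = b.
          have hβ : β (e⁻¹ * b) b * β (a⁻¹ * e) b⁻¹⁻¹ = β (a⁻¹ * b) b := by
            rw [inv_inv, ← MonoidHom.mul_apply, ← map_mul]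
            congr 2
            rw [mul_comm, mul_assoc, mul_inv_cancel_left]
          simp only [LinearMap.comp_apply, LinearMap.smul_apply, ofTwo_tmul,
            LinearMap.lTensor_tmul, LinearMap.mul'_apply, antipode_of_of_mem π β hz,
            mul_smul_comm, of_mul_of_of_mem π β hy (hS _ _ z hz), smul_smul, ← Circle.coe_mul,
            hβ]
          rfl) (hΔ a b x hx)
      rw [comul_of, counit_of]
      refine (show _ = _ from h).trans ?_
      rw [LinearMap.smul_apply, LinearMap.comp_apply, LinearMap.comp_apply,
        HopfAlgebra.mul_antipode_lTensor_comul_apply, Algebra.algebraMap_eq_smul_one, map_smul,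
        Algebra.algebraMap_eq_smul_one]
      rcases counit_eq_zero_or_eq π hx with h | rfl
      · simp [h]
      · simp [of_one]

end Transmutation

end BraidedHopf

/-! ### Matrix products with respect to a bilinear product -/

section TwistedMatrixProduct

variable {n : Type*} [Fintype n] [DecidableEq n] {E : Type*} [Ring E] [Algebra ℂ E]

/-- The product of matrices over `E` defined by a bilinear product `m` on `E`. -/
def twistedMul (m : E ⊗[ℂ] E →ₗ[ℂ] E) (M N : Matrix n n E) : Matrix n n E :=
  Matrix.of fun i j => ∑ k, m (M i k ⊗ₜ N k j)

theorem scalarMat_mul_apply (c : Matrix n n ℂ) (M : Matrix n n E) (i j : n) :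
    (scalarMat E c * M) i j = ∑ k, c i k • M k j := by
  simp [Matrix.mul_apply, scalarMat, Algebra.smul_def]

theorem mul_scalarMat_apply (c : Matrix n n ℂ) (M : Matrix n n E) (i j : n) :
    (M * scalarMat E c) i j = ∑ k, c k j • M i k := by
  simp only [Matrix.mul_apply, scalarMat, Matrix.map_apply, Algebra.smul_def, Algebra.commutes]

theorem scalarMat_mul_twistedMul (m : E ⊗[ℂ] E →ₗ[ℂ] E) (c : Matrix n n ℂ) (M N : Matrix n n E) :
    twistedMul m (scalarMat E c * M) N = scalarMat E c * twistedMul m M N := by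
  ext i j
  simp only [twistedMul, Matrix.of_apply, scalarMat_mul_apply, TensorProduct.sum_tmul, map_sum,
    ← TensorProduct.smul_tmul', map_smul, Finset.smul_sum]
  exact Finset.sum_comm

theorem twistedMul_mul_scalarMat (m : E ⊗[ℂ] E →ₗ[ℂ] E) (c : Matrix n n ℂ) (M N : Matrix n n E) :
    twistedMul m M (N * scalarMat E c) = twistedMul m M N * scalarMat E c := by
  ext i j
  simp only [twistedMul, Matrix.of_apply, mul_scalarMat_apply, TensorProduct.tmul_sum, map_sum,
    TensorProduct.tmul_smul, map_smul, Finset.smul_sum]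
  exact Finset.sum_comm

theorem twistedMul_scalarMat_mul (m : E ⊗[ℂ] E →ₗ[ℂ] E) (c : Matrix n n ℂ) (M N : Matrix n n E) :
    twistedMul m (M * scalarMat E c) N = twistedMul m M (scalarMat E c * N) := by
  ext i j
  simp only [twistedMul, Matrix.of_apply, mul_scalarMat_apply, scalarMat_mul_apply,
    TensorProduct.tmul_sum, TensorProduct.sum_tmul, map_sum, TensorProduct.tmul_smul,
    ← TensorProduct.smul_tmul', map_smul]
  exact Finset.sum_comm

/-- Only bilinearity of m is needed: scalar matrices move across m, and g⁻¹g cancels in the middle.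
No associativity or unit of m is involved, so the result applies to the product of ℂΓ ⊗_β H_β given
merely as a bilinear map. -/
theorem twistedMul_conjBy (m : E ⊗[ℂ] E →ₗ[ℂ] E) (g : GL n ℂ) (M N : Matrix n n E) :
    twistedMul m (conjBy g M) (conjBy g N) = conjBy g (twistedMul m M N) := by
  rw [conjBy, conjBy, conjBy, twistedMul_mul_scalarMat, mul_assoc, scalarMat_mul_twistedMul,
    twistedMul_scalarMat_mul, ← mul_assoc (scalarMat E g⁻¹.val), scalarMat_inv_mul, one_mul]

/-- The conjugate transpose with respect to a map `s`. -/
def twistedStar (s : E → E) (M : Matrix n n E) : Matrix n n E := Matrix.of fun i j => s (M j i)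

/-- For antilinear s the conjugate transpose of g M g⁻¹ is conjugated by (g*)⁻¹, which is g since g
is unitary. -/
theorem twistedStar_conjBy (s : E → E) (hadd : ∀ x y, s (x + y) = s x + s y)
    (hsmul : ∀ (c : ℂ) x, s (c • x) = star c • s x) {g : GL n ℂ} (hg : star g.val = g⁻¹.val)
    (M : Matrix n n E) : twistedStar s (conjBy g M) = conjBy g (twistedStar s M) := by
  have hg1 : ∀ i j, star (g.val i j) = g⁻¹.val j i := fun i j => by
    rw [← hg, Matrix.star_apply]
  have hg2 : ∀ i j, star (g⁻¹.val i j) = g.val j i := fun i j => by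
    rw [← hg, Matrix.star_apply, star_star]
  have hsum : ∀ (f : n → E), s (∑ k, f k) = ∑ k, s (f k) :=
    fun f => map_sum (AddMonoidHom.mk' s hadd) f _
  ext i j
  simp only [twistedStar, Matrix.of_apply, conjBy_apply, hsum, hsmul, star_mul', hg1, hg2]
  rw [Finset.sum_comm]
  refine Finset.sum_congr rfl fun q _ => Finset.sum_congr rfl fun p _ => ?_
  rw [mul_comm]

end TwistedMatrixProduct

/-! ### Unitary corepresentations of H viewed over the transmutation -/

section Transmuted

variable {Γ : Type*} [CommGroup Γ] {n : Type*} [Fintype n] [DecidableEq n]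
  {H : Type*} [Ring H] [HopfAlgebra ℂ H] [StarRing H] [StarModule ℂ H] [HopfStar H]
  (π : HopfStarHom H (MonoidAlgebra ℂ Γ)) (β : Γ →* Γ →* Circle)

namespace Transmutation

/-- In Σ_k x_ki* x_kj the scalars of the involution and of the product cancel term by term. In Σ_k
x_ik x_jk* they combine to β(a_i⁻¹a_j, a_j), which does not depend on k and is 1 for i = j, the only
case in which the sum is nonzero. -/
theorem map_of_mem_unitary_of_mem_bigraded {X : Matrix n n H} (hX : X ∈ unitary (Matrix n n H)) {a : n → Γ}
    (hmem : ∀ i j, X i j ∈ bigraded π (a i) (a j)) :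
    X.map (of π β) ∈ unitary (Matrix n n (Transmutation π β)) := by
  have h1 : (1 : Matrix n n H).map (of π β) = 1 := Matrix.map_one _ (map_zero _) (of_one π β)
  rw [Unitary.mem_iff]
  constructor
  · rw [← h1, ← hX.1]
    ext i j
    rw [Matrix.mul_apply, Matrix.map_apply, Matrix.mul_apply, map_sum]
    refine Finset.sum_congr rfl fun k _ => ?_
    have hβ : β ((a k)⁻¹ * a i) (a k)⁻¹ * β ((a k)⁻¹⁻¹ * (a i)⁻¹) (a k)⁻¹ = 1 := by
      rw [← MonoidHom.mul_apply, ← map_mul]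
      simp [mul_comm]
    rw [Matrix.star_apply, Matrix.map_apply, Matrix.map_apply, star_of_of_mem π β (hmem k i),
      smul_mul_assoc, of_mul_of_of_mem π β (star_mem_bigraded π (hmem k i)) (hmem k j),
      smul_smul, ← Circle.coe_mul, hβ, Circle.coe_one, one_smul, Matrix.star_apply]
  · ext i j
    have hβ : ∀ k, β ((a j)⁻¹ * a k) (a j)⁻¹ * β ((a i)⁻¹ * a k) (a j)⁻¹⁻¹ =
        β (a i)⁻¹ (a j) * β (a j) (a j) := fun k => by
      apply Additive.ofMul.injective
      simp only [map_mul, map_inv, MonoidHom.mul_apply, MonoidHom.inv_apply, ofMul_mul, ofMul_inv]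
      abel
    have hterm : ∀ k, X.map (of π β) i k * star (X.map (of π β)) k j =
        (β (a i)⁻¹ (a j) * β (a j) (a j) : ℂ) • of π β (X i k * star X k j) := fun k => by
      rw [Matrix.star_apply, Matrix.map_apply, Matrix.map_apply, star_of_of_mem π β (hmem j k),
        mul_smul_comm, of_mul_of_of_mem π β (hmem i k) (star_mem_bigraded π (hmem j k)),
        smul_smul, ← Circle.coe_mul, hβ, Circle.coe_mul, Matrix.star_apply]
    rw [Matrix.mul_apply, Finset.sum_congr rfl fun k _ => hterm k, ← Finset.smul_sum, ← map_sum,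
      ← Matrix.mul_apply, hX.2, ← h1, Matrix.map_apply]
    by_cases hij : i = j
    · subst hij
      rw [← Circle.coe_mul, ← MonoidHom.mul_apply, ← map_mul]
      simp
    · simp [hij]

/-- A unitary corepresentation matrix of `H` is a unitary matrix over `H_β`. -/
theorem map_of_mem_unitary {X : Matrix n n H} (hc : IsCorepMatrix X)
    (hX : X ∈ unitary (Matrix n n H)) {g : GL n ℂ} {a : n → Γ}
    (hg : Diagonalizes g a (X.map π.hom)) :
    X.map (of π β) ∈ unitary (Matrix n n (Transmutation π β)) := by
  have h := map_of_mem_unitary_of_mem_bigraded π β (conjBy_inv_mem_unitary hg.star_eq hX)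
    (conjBy_inv_mem_bigraded π hc hg)
  have h' := conjBy_map_linear (of π β).toLinearMap g⁻¹ X
  have h2 : (conjBy g⁻¹ X).map (of π β) = conjBy g⁻¹ (X.map (of π β)) := h'
  rw [h2] at h
  have h3 := conjBy_mem_unitary hg.star_eq h
  rwa [conjBy_conjBy_inv] at h3

theorem isCorepMatrix_map_of {X : Matrix n n H} (hc : IsCorepMatrix X) :
    IsCorepMatrix (X.map (of π β)) where
  comul i j := by
    rw [Matrix.map_apply, comul_of, hc.comul, map_sum]
    rfl
  counit i j := hc.counit i j

/-- With Z = π(X), the adjoint coaction is x_kj ↦ Σ_{p,q} x_pq ⊗ S(z_kp) z_qj. Tensoring with δ_Z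
multiplies this on the left by z_ik, and Σ_k z_ik S(z_kp) = δ_ip collapses the sum to Σ_q x_iq ⊗
z_qj. The argument works in any basis. -/
theorem isComodulePair {X : Matrix n n H} (hc : IsCorepMatrix X) :
    IsComodulePair (coact π β) (X.map π.hom) (X.map (of π β)) where
  corep_left := hc.map_hom π
  corep_right := isCorepMatrix_map_of π β hc
  equivariant := by
    have hco : ∀ k j, coact π β (of π β (X k j)) = ∑ p, ∑ q, of π β (X p q) ⊗ₜ
        (piLin π (HopfAlgebra.antipode ℂ (X k p)) * piLin π (X q j)) := fun k j => by
      have hmul : ∀ x y : H, piLin π (x * y) = piLin π x * piLin π y :=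
        map_mul (π.hom : H →ₐ[ℂ] MonoidAlgebra ℂ Γ)
      have h : coact π β (of π β (X k j)) = TensorProduct.map (of π β).toLinearMap (piLin π)
        (adjointCoact H (X k j)) := rfl
      rw [h, adjointCoact]
      simp only [LinearMap.comp_apply, hc.comul, map_sum, LinearMap.lTensor_tmul,
        TensorProduct.tmul_sum, TensorProduct.lift.tmul, LinearMap.coe_lTensorHom,
        LinearMap.mul_apply', TensorProduct.map_tmul, hmul]
      rfl
    have hcancel : ∀ i p, ∑ k, piLin π (X i k) * piLin π (HopfAlgebra.antipode ℂ (X k p)) =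
        (1 : Matrix n n (MonoidAlgebra ℂ Γ)) i p := fun i p => by
      have hmul : ∀ x y : H, piLin π (x * y) = piLin π x * piLin π y :=
        map_mul (π.hom : H →ₐ[ℂ] MonoidAlgebra ℂ Γ)
      have hone : piLin π 1 = 1 := map_one (π.hom : H →ₐ[ℂ] MonoidAlgebra ℂ Γ)
      simp only [← hmul]
      rw [← map_sum, sum_mul_antipode_of_isCorepMatrix hc]
      by_cases hip : i = p
      · subst hip; simp [hone]
      · simp [hip]
    refine (Pi.basisFun ℂ n).ext fun j => ?_
    rw [Pi.basisFun_apply, LinearMap.comp_apply, LinearMap.comp_apply, matCoact_single,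
      matCoact_single, map_sum, map_sum]
    have hπ : ∀ x : H, π.hom x = piLin π x := fun _ => rfl
    simp only [LinearMap.rTensor_tmul, matCoact_single, tensorCoact, LinearMap.comp_apply,
      TensorProduct.map_tmul, Matrix.map_apply, hco, TensorProduct.sum_tmul,
      TensorProduct.tmul_sum, map_sum, LinearEquiv.coe_coe,
      TensorProduct.tensorTensorTensorComm_tmul, LinearMap.lTensor_tmul, LinearMap.mul'_apply, hπ]
    have hterm : ∀ q i, ∑ p, ∑ k, ((Pi.single i (1 : ℂ) : n → ℂ) ⊗ₜ[ℂ] of π β (X p q)) ⊗ₜ[ℂ]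
        (piLin π (X i k) * (piLin π (HopfAlgebra.antipode ℂ (X k p)) * piLin π (X q j))) =
        ((Pi.single i (1 : ℂ) : n → ℂ) ⊗ₜ[ℂ] of π β (X i q)) ⊗ₜ[ℂ] piLin π (X q j) := fun q i => by
      simp only [← mul_assoc, ← TensorProduct.tmul_sum, ← Finset.sum_mul, hcancel]
      rw [Finset.sum_eq_single i]
      · rw [Matrix.one_apply_eq, one_mul]
      · intro p _ hp
        rw [Matrix.one_apply_ne (Ne.symm hp), zero_mul, TensorProduct.tmul_zero]
      · simp
    simp only [← hterm]
    -- The remaining lines only reorder the fourfold sum so that k and p become innermost.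
    symm
    refine (Finset.sum_congr rfl fun k _ => Finset.sum_comm).trans (Finset.sum_comm.trans ?_)
    refine Finset.sum_congr rfl fun q _ => ?_
    refine (Finset.sum_congr rfl fun k _ => Finset.sum_comm).trans (Finset.sum_comm.trans ?_)
    exact Finset.sum_congr rfl fun i _ => Finset.sum_comm

theorem tensorMat_conjBy {A B : Type*} [Ring A] [Algebra ℂ A] [StarRing A] [StarModule ℂ A]
    [Ring B] [Algebra ℂ B] [StarRing B] [StarModule ℂ B] (g : GL n ℂ) (V : Matrix n n A)
    (W : Matrix n n B) : FreeUnitary.tensorMat (conjBy g V) (conjBy g W) =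
      conjBy g (FreeUnitary.tensorMat V W) := by
  rw [FreeUnitary.tensorMat_eq, FreeUnitary.tensorMat_eq, ← conjBy_mul]
  congr 1
  · exact map_conjBy (FreeUnitary.inclL A B : A →ₐ[ℂ] A ⊗[ℂ] B) g V
  · exact map_conjBy (FreeUnitary.inclR A B : B →ₐ[ℂ] A ⊗[ℂ] B) g W

/-! ### Unitarity in the smash product ℂΓ ⊗_β H_β -/

section UnitaryPair

variable {X : Matrix n n H} {a : n → Γ}
  (hδ : ∀ a b, ∀ x ∈ bigraded π a b, coact π β (of π β x) = of π β x ⊗ₜ chi (a⁻¹ * b))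

/-- The product of `ℂΓ ⊗_β H_β`. -/
def smashMul : (MonoidAlgebra ℂ Γ ⊗[ℂ] Transmutation π β) ⊗[ℂ]
    (MonoidAlgebra ℂ Γ ⊗[ℂ] Transmutation π β) →ₗ[ℂ] MonoidAlgebra ℂ Γ ⊗[ℂ] Transmutation π β :=
  braidedMul (bicharForm β) (Coalgebra.comul (R := ℂ) (A := MonoidAlgebra ℂ Γ)) (coact π β)

/-- The involution of `ℂΓ ⊗_β H_β`. -/
def smashStar : MonoidAlgebra ℂ Γ ⊗[ℂ] Transmutation π β →
    MonoidAlgebra ℂ Γ ⊗[ℂ] Transmutation π β :=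
  braidedStar (bicharForm β) (Coalgebra.comul (R := ℂ) (A := MonoidAlgebra ℂ Γ)) (coact π β)

include hδ in
theorem smashMul_tmul {k : MonoidAlgebra ℂ Γ} {x : H} {b c d : Γ} {y : Transmutation π β}
    (hx : x ∈ bigraded π b c) : smashMul π β ((k ⊗ₜ of π β x) ⊗ₜ (chi d ⊗ₜ y)) =
      (β (b⁻¹ * c) d : ℂ) • ((k * chi d) ⊗ₜ (of π β x * y)) := by
  rw [smashMul, braidedMul_tmul_of_eq _ _ _ _ _ _ _ (hδ _ _ x hx) (comul_chi d), bicharForm_chi]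

include hδ in
-- The scalar from moving b⁻¹ past x* is inverse to the scalar in the transmuted involution, so the
-- adjoint of χ_b ⊗ x carries the original x* with no twist.
theorem smashStar_tmul {x : H} {b c : Γ} (hx : x ∈ bigraded π b c) :
    smashStar π β (chi b ⊗ₜ of π β x) = chi b⁻¹ ⊗ₜ of π β (star x) := by
  have h1 : coact π β (star (of π β x)) = star (of π β x) ⊗ₜ chi (b * c⁻¹) := by
    rw [star_of_of_mem π β hx, map_smul, hδ _ _ _ (star_mem_bigraded π hx), inv_inv,
      TensorProduct.smul_tmul']
  have h2 : Coalgebra.comul (R := ℂ) (star (chi b)) = star (chi b) ⊗ₜ[ℂ] chi b⁻¹ := by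
    rw [star_chi, comul_chi]
  have hβ : β (b * c⁻¹) b⁻¹ * β (b⁻¹ * c) b⁻¹ = 1 := by
    rw [← MonoidHom.mul_apply, ← map_mul]
    simp [mul_comm]
  rw [smashStar, braidedStar_tmul_of_eq _ _ _ _ _ h1 h2, star_of_of_mem π β hx, bicharForm_chi,
    TensorProduct.tmul_smul, smul_smul, ← Circle.coe_mul, hβ, Circle.coe_one, one_smul, star_chi]

/-- The matrix with entries `χ_i ⊗ x_ij`. -/
def smashMat (a : n → Γ) (X : Matrix n n H) :
    Matrix n n (MonoidAlgebra ℂ Γ ⊗[ℂ] Transmutation π β) :=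
  Matrix.of fun i j => chi (a i) ⊗ₜ of π β (X i j)

theorem chi_tmul_of_one_apply (i j : n) (c : ℂ) (hc : i = j → c = 1) :
    c • (chi ((a i)⁻¹ * a j) ⊗ₜ of π β ((1 : Matrix n n H) i j)) =
      (1 : Matrix n n (MonoidAlgebra ℂ Γ ⊗[ℂ] Transmutation π β)) i j := by
  by_cases hij : i = j
  · subst hij
    rw [hc rfl, one_smul, inv_mul_cancel, Matrix.one_apply_eq, Matrix.one_apply_eq, chi_one,
      of_one, Algebra.TensorProduct.one_def]
  · simp [hij]

include hδ in
-- For x ∈ H_{b,c} and y ∈ H_{d,e} the braiding contributes β(b⁻¹c, d) to (χ_b ⊗ x)(χ_d ⊗ y), and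
-- the transmuted product contributes β(b⁻¹c, d⁻¹). These cancel, so the matrices multiply as they
-- do over H, and unitarity of X carries over.
theorem twistedStar_mul_smashMat (hX : X ∈ unitary (Matrix n n H))
    (hmem : ∀ i j, X i j ∈ bigraded π (a i) (a j)) :
    twistedMul (smashMul π β) (twistedStar (smashStar π β) (smashMat π β a X))
      (smashMat π β a X) = 1 := by
  ext i j
  have hterm : ∀ k, smashMul π β (smashStar π β (smashMat π β a X k i) ⊗ₜ smashMat π β a X k j) =
      (1 : MonoidAlgebra ℂ Γ) ⊗ₜ of π β (star X i k * X k j) := fun k => by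
    have hβ : β ((a k)⁻¹⁻¹ * (a i)⁻¹) (a k) * β ((a k)⁻¹⁻¹ * (a i)⁻¹) (a k)⁻¹ = 1 := by
      rw [← map_mul, mul_inv_cancel, map_one]
    rw [smashMat, Matrix.of_apply, Matrix.of_apply, smashStar_tmul π β hδ (hmem k i),
      smashMul_tmul π β hδ (star_mem_bigraded π (hmem k i)),
      of_mul_of_of_mem π β (star_mem_bigraded π (hmem k i)) (hmem k j), TensorProduct.tmul_smul,
      smul_smul, ← Circle.coe_mul, hβ, Circle.coe_one, one_smul, chi_mul, inv_mul_cancel, chi_one,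
      Matrix.star_apply]
  simp only [twistedMul, twistedStar, Matrix.of_apply, hterm]
  rw [← TensorProduct.tmul_sum, ← map_sum, ← Matrix.mul_apply, hX.1]
  have h := chi_tmul_of_one_apply π β (a := fun _ : n => (1 : Γ)) i j 1 (fun _ => rfl)
  simpa [chi_one] using h

include hδ in
theorem smashMat_mul_twistedStar (hX : X ∈ unitary (Matrix n n H))
    (hmem : ∀ i j, X i j ∈ bigraded π (a i) (a j)) :
    twistedMul (smashMul π β) (smashMat π β a X)
      (twistedStar (smashStar π β) (smashMat π β a X)) = 1 := by
  ext i j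
  have hterm : ∀ k, smashMul π β (smashMat π β a X i k ⊗ₜ smashStar π β (smashMat π β a X j k)) =
      chi (a i * (a j)⁻¹) ⊗ₜ of π β (X i k * star X k j) := fun k => by
    have hβ : β ((a i)⁻¹ * a k) (a j)⁻¹ * β ((a i)⁻¹ * a k) (a j)⁻¹⁻¹ = 1 := by
      rw [← map_mul, mul_inv_cancel, map_one]
    rw [smashMat, Matrix.of_apply, Matrix.of_apply, smashStar_tmul π β hδ (hmem j k),
      smashMul_tmul π β hδ (hmem i k),
      of_mul_of_of_mem π β (hmem i k) (star_mem_bigraded π (hmem j k)), TensorProduct.tmul_smul,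
      smul_smul, ← Circle.coe_mul, hβ, Circle.coe_one, one_smul, chi_mul, Matrix.star_apply]
  simp only [twistedMul, twistedStar, Matrix.of_apply, hterm]
  rw [← TensorProduct.tmul_sum, ← map_sum, ← Matrix.mul_apply, hX.2]
  have h := chi_tmul_of_one_apply π β (a := fun i => (a i)⁻¹) i j 1 (fun _ => rfl)
  simpa using h

include hδ in
/-- A unitary corepresentation matrix of `H` defines a unitary comodule over `H_β`. -/
theorem isUnitaryPair (hc : IsCorepMatrix X) (hX : X ∈ unitary (Matrix n n H)) {g : GL n ℂ}
    (hg : Diagonalizes g a (X.map π.hom)) :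
    IsUnitaryPair (bicharForm β) (coact π β) (X.map π.hom) (X.map (of π β)) := by
  have hX' := conjBy_inv_mem_unitary hg.star_eq hX
  have hmem := conjBy_inv_mem_bigraded π hc hg
  -- In the diagonal basis the sum Σ_k z_ik ⊗ x_kj has the single term χ_{a_i} ⊗ x_ij, so the matrix
  -- whose unitarity is claimed is a unitary conjugate of `smashMat`.
  have hT : FreeUnitary.tensorMat (X.map π.hom) (X.map (of π β)) =
      conjBy g (smashMat π β a (conjBy g⁻¹ X)) := by
    have h1 : X.map (of π β) = conjBy g ((conjBy g⁻¹ X).map (of π β)) := by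
      have h := conjBy_map_linear (of π β).toLinearMap g (conjBy g⁻¹ X)
      rw [conjBy_conjBy_inv] at h
      exact h
    have h2 : X.map π.hom = conjBy g (Matrix.diagonal fun i => chi (a i)) := by
      rw [← hg.conj_eq, conjBy_conjBy_inv]
    rw [h1, h2, tensorMat_conjBy]
    congr 1
    ext i j
    simp only [FreeUnitary.tensorMat, Matrix.of_apply, smashMat, Matrix.map_apply]
    rw [Finset.sum_eq_single i]
    · rw [Matrix.diagonal_apply_eq]
    · intro k _ hk
      rw [Matrix.diagonal_apply_ne _ (Ne.symm hk), TensorProduct.zero_tmul]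
    · simp
  have hS : twistedStar (smashStar π β)
      (FreeUnitary.tensorMat (X.map π.hom) (X.map (of π β))) =
      conjBy g (twistedStar (smashStar π β) (smashMat π β a (conjBy g⁻¹ X))) := by
    rw [hT]
    refine twistedStar_conjBy _ (fun x y => ?_) (fun c x => ?_) hg.star_eq _
    · simp only [smashStar, braidedStar, star_add, map_add]
    · simp only [smashStar, braidedStar, star_smul, map_smul]
  have hone : ∀ i j : n, (1 : Matrix n n (MonoidAlgebra ℂ Γ ⊗[ℂ] Transmutation π β)) i j =
      if i = j then 1 ⊗ₜ 1 else 0 := fun i j => by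
    rw [Matrix.one_apply, Algebra.TensorProduct.one_def]
  refine ⟨isComodulePair π β hc, fun i j => ?_, fun i j => ?_⟩
  · have h := twistedMul_conjBy (smashMul π β) g
      (twistedStar (smashStar π β) (smashMat π β a (conjBy g⁻¹ X)))
      (smashMat π β a (conjBy g⁻¹ X))
    rw [twistedStar_mul_smashMat π β hδ hX' hmem, conjBy_one, ← hS, ← hT] at h
    exact (congrFun (congrFun h i) j).trans (hone i j)
  · have h := twistedMul_conjBy (smashMul π β) g (smashMat π β a (conjBy g⁻¹ X))
      (twistedStar (smashStar π β) (smashMat π β a (conjBy g⁻¹ X)))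
    rw [smashMat_mul_twistedStar π β hδ hX' hmem, conjBy_one, ← hS, ← hT] at h
    exact (congrFun (congrFun h i) j).trans (hone i j)

end UnitaryPair

end Transmutation

end Transmuted

/-! ### Conjugate matrices -/

section Conjugate

variable {n : Type*} [Fintype n] [DecidableEq n]

/-- The entrywise complex conjugate of an invertible matrix. -/
def barGL (g : GL n ℂ) : GL n ℂ := Units.map (starRingEnd ℂ).mapMatrix.toMonoidHom g

theorem barGL_apply (g : GL n ℂ) (i j : n) : (barGL g).val i j = star (g.val i j) := rfl

theorem barGL_inv_apply (g : GL n ℂ) (i j : n) : (barGL g)⁻¹.val i j = star (g⁻¹.val i j) := rfl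

variable {A : Type*} [Ring A] [Algebra ℂ A]

/-- For unitary g the transpose of g⁻¹ is ḡ. This is why conjugation by g for U goes together with
conjugation by ḡ for Ū. -/
theorem transpose_conjBy {g : GL n ℂ} (hg : star g.val = g⁻¹.val) (V : Matrix n n A) :
    (conjBy g V).transpose = conjBy (barGL g) V.transpose := by
  have h1 : (g⁻¹.val).transpose = (barGL g).val := by
    rw [← hg]; rfl
  have h2 : (g.val).transpose = (barGL g)⁻¹.val := by
    have h3 : g.val = star g⁻¹.val := by rw [← hg, star_star]
    rw [h3]; rfl
  rw [conjBy, transpose_scalar_mul_mul, h1, h2, conjBy]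

theorem transpose_conjBy_barGL {g : GL n ℂ} (hg : star g.val = g⁻¹.val) (V : Matrix n n A) :
    (conjBy (barGL g) V).transpose = conjBy g V.transpose := by
  rw [← Matrix.transpose_transpose (conjBy g V.transpose), transpose_conjBy hg,
    Matrix.transpose_transpose]

theorem star_barGL {g : GL n ℂ} (hg : star g.val = g⁻¹.val) : star (barGL g) = (barGL g)⁻¹ := by
  refine Units.ext (Matrix.ext fun i j => ?_)
  rw [Units.coe_star, Matrix.star_apply, barGL_apply, barGL_inv_apply, ← hg, Matrix.star_apply]

variable [StarRing A] [StarModule ℂ A]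

theorem barMat_conjBy (g : GL n ℂ) (V : Matrix n n A) :
    barMat (conjBy g V) = conjBy (barGL g) (barMat V) := by
  ext i j
  simp only [barMat_apply, conjBy_apply, star_sum, star_smul, barGL_apply, barGL_inv_apply,
    star_mul']

theorem star_conjBy_eq (F : GL n ℂ) (V : Matrix n n A) :
    star (conjBy F V) = conjBy (star F)⁻¹ (star V) := by
  rw [conjBy, star_mul, star_mul, star_scalarMat, star_scalarMat, conjBy, ← mul_assoc]
  rfl

theorem star_barMat (V : Matrix n n A) : star (barMat V) = V.transpose := by
  ext i j; simp [barMat, Matrix.star_apply]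

/-- Unitarity of `F V F⁻¹` in terms of `F*F`. -/
theorem mul_conjBy_star_of_mem_unitary {F : GL n ℂ} {V : Matrix n n A}
    (h : conjBy F V ∈ unitary (Matrix n n A)) :
    V * conjBy (star F * F)⁻¹ (star V) = 1 ∧ conjBy (star F * F)⁻¹ (star V) * V = 1 := by
  have h1 : conjBy (star F * F)⁻¹ (star V) = conjBy F⁻¹ (star (conjBy F V)) := by
    rw [star_conjBy_eq, conjBy_conjBy, mul_inv_rev]
  have h2 : V = conjBy F⁻¹ (conjBy F V) := (conjBy_inv_conjBy F V).symm
  rw [h1]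
  constructor
  · nth_rewrite 1 [h2]
    rw [conjBy_mul, h.2, conjBy_one]
  · nth_rewrite 2 [h2]
    rw [conjBy_mul, h.1, conjBy_one]

end Conjugate

/-! ### Block structure of F*F relative to the eigenspaces of Z -/

section Blocks

variable {Γ : Type*} [CommGroup Γ] {n : Type*} [Fintype n] [DecidableEq n]

/-- The (i, j) entry of the relation reads c_ij a_j = c_ij a_i in the group algebra, where distinct
group elements are linearly independent. -/
theorem apply_eq_zero_of_commute {a : n → Γ} {c : Matrix n n ℂ}
    (h : scalarMat (MonoidAlgebra ℂ Γ) c * Matrix.diagonal (fun i => chi (a i)) =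
      Matrix.diagonal (fun i => chi (a i)) * scalarMat _ c) (i j : n) (hij : a i ≠ a j) :
    c i j = 0 := by
  classical
  have h1 := congrArg (fun k => k.coeff (a i)) (congrFun (congrFun h i) j)
  rw [Matrix.mul_diagonal, Matrix.diagonal_mul, scalarMat, Matrix.map_apply,
    ← Algebra.commutes (c i j) (chi (a i)), ← Algebra.smul_def, ← Algebra.smul_def] at h1
  simpa [chi, Finsupp.single_apply, hij, Ne.symm hij] using h1.symm

/-- The matrix `F*F`, in a basis that diagonalizes `Z`, is block diagonal if `F Z̄ F⁻¹` is
unitary. -/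
theorem blockDiagonal_of_conjBy_mem_unitary {F g : GL n ℂ} {a : n → Γ}
    {Z : Matrix n n (MonoidAlgebra ℂ Γ)} (hg : Diagonalizes g a Z)
    (hF : conjBy F (barMat Z) ∈ unitary (Matrix n n (MonoidAlgebra ℂ Γ))) (i j : n)
    (hij : a i ≠ a j) :
    (star (F * barGL g) * (F * barGL g)).val i j = 0 ∧
      (star (F * barGL g) * (F * barGL g))⁻¹.val i j = 0 := by
  set D : Matrix n n (MonoidAlgebra ℂ Γ) := Matrix.diagonal fun i => chi (a i) with hD
  have hZ : conjBy F (barMat Z) = conjBy (F * barGL g) (barMat D) := by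
    rw [hD, ← hg.conj_eq, ← conjBy_conjBy, ← barMat_conjBy, conjBy_conjBy_inv]
  rw [hZ] at hF
  have h := (mul_conjBy_star_of_mem_unitary hF).2
  set Q := star (F * barGL g) * (F * barGL g)
  have hDD : barMat D * D = 1 := by
    have hb : barMat D = Matrix.diagonal fun i => chi (a i)⁻¹ := by
      ext i j
      by_cases hij : i = j
      · subst hij; simp [barMat_apply, hD, star_chi]
      · simp [barMat_apply, hD, hij]
    rw [hb, hD, Matrix.diagonal_mul_diagonal]
    simp [chi_mul, chi_one]
  -- Unitarity says that Q⁻¹DQ is a left inverse of D̄. Since D̄D = 1, this gives Q⁻¹DQ = D, so Q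
  -- and Q⁻¹ commute with D.
  have hQ : conjBy Q⁻¹ D = D := by
    rw [star_barMat, hD, Matrix.diagonal_transpose, ← hD] at h
    calc conjBy Q⁻¹ D = conjBy Q⁻¹ D * (barMat D * D) := by rw [hDD, mul_one]
      _ = D := by rw [← mul_assoc, h, one_mul]
  have h1 : scalarMat (MonoidAlgebra ℂ Γ) Q⁻¹.val * D = D * scalarMat _ Q⁻¹.val := by
    nth_rewrite 2 [← hQ]
    rw [conjBy, inv_inv, mul_assoc _ (scalarMat _ Q.val), scalarMat_mul_inv, mul_one]
  have h2 : scalarMat (MonoidAlgebra ℂ Γ) Q.val * D = D * scalarMat _ Q.val := by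
    nth_rewrite 1 [← hQ]
    rw [conjBy, inv_inv, ← mul_assoc, ← mul_assoc, scalarMat_mul_inv, one_mul]
  exact ⟨apply_eq_zero_of_commute h2 i j hij, apply_eq_zero_of_commute h1 i j hij⟩

end Blocks

/-! ### The Hopf star-algebra structure in terms of the bigrading -/

theorem mul_mem_comulSpan {Γ : Type*} [CommGroup Γ] {H : Type*} [Ring H] [HopfAlgebra ℂ H] [StarRing H]
    (π : HopfStarHom H (MonoidAlgebra ℂ Γ)) {a b c d : Γ} {s t : H ⊗[ℂ] H}
    (hs : s ∈ comulSpan π a b) (ht : t ∈ comulSpan π c d) :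
    s * t ∈ comulSpan π (a * c) (b * d) := by
  refine comulSpan_induction π (P := fun s => s * t ∈ comulSpan π (a * c) (b * d)) ?_
    (fun _ _ h h' => ?_) (fun k _ h => ?_) (fun e y hy z hz => ?_) hs
  · simp
  · rw [add_mul]; exact add_mem h h'
  · rw [smul_mul_assoc]; exact Submodule.smul_mem _ k h
  refine comulSpan_induction π
    (P := fun t => y ⊗ₜ[ℂ] z * t ∈ comulSpan π (a * c) (b * d)) ?_
    (fun _ _ h h' => ?_) (fun k _ h => ?_) (fun f y' hy' z' hz' => ?_) ht
  · simp
  · rw [mul_add]; exact add_mem h h'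
  · rw [mul_smul_comm]; exact Submodule.smul_mem _ k h
  rw [Algebra.TensorProduct.tmul_mul_tmul]
  exact tmul_mem_comulSpan π (mul_mem_bigraded π hy hy') (mul_mem_bigraded π hz hz')

namespace FreeUnitary

variable {Γ : Type*} [CommGroup Γ] {n : Type*} [Fintype n] [DecidableEq n] {F : GL n ℂ}
  (π : HopfStarHom (FreeUnitary F) (MonoidAlgebra ℂ Γ)) {g : GL n ℂ} {a : n → Γ}

/-- The spaces ⨁_e H_{a,e} ⊗ H_{e,b} multiply compatibly with degrees, so it suffices to look at
Δ(u'_ij) = Σ_k u'_ik ⊗ u'_kj and its adjoint, where e is a_k or a_k⁻¹. -/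
theorem comul_mem_comulSpan (hg : Diagonalizes g a ((U F).map π.hom)) (b c : Γ)
    (x : FreeUnitary F) (hx : x ∈ bigraded π b c) :
    Coalgebra.comul (R := ℂ) x ∈ comulSpan π b c := by
  have hmem := conjBy_inv_mem_bigraded π isCorepMatrix_U hg
  have hc := (isCorepMatrix_U (F := F)).conjBy g⁻¹
  refine homogeneous_induction (P := fun b c x => Coalgebra.comul (R := ℂ) x ∈ comulSpan π b c)
    hg ?_ ?_ ?_ ?_ ?_ ?_ ?_ hx
  · intro a b; rw [map_zero]; exact zero_mem _
  · intro a b x y hx hy; rw [map_add]; exact add_mem hx hy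
  · intro a b k x hx; rw [map_smul]; exact Submodule.smul_mem _ k hx
  · rw [Bialgebra.comul_one, Algebra.TensorProduct.one_def]
    exact tmul_mem_comulSpan π (one_mem_bigraded π) (one_mem_bigraded π)
  · intro a b c d x _ y _ hx hy
    rw [Bialgebra.comul_mul]
    exact mul_mem_comulSpan π hx hy
  · intro i j
    rw [hc.comul]
    exact Submodule.sum_mem _ fun k _ => tmul_mem_comulSpan π (hmem i k) (hmem k j)
  · intro i j
    rw [HopfStar.comul_star, hc.comul, star_sum]
    exact Submodule.sum_mem _ fun k _ => tmul_mem_comulSpan π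
      (star_mem_bigraded π (hmem i k)) (star_mem_bigraded π (hmem k j))

/-- The antipode on the adjoints of the homogeneous generators. -/
theorem antipode_star_generator (i j : n) :
    HopfAlgebra.antipode ℂ (star (conjBy g⁻¹ (U F) i j)) =
      conjBy (star (F * barGL g) * (F * barGL g))⁻¹ (conjBy g⁻¹ (U F)).transpose i j := by
  set G := F * barGL g with hG
  set Y := barMat (conjBy g⁻¹ (U F)) with hY
  have hYG : conjBy G Y = conjBy F (barMat (U F)) := by
    rw [hG, ← conjBy_conjBy, hY, ← barMat_conjBy, conjBy_conjBy_inv]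
  have hYu : conjBy G Y ∈ unitary (Matrix n n (FreeUnitary F)) := by rw [hYG]; exact conj_mem
  have hYc : IsCorepMatrix (conjBy G Y) := by rw [hYG]; exact isCorepMatrix_U.barMat.conjBy F
  -- The matrix G Y G⁻¹ is F Ū F⁻¹, a unitary corepresentation matrix, on which the antipode is the
  -- adjoint. Conjugating back by G replaces F*F by G*G.
  have h1 : (conjBy G Y).map (HopfAlgebra.antipode ℂ) = star (conjBy G Y) := by
    ext i j
    exact antipode_of_isCorepMatrix hYc hYu i j
  have h2 : Y.map (HopfAlgebra.antipode ℂ) = conjBy (star G * G)⁻¹ (star Y) := by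
    rw [← conjBy_inv_conjBy G Y, conjBy_map_linear, h1, star_conjBy_eq, conjBy_inv_conjBy,
      conjBy_conjBy, ← mul_inv_rev]
  rw [hY, star_barMat] at h2
  exact congrFun (congrFun h2 i) j

/-- On u'_ij the antipode is u'_ji*, of the required degree. On u'_ij* it is a combination of
entries u'_qp, and block diagonality of G*G and its inverse, with G = Fḡ, keeps only those with a_p
= a_i and a_q = a_j, that is, of degree (a_j, a_i). -/
theorem antipode_mem_bigraded (hg : Diagonalizes g a ((U F).map π.hom))
    (hF : conjBy F (barMat ((U F).map π.hom)) ∈ unitary (Matrix n n (MonoidAlgebra ℂ Γ)))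
    (b c : Γ) (x : FreeUnitary F) (hx : x ∈ bigraded π b c) :
    HopfAlgebra.antipode ℂ x ∈ bigraded π c⁻¹ b⁻¹ := by
  have hmem := conjBy_inv_mem_bigraded π isCorepMatrix_U hg
  have hc := (isCorepMatrix_U (F := F)).conjBy g⁻¹
  have hu := conjBy_inv_mem_unitary hg.star_eq (U_mem (F := F))
  refine homogeneous_induction
    (P := fun b c x => HopfAlgebra.antipode ℂ x ∈ bigraded π c⁻¹ b⁻¹) hg ?_ ?_ ?_ ?_ ?_ ?_ ?_ hx
  · intro a b; rw [map_zero]; exact zero_mem _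
  · intro a b x y hx hy; rw [map_add]; exact add_mem hx hy
  · intro a b k x hx; rw [map_smul]; exact Submodule.smul_mem _ k hx
  · rw [HopfAlgebra.antipode_one, inv_one]
    exact one_mem_bigraded π
  · intro a b c d x _ y _ hx hy
    rw [HopfAlgebra.antipode_mul_antidistrib, mul_inv_rev, mul_inv_rev]
    exact mul_mem_bigraded π hy hx
  · intro i j
    rw [antipode_of_isCorepMatrix hc hu]
    exact star_mem_bigraded π (hmem j i)
  · intro i j
    rw [antipode_star_generator, conjBy_apply, inv_inv, inv_inv]
    refine Submodule.sum_mem _ fun q _ => Submodule.sum_mem _ fun p _ => ?_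
    by_cases hip : a i = a p
    · by_cases hqj : a q = a j
      · rw [hip, ← hqj]
        exact Submodule.smul_mem _ _ (hmem q p)
      · rw [inv_inv, (blockDiagonal_of_conjBy_mem_unitary hg hF q j hqj).1, mul_zero, zero_smul]
        exact zero_mem _
    · rw [(blockDiagonal_of_conjBy_mem_unitary hg hF i p hip).2, zero_mul, zero_smul]
      exact zero_mem _

end FreeUnitary

/-! ### The conjugate matrix `Ū_Z` -/

section BarZ

variable {Γ : Type*} [CommGroup Γ] {n : Type*} [Fintype n] [DecidableEq n]
  (β : Γ →* Γ →* Circle)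

/-- The matrix with entries `β(a_i⁻¹ a_j, a_i) v_ij*`, which is the matrix `V̄_Z` for the diagonal
matrix `Z` with diagonal entries `a_i`. -/
def twistedBar {B : Type*} [Star B] [SMul ℂ B] (a : n → Γ) (V : Matrix n n B) : Matrix n n B :=
  Matrix.of fun i j => (β ((a i)⁻¹ * a j) (a i) : ℂ) • star (V i j)

/-- In the basis diagonalizing Z the sums defining V̄_Z reduce to multiplying each v'_ij* by one
value of β. The conjugate of V transforms by ḡ, since the star conjugates scalars. -/
theorem barZ_eq {B : Type*} [Ring B] [Algebra ℂ B] [StarRing B] [StarModule ℂ B]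
    {Z : Matrix n n (MonoidAlgebra ℂ Γ)} {g : GL n ℂ} {a : n → Γ} (hg : Diagonalizes g a Z)
    (V : Matrix n n B) : barZ (bicharForm β) Z V =
      conjBy (barGL g) (twistedBar β a (conjBy g⁻¹ V)) := by
  have hg1 : ∀ i j, star (g.val i j) = g⁻¹.val j i := fun i j => by
    rw [← hg.star_eq, Matrix.star_apply]
  have hg2 : ∀ i j, star (g⁻¹.val i j) = g.val j i := fun i j => by
    rw [← hg.star_eq, Matrix.star_apply, star_star]
  have hZ : ∀ i j, Z i j = ∑ p, (g.val i p * g⁻¹.val p j) • chi (a p) := fun i j => by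
    have h : Z = conjBy g (Matrix.diagonal fun i => chi (a i)) := by
      rw [← hg.conj_eq, conjBy_conjBy_inv]
    rw [h, conjBy_apply]
    refine Finset.sum_congr rfl fun q _ => ?_
    rw [Finset.sum_eq_single q]
    · rw [Matrix.diagonal_apply_eq]
    · intro p _ hp
      rw [Matrix.diagonal_apply_ne _ hp, smul_zero]
    · simp
  have hZs : ∀ i j, star (Z i j) = ∑ p, (g⁻¹.val p i * g.val j p) • chi (a p)⁻¹ := fun i j => by
    rw [hZ, star_sum]
    refine Finset.sum_congr rfl fun p _ => ?_
    rw [star_smul, star_mul', hg1, hg2, star_chi]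
  have hdelta : ∀ p r, ∑ l, g⁻¹.val p l * g.val l r = (1 : Matrix n n ℂ) p r := fun p r => by
    rw [← Matrix.mul_apply, ← Units.val_mul, inv_mul_cancel, Units.val_one]
  -- The repeated index l is contracted first: g⁻¹g = 1 forces the group elements in z_sl and z_il*
  -- to be inverse to each other.
  have hl : ∀ s i, ∑ l, Z s l ⊗ₜ[ℂ] star (Z i l) =
      ∑ p, (g.val s p * g⁻¹.val p i) • (chi (a p) ⊗ₜ[ℂ] chi (a p)⁻¹) := fun s i => by
    have h1 : ∀ l, Z s l ⊗ₜ[ℂ] star (Z i l) = ∑ p, ∑ r,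
        (g⁻¹.val p l * g.val l r) • ((g.val s p * g⁻¹.val r i) • (chi (a p) ⊗ₜ chi (a r)⁻¹)) :=
      fun l => by
      rw [hZ, hZs, TensorProduct.sum_tmul]
      refine Finset.sum_congr rfl fun p _ => ?_
      rw [TensorProduct.tmul_sum]
      refine Finset.sum_congr rfl fun r _ => ?_
      rw [TensorProduct.smul_tmul_smul, smul_smul]
      congr 1
      ring
    rw [Finset.sum_congr rfl fun l _ => h1 l, Finset.sum_comm]
    refine Finset.sum_congr rfl fun p _ => ?_
    rw [Finset.sum_comm]
    simp only [← Finset.sum_smul, hdelta]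
    rw [Finset.sum_eq_single p]
    · rw [Matrix.one_apply_eq, one_smul]
    · intro r _ hr
      rw [Matrix.one_apply_ne (Ne.symm hr), zero_smul]
    · simp
  have hR : ∀ (k : MonoidAlgebra ℂ Γ) s i,
      ∑ l, bicharForm β ((k * Z s l) ⊗ₜ star (Z i l)) =
      ∑ p, (g.val s p * g⁻¹.val p i) * bicharForm β ((k * chi (a p)) ⊗ₜ chi (a p)⁻¹) :=
    fun k s i => by
    have h := congrArg (bicharForm β ∘ₗ (LinearMap.mulLeft ℂ k).rTensor _) (hl s i)
    simpa only [map_sum, map_smul, LinearMap.comp_apply, LinearMap.rTensor_tmul,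
      LinearMap.mulLeft_apply, smul_eq_mul] using h
  have hRR : ∀ t j s i, ∑ l, bicharForm β ((star (Z t j) * Z s l) ⊗ₜ star (Z i l)) =
      ∑ q, ∑ p, (g⁻¹.val q t * g.val j q) * ((g.val s p * g⁻¹.val p i) *
        (β ((a p)⁻¹ * a q) (a p) : ℂ)) := fun t j s i => by
    have hβ : ∀ p q, β ((a q)⁻¹ * a p) (a p)⁻¹ = β ((a p)⁻¹ * a q) (a p) := fun p q => by
      rw [← inv_inv ((a p)⁻¹ * a q), mul_inv_rev, inv_inv, map_inv, map_inv, MonoidHom.inv_apply]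
    rw [hR, Finset.sum_comm]
    refine Finset.sum_congr rfl fun p _ => ?_
    rw [hZs, Finset.sum_mul, TensorProduct.sum_tmul, map_sum, Finset.mul_sum]
    refine Finset.sum_congr rfl fun q _ => ?_
    rw [smul_mul_assoc, chi_mul, ← TensorProduct.smul_tmul', map_smul, bicharForm_chi, hβ,
      smul_eq_mul]
    ring
  ext i j
  have hLHS : barZ (bicharForm β) Z V i j = ∑ s, ∑ t, ∑ q, ∑ p,
      ((g⁻¹.val q t * g.val j q) * ((g.val s p * g⁻¹.val p i) *
        (β ((a p)⁻¹ * a q) (a p) : ℂ))) • star (V s t) := by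
    rw [barZ, Matrix.of_apply]
    refine Finset.sum_congr rfl fun s _ => ?_
    rw [Finset.sum_comm]
    refine Finset.sum_congr rfl fun t _ => ?_
    rw [← Finset.sum_smul, hRR, Finset.sum_smul]
    simp only [Finset.sum_smul]
  have hRHS : conjBy (barGL g) (twistedBar β a (conjBy g⁻¹ V)) i j = ∑ q, ∑ p, ∑ t, ∑ s,
      ((g⁻¹.val q t * g.val j q) * ((g.val s p * g⁻¹.val p i) *
        (β ((a p)⁻¹ * a q) (a p) : ℂ))) • star (V s t) := by
    rw [conjBy_apply]
    refine Finset.sum_congr rfl fun q _ => Finset.sum_congr rfl fun p _ => ?_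
    rw [twistedBar, Matrix.of_apply, conjBy_apply, star_sum, Finset.smul_sum, Finset.smul_sum]
    refine Finset.sum_congr rfl fun t _ => ?_
    rw [star_sum, Finset.smul_sum, Finset.smul_sum]
    refine Finset.sum_congr rfl fun s _ => ?_
    rw [star_smul, smul_smul, smul_smul, star_mul', inv_inv, hg1, hg2, barGL_apply,
      barGL_inv_apply, hg1, hg2]
    congr 1
    ring
  rw [hLHS, hRHS]
  refine (Finset.sum_congr rfl fun s _ => Finset.sum_comm).trans (Finset.sum_comm.trans ?_)
  refine Finset.sum_congr rfl fun q _ => ?_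
  refine (Finset.sum_congr rfl fun s _ => Finset.sum_comm).trans (Finset.sum_comm.trans ?_)
  exact Finset.sum_congr rfl fun p _ => Finset.sum_comm

end BarZ

/-! ### The universal property of the transmutation -/

section Operators

variable {Γ : Type*} [CommGroup Γ] (β : Γ →* Γ →* Circle) {B : Type*} [Ring B] [Algebra ℂ B]

/-- The operator `f ↦ (k ↦ β(a⁻¹b, (ka)⁻¹) y f(ka))` on the functions `Γ → B`. These operators
span a copy of the twist of `B ⊗ ℂ[Γ × Γ]` by the cocycle inverse to that of the transmutation. -/
def twistOp (a b : Γ) : B →ₗ[ℂ] Module.End ℂ (Γ → B) where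
  toFun y :=
    { toFun := fun f k => (β (a⁻¹ * b) (k * a)⁻¹ : ℂ) • (y * f (k * a))
      map_add' := fun f h => by ext k; simp [mul_add]
      map_smul' := fun c f => by ext k; simp [smul_comm c] }
  map_add' y z := by ext f k; simp [add_mul]
  map_smul' c y := by ext f k; simp [smul_comm c]

theorem twistOp_apply (a b : Γ) (y : B) (f : Γ → B) (k : Γ) :
    twistOp β a b y f k = (β (a⁻¹ * b) (k * a)⁻¹ : ℂ) • (y * f (k * a)) := rfl

/-- The second operator is evaluated at ka, and (ka)⁻¹ = c (kac)⁻¹ splits off β(a⁻¹b, c). This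
factor is the inverse of the transmutation factor β(a⁻¹b, c⁻¹), so passing to these operators undoes
the twist. -/
theorem twistOp_mul (a b c d : Γ) (y z : B) : twistOp β a b y * twistOp β c d z =
    (β (a⁻¹ * b) c : ℂ) • twistOp β (a * c) (b * d) (y * z) := by
  ext f k
  have hβ : β (a⁻¹ * b) (k * a)⁻¹ * β (c⁻¹ * d) (k * a * c)⁻¹ =
      β (a⁻¹ * b) c * β ((a * c)⁻¹ * (b * d)) (k * (a * c))⁻¹ := by
    apply Additive.ofMul.injective
    simp only [mul_inv, map_mul, map_inv, MonoidHom.mul_apply, MonoidHom.inv_apply, ofMul_mul,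
      ofMul_inv]
    abel
  rw [Module.End.mul_apply, twistOp_apply, twistOp_apply, LinearMap.smul_apply, Pi.smul_apply,
    twistOp_apply, mul_smul_comm, smul_smul, smul_smul, ← Circle.coe_mul, ← Circle.coe_mul, hβ,
    mul_assoc, mul_assoc]

theorem twistOp_one : twistOp β 1 1 (1 : B) = 1 := by
  ext f k
  simp [twistOp_apply]

/-- For fixed degrees (a, b) the element y is recovered by applying its operator to the constant
function 1 and evaluating at the unit of Γ. The prefactor cancels the value of β picked up there. -/
theorem twistOp_one_one (a b : Γ) (y : B) :
    (β (a⁻¹ * b) a : ℂ) • twistOp β a b y 1 1 = y := by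
  rw [twistOp_apply, smul_smul, ← Circle.coe_mul, one_mul, ← map_mul, mul_inv_cancel, map_one,
    Circle.coe_one, one_smul, Pi.one_apply, mul_one]

/-- The elements of `B` as operators. -/
def leftOp : B →ₐ[ℂ] Module.End ℂ (Γ → B) :=
  AlgHom.ofLinearMap (twistOp β 1 1) (twistOp_one β) fun x y => by
    rw [twistOp_mul]; simp

theorem leftOp_apply (y : B) : leftOp β y = twistOp β 1 1 y := rfl

/-! ### Matrices of twisted operators -/

variable {n : Type*} [Fintype n] [DecidableEq n] (a : n → Γ)

/-- The matrix of operators defined by a matrix with entries of degrees `(a_i, a_j)`. -/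
def twistOpMat (V : Matrix n n B) : Matrix n n (Module.End ℂ (Γ → B)) :=
  Matrix.of fun i j => twistOp β (a i) (a j) (V i j)

variable (B) in
/-- The diagonal matrix of shift operators. -/
def shiftMat : Matrix n n (Module.End ℂ (Γ → B)) :=
  Matrix.diagonal fun i => twistOp β (a i) 1 1

variable (B) in
/-- The inverse of `shiftMat`. -/
def shiftMatInv : Matrix n n (Module.End ℂ (Γ → B)) :=
  Matrix.diagonal fun i => (β (a i) (a i)⁻¹ : ℂ) • twistOp β (a i)⁻¹ 1 1

variable (B) in
/-- The diagonal matrix of multiplications by characters. -/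
def charMat : Matrix n n (Module.End ℂ (Γ → B)) :=
  Matrix.diagonal fun i => twistOp β 1 (a i) 1

theorem shiftMat_mul_inv : shiftMat β B a * shiftMatInv β B a = 1 := by
  rw [shiftMat, shiftMatInv, Matrix.diagonal_mul_diagonal, ← Matrix.diagonal_one]
  congr 1
  ext1 i
  -- Composing the shifts by a_i and a_i⁻¹ leaves the scalar β(a_i⁻¹, a_i⁻¹), which the coefficient
  -- in `shiftMatInv` compensates.
  have hβ : β (a i) (a i)⁻¹ * β ((a i)⁻¹ * 1) (a i)⁻¹ = 1 := by
    rw [← MonoidHom.mul_apply, ← map_mul]; simp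
  rw [mul_smul_comm, twistOp_mul, smul_smul, ← Circle.coe_mul, hβ]
  simp [twistOp_one]

theorem shiftMatInv_mul : shiftMatInv β B a * shiftMat β B a = 1 := by
  rw [shiftMat, shiftMatInv, Matrix.diagonal_mul_diagonal, ← Matrix.diagonal_one]
  congr 1
  ext1 i
  have hβ : β (a i) (a i)⁻¹ * β ((a i)⁻¹⁻¹ * 1) (a i) = 1 := by
    rw [inv_inv, mul_one, ← map_mul]; simp
  rw [smul_mul_assoc, twistOp_mul, smul_smul, ← Circle.coe_mul, hβ]
  simp [twistOp_one]

theorem charMat_mul_inv : charMat β B a * charMat β B (fun i => (a i)⁻¹) = 1 := by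
  rw [charMat, charMat, Matrix.diagonal_mul_diagonal, ← Matrix.diagonal_one]
  congr 1
  ext1 i
  rw [twistOp_mul]
  simp [twistOp_one]

theorem charMat_inv_mul : charMat β B (fun i => (a i)⁻¹) * charMat β B a = 1 := by
  have h := charMat_mul_inv β (B := B) fun i => (a i)⁻¹
  simpa only [inv_inv] using h

/-- The degree (a_i, a_j) is split as (a_i, 1)(1, 1)(1, a_j). In this order the scalars are values
β(·, 1) = 1, so the operator matrix is V between two invertible diagonal matrices. -/
theorem twistOpMat_eq (V : Matrix n n B) : twistOpMat β a V =
    shiftMat β B a * V.map (leftOp β) * charMat β B a := by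
  ext1 i j
  rw [shiftMat, charMat, Matrix.mul_diagonal, Matrix.diagonal_mul, Matrix.map_apply, leftOp_apply,
    twistOp_mul, smul_mul_assoc, twistOp_mul]
  simp [twistOpMat]

variable [StarRing B] [StarModule ℂ B]

/-- The scalar β(a_i⁻¹a_j, a_i) in `twistedBar` is the one that makes the operator version of the
conjugate factor through V* and the inverses of the diagonal matrices in `twistOpMat_eq`. -/
theorem transpose_twistOpMat_twistedBar (V : Matrix n n B) :
    (twistOpMat β (fun i => (a i)⁻¹) (twistedBar β a V)).transpose =
      charMat β B (fun i => (a i)⁻¹) * (star V).map (leftOp β) * shiftMatInv β B a := by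
  ext1 i j
  have hβ : β (a j) (a j)⁻¹ * β (a i)⁻¹ (a j)⁻¹ = β ((a j)⁻¹ * a i) (a j) := by
    apply Additive.ofMul.injective
    simp only [map_mul, map_inv, MonoidHom.mul_apply, MonoidHom.inv_apply, ofMul_mul, ofMul_inv]
    abel
  rw [shiftMatInv, charMat, Matrix.mul_diagonal, Matrix.diagonal_mul, Matrix.map_apply,
    leftOp_apply, twistOp_mul, smul_mul_assoc, mul_smul_comm, twistOp_mul, Matrix.transpose_apply,
    twistOpMat, Matrix.of_apply, twistedBar, Matrix.of_apply, map_smul, ← hβ]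
  simp [Matrix.star_apply, smul_smul]

/-- The twisted conjugation is an involution once the degrees are inverted. So V and its conjugate
play symmetric roles, and the relations for F V̄_Z F⁻¹ follow from the same lemma as those for V. -/
theorem twistedBar_twistedBar (V : Matrix n n B) :
    twistedBar β (fun i => (a i)⁻¹) (twistedBar β a V) = V := by
  ext i j
  have hβ : β ((a i)⁻¹⁻¹ * (a j)⁻¹) (a i)⁻¹ * (β ((a i)⁻¹ * a j) (a i))⁻¹ = 1 := by
    apply Additive.ofMul.injective
    simp only [map_mul, map_inv, MonoidHom.mul_apply, MonoidHom.inv_apply, ofMul_mul, ofMul_inv,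
      ofMul_one]
    abel
  rw [twistedBar, twistedBar, Matrix.of_apply, Matrix.of_apply, star_smul, star_star, smul_smul,
    show star ((β ((a i)⁻¹ * a j) (a i) : Circle) : ℂ) = ((β ((a i)⁻¹ * a j) (a i))⁻¹ : Circle)
      from (Circle.coe_inv_eq_conj _).symm, ← Circle.coe_mul, hβ, Circle.coe_one, one_smul]

omit [StarRing B] [StarModule ℂ B] in
theorem commute_scalarMat_diagonal {c : Matrix n n ℂ} (hc : ∀ i j, a i ≠ a j → c i j = 0)
    (d : Γ → B) : Commute (scalarMat B c) (Matrix.diagonal fun i => d (a i)) := by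
  ext i j
  rw [Matrix.mul_diagonal, Matrix.diagonal_mul, scalarMat, Matrix.map_apply]
  by_cases hij : a i = a j
  · rw [hij, Algebra.commutes]
  · simp [hc i j hij]

/-- The relations between the operators defined by a matrix and by its conjugate. -/
theorem twistOpMat_relations {Q : GL n ℂ} (hQ : ∀ i j, a i ≠ a j → Q.val i j = 0)
    (hQ' : ∀ i j, a i ≠ a j → Q⁻¹.val i j = 0) {V : Matrix n n B}
    (h : V * conjBy Q⁻¹ (star V) = 1 ∧ conjBy Q⁻¹ (star V) * V = 1) :
    twistOpMat β a V * conjBy Q⁻¹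
        (twistOpMat β (fun i => (a i)⁻¹) (twistedBar β a V)).transpose = 1 ∧
      conjBy Q⁻¹ (twistOpMat β (fun i => (a i)⁻¹) (twistedBar β a V)).transpose *
        twistOpMat β a V = 1 := by
  -- Conjugation by Q⁻¹ can be moved onto V*, because Q and Q⁻¹ respect the blocks of equal a_i and
  -- hence commute with the diagonal operator matrices.
  have h1 : conjBy Q⁻¹ (twistOpMat β (fun i => (a i)⁻¹) (twistedBar β a V)).transpose =
      charMat β B (fun i => (a i)⁻¹) * (conjBy Q⁻¹ (star V)).map (leftOp β) *
        shiftMatInv β B a := by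
    have hc1 : Commute (scalarMat (Module.End ℂ (Γ → B)) Q⁻¹.val)
        (charMat β B fun i => (a i)⁻¹) :=
      commute_scalarMat_diagonal a hQ' fun b => twistOp β 1 b⁻¹ 1
    have hc2 : Commute (scalarMat (Module.End ℂ (Γ → B)) Q.val) (shiftMatInv β B a) :=
      commute_scalarMat_diagonal a hQ fun b => (β b b⁻¹ : ℂ) • twistOp β b⁻¹ 1 1
    rw [transpose_twistOpMat_twistedBar, map_conjBy, conjBy, conjBy, inv_inv]
    simp only [← mul_assoc]
    rw [hc1.eq]
    simp only [mul_assoc]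
    rw [hc2.eq]
  have hmap : ∀ M N : Matrix n n B, M * N = 1 →
      M.map (leftOp β (B := B)) * N.map (leftOp β) = 1 := fun M N hMN => by
    rw [← Matrix.map_mul, hMN, Matrix.map_one _ (map_zero _) (map_one _)]
  rw [h1, twistOpMat_eq]
  constructor
  · calc _ = shiftMat β B a * (V.map (leftOp β) * (charMat β B a *
          charMat β B (fun i => (a i)⁻¹)) * (conjBy Q⁻¹ (star V)).map (leftOp β)) *
          shiftMatInv β B a := by simp only [mul_assoc]
      _ = 1 := by rw [charMat_mul_inv, mul_one, hmap _ _ h.1, mul_one, shiftMat_mul_inv]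
  · calc _ = charMat β B (fun i => (a i)⁻¹) * ((conjBy Q⁻¹ (star V)).map (leftOp β) *
          (shiftMatInv β B a * shiftMat β B a) * V.map (leftOp β)) * charMat β B a := by
          simp only [mul_assoc]
      _ = 1 := by rw [shiftMatInv_mul, mul_one, hmap _ _ h.2, mul_one, charMat_inv_mul]

end Operators

/-! ### The transmutation of the free unitary quantum group -/

namespace FreeUnitary

variable {Γ : Type*} [CommGroup Γ] {n : Type*} [Fintype n] [DecidableEq n] {F : GL n ℂ}
  (π : HopfStarHom (FreeUnitary F) (MonoidAlgebra ℂ Γ)) (β : Γ →* Γ →* Circle) {g : GL n ℂ}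
  {a : n → Γ}

open Transmutation in
-- The scalar β(a_i⁻¹a_j, a_i) in the twisted conjugate is inverse to the scalar β(a_i⁻¹a_j, a_i⁻¹)
-- in the transmuted involution, so the original adjoint remains.
theorem twistedBar_map_of (hg : Diagonalizes g a ((U F).map π.hom)) :
    twistedBar β a ((conjBy g⁻¹ (U F)).map (of π β)) =
      (barMat (conjBy g⁻¹ (U F))).map (of π β) := by
  have hmem := conjBy_inv_mem_bigraded π isCorepMatrix_U hg
  ext i j
  have hβ : β ((a i)⁻¹ * a j) (a i) * β ((a i)⁻¹ * a j) (a i)⁻¹ = 1 := by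
    rw [← map_mul, mul_inv_cancel, map_one]
  rw [twistedBar, Matrix.of_apply, Matrix.map_apply, star_of_of_mem π β (hmem i j), smul_smul,
    ← Circle.coe_mul, hβ, Circle.coe_one, one_smul]
  rfl

theorem map_of_conjBy (h : GL n ℂ) (V : Matrix n n (FreeUnitary F)) :
    (conjBy h V).map (Transmutation.of π β) = conjBy h (V.map (Transmutation.of π β)) :=
  conjBy_map_linear (Transmutation.of π β).toLinearMap h V

/-- In the transmutation, `Ū_Z` is the conjugate of `U` in the original algebra. -/
theorem barZ_map_of (hg : Diagonalizes g a ((U F).map π.hom)) :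
    barZ (bicharForm β) ((U F).map π.hom) ((U F).map (Transmutation.of π β)) =
      (barMat (U F)).map (Transmutation.of π β) := by
  rw [barZ_eq β hg, ← map_of_conjBy, twistedBar_map_of π β hg, ← map_of_conjBy, ← barMat_conjBy,
    conjBy_conjBy_inv]

theorem map_hom_conjBy_barMat (h : GL n ℂ) :
    (conjBy h (barMat (U F))).map π.hom = conjBy h (barMat ((U F).map π.hom)) := by
  have h1 : (barMat (U F)).map π.hom = barMat ((U F).map π.hom) := by
    ext1 i j
    exact π.map_star _
  rw [← h1]
  exact map_conjBy (π.hom : FreeUnitary F →ₐ[ℂ] MonoidAlgebra ℂ Γ) h _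

/-- The transmutation is generated by the entries of `U`. -/
theorem adjoin_map_of_eq_top (hg : Diagonalizes g a ((U F).map π.hom)) :
    StarAlgebra.adjoin ℂ {x | ∃ i j, x = (U F).map (Transmutation.of π β) i j} = ⊤ := by
  set S := StarAlgebra.adjoin ℂ {x | ∃ i j, x = (U F).map (Transmutation.of π β) i j} with hS
  have hmem := conjBy_inv_mem_bigraded π isCorepMatrix_U hg
  -- Transmuted products and adjoints of homogeneous elements differ from the original ones by
  -- unimodular scalars, so membership in S is insensitive to the difference.
  have hsmul : ∀ (z : Circle) (x : Transmutation π β), (z : ℂ) • x ∈ S → x ∈ S := fun z x hx => by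
    have h := S.smul_mem hx ((z⁻¹ : Circle) : ℂ)
    rwa [smul_smul, ← Circle.coe_mul, inv_mul_cancel, Circle.coe_one, one_smul] at h
  have hu : ∀ i j, Transmutation.of π β (conjBy g⁻¹ (U F) i j) ∈ S := fun i j => by
    have h := conjBy_apply_mem (Subalgebra.toSubmodule S.toSubalgebra) g⁻¹
      (V := (U F).map (Transmutation.of π β))
      (fun i j => StarAlgebra.subset_adjoin ℂ _ ⟨i, j, rfl⟩) i j
    rw [← map_of_conjBy] at h
    exact h
  have key : ∀ b c, ∀ x ∈ bigraded π b c, Transmutation.of π β x ∈ S := fun b c x hx => by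
    refine homogeneous_induction (P := fun b c x => Transmutation.of π β x ∈ S) hg
      ?_ ?_ ?_ ?_ ?_ ?_ ?_ hx
    · intro _ _; rw [map_zero]; exact zero_mem S
    · intro _ _ x y hx hy; rw [map_add]; exact add_mem hx hy
    · intro _ _ c x hx; rw [map_smul]; exact S.smul_mem hx c
    · exact one_mem S
    · intro a b c d x hx y hy hxS hyS
      refine hsmul (β (a⁻¹ * b) c⁻¹) _ ?_
      rw [← Transmutation.of_mul_of_of_mem π β hx hy]
      exact mul_mem hxS hyS
    · exact hu
    · intro i j
      refine hsmul (β ((a i)⁻¹ * a j) (a i)⁻¹) _ ?_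
      rw [← Transmutation.star_of_of_mem π β (hmem i j)]
      exact star_mem (hu i j)
  refine StarSubalgebra.eq_top_iff.2 fun x => ?_
  induction x using Transmutation.induction with
  | h0 => exact zero_mem S
  | ha x y hx hy => exact add_mem hx hy
  | hh b c x hx => exact key b c x hx

theorem isBraidedCMQG (hZ : (U F).map π.hom ∈ unitary (Matrix n n (MonoidAlgebra ℂ Γ)))
    (hFZ : conjBy F (barMat ((U F).map π.hom)) ∈ unitary (Matrix n n (MonoidAlgebra ℂ Γ))) :
    IsBraidedCMQG β ((U F).map π.hom) (Transmutation.coact π β) (Transmutation.antipode π β)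
      ((U F).map (Transmutation.of π β)) := by
  obtain ⟨g, a, hg⟩ := exists_diagonalizes (isCorepMatrix_U.map_hom π) hZ
  have hΔ := comul_mem_comulSpan π hg
  have hS := antipode_mem_bigraded π hg hFZ
  have hδ : ∀ a b, ∀ x ∈ bigraded π a b, Transmutation.coact π β (Transmutation.of π β x) =
      Transmutation.of π β x ⊗ₜ chi (a⁻¹ * b) :=
    fun a b x hx => Transmutation.coact_of_mem π β hΔ hS hx
  have hbar : IsCorepMatrix (barMat (U F)) := isCorepMatrix_U.barMat
  have hb : (barMat (U F)).map π.hom = barMat ((U F).map π.hom) := by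
    have h := map_hom_conjBy_barMat π 1
    rwa [one_conjBy, one_conjBy] at h
  have hFc := hbar.conjBy F
  rw [← map_hom_conjBy_barMat] at hFZ
  -- The unitary corepresentation F Z̄ F⁻¹ gets its own orthonormal eigenbasis g'; the basis ḡ would
  -- diagonalize Z̄ instead. The matrix F itself witnesses unitarizability of the conjugate
  -- comodule.
  obtain ⟨g', a', hg'⟩ := exists_diagonalizes (hFc.map_hom π) hFZ
  refine ⟨Transmutation.isBraidedHopfStar π β hΔ hS, adjoin_map_of_eq_top π β hg,
    Transmutation.isUnitaryPair π β hδ isCorepMatrix_U U_mem hg, ?_, F, ?_⟩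
  · rw [barZ_map_of π β hg, ← hb]
    exact Transmutation.isComodulePair π β hbar
  · rw [barZ_map_of π β hg, ← map_of_conjBy, ← map_hom_conjBy_barMat]
    exact Transmutation.isUnitaryPair π β hδ hFc conj_mem hg'

theorem map_of_mem_unitary (hZ : (U F).map π.hom ∈ unitary (Matrix n n (MonoidAlgebra ℂ Γ))) :
    (U F).map (Transmutation.of π β) ∈ unitary (Matrix n n (Transmutation π β)) := by
  obtain ⟨g, a, hg⟩ := exists_diagonalizes (isCorepMatrix_U.map_hom π) hZ
  exact Transmutation.map_of_mem_unitary π β isCorepMatrix_U U_mem hg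

theorem conjBy_barZ_map_of_mem_unitary
    (hZ : (U F).map π.hom ∈ unitary (Matrix n n (MonoidAlgebra ℂ Γ)))
    (hFZ : conjBy F (barMat ((U F).map π.hom)) ∈ unitary (Matrix n n (MonoidAlgebra ℂ Γ))) :
    conjBy F (barZ (bicharForm β) ((U F).map π.hom) ((U F).map (Transmutation.of π β))) ∈
      unitary (Matrix n n (Transmutation π β)) := by
  obtain ⟨g, a, hg⟩ := exists_diagonalizes (isCorepMatrix_U.map_hom π) hZ
  have hFc := (isCorepMatrix_U (F := F)).barMat.conjBy F
  rw [← map_hom_conjBy_barMat] at hFZ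
  obtain ⟨g', a', hg'⟩ := exists_diagonalizes (hFc.map_hom π) hFZ
  rw [barZ_map_of π β hg, ← map_of_conjBy]
  exact Transmutation.map_of_mem_unitary π β hFc conj_mem hg'

/-! ### Homomorphisms from the transmutation to an arbitrary star-algebra -/

section Universal

variable {B : Type*} [Ring B] [Algebra ℂ B] [StarRing B] [StarModule ℂ B] {V : Matrix n n B}

/-- A representation of `ℂ[U_F⁺]` by operators, defined by a matrix over `B` that satisfies the
relations of the transmutation. -/
theorem exists_algHom_twistOp (hg : Diagonalizes g a ((U F).map π.hom))
    (hFZ : conjBy F (barMat ((U F).map π.hom)) ∈ unitary (Matrix n n (MonoidAlgebra ℂ Γ)))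
    (hV : V ∈ unitary (Matrix n n B))
    (hFV : conjBy F (barZ (bicharForm β) ((U F).map π.hom) V) ∈ unitary (Matrix n n B)) :
    ∃ φ : FreeUnitary F →ₐ[ℂ] Module.End ℂ (Γ → B),
      (∀ i j, φ (conjBy g⁻¹ (U F) i j) = twistOp β (a i) (a j) (conjBy g⁻¹ V i j)) ∧
      ∀ i j, φ (star (conjBy g⁻¹ (U F) i j)) =
        twistOp β (a i)⁻¹ (a j)⁻¹ (twistedBar β a (conjBy g⁻¹ V) i j) := by
  set V' := conjBy g⁻¹ V with hV'
  set W' := twistedBar β a V' with hW'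
  set G := F * barGL g with hG
  set X := twistOpMat β a V' with hX
  set Y := twistOpMat β (fun i => (a i)⁻¹) W' with hY
  have hVu : V' ∈ unitary (Matrix n n B) := conjBy_inv_mem_unitary hg.star_eq hV
  have hWu : conjBy G W' ∈ unitary (Matrix n n B) := by
    rw [barZ_eq β hg, conjBy_conjBy] at hFV
    exact hFV
  -- Taking the matrix parameter to be 1 turns unitarity of V' into the statement that X and the
  -- transpose of Y are inverse to each other.
  have hrel1 := twistOpMat_relations β a (Q := 1) (V := V')
    (fun i j hij => Matrix.one_apply_ne fun h => hij (congrArg a h))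
    (fun i j hij => by rw [inv_one]; exact Matrix.one_apply_ne fun h => hij (congrArg a h))
    (by rw [inv_one, one_conjBy]; exact ⟨hVu.2, hVu.1⟩)
  rw [inv_one, one_conjBy] at hrel1
  have hblock := fun i j (hij : (a i)⁻¹ ≠ (a j)⁻¹) =>
    blockDiagonal_of_conjBy_mem_unitary hg hFZ i j fun h => hij (congrArg _ h)
  -- The same lemma is applied to W' with inverted degrees and parameter G*G. Conjugating W'
  -- twistedly returns V', so the outcome relates Y to the transpose of X.
  have hrel2 := twistOpMat_relations β (fun i => (a i)⁻¹) (fun i j hij => (hblock i j hij).1)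
    (fun i j hij => (hblock i j hij).2) (mul_conjBy_star_of_mem_unitary hWu)
  simp only [hW', twistedBar_twistedBar, inv_inv] at hrel2
  rw [← hW', ← hX, ← hY, ← hG] at hrel2
  have hF1 : ∀ M : Matrix n n (Module.End ℂ (Γ → B)),
      scalarMat _ (star F⁻¹.val) * M * scalarMat _ (star F.val) = conjBy (star F)⁻¹ M :=
    fun M => rfl
  -- Both sides are (G*)⁻¹, because G = Fḡ with ḡ unitary.
  have hGF : (star F)⁻¹ * barGL g = G * (star G * G)⁻¹ := by
    rw [mul_inv_rev, mul_inv_cancel_left, hG, star_mul, star_barGL hg.star_eq, mul_inv_rev,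
      inv_inv]
  have h1 : conjBy g X * (conjBy (barGL g) Y).transpose = 1 := by
    rw [transpose_conjBy_barGL hg.star_eq, conjBy_mul, hrel1.1, conjBy_one]
  have h2 : (conjBy (barGL g) Y).transpose * conjBy g X = 1 := by
    rw [transpose_conjBy_barGL hg.star_eq, conjBy_mul, hrel1.2, conjBy_one]
  have h3 : conjBy F (conjBy (barGL g) Y) * (scalarMat _ (star F⁻¹.val) *
      (conjBy g X).transpose * scalarMat _ (star F.val)) = 1 := by
    rw [hF1, transpose_conjBy hg.star_eq, conjBy_conjBy F, ← hG, conjBy_conjBy, hGF,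
      ← conjBy_conjBy G, conjBy_mul, hrel2.1, conjBy_one]
  have h4 : scalarMat _ (star F⁻¹.val) * (conjBy g X).transpose * scalarMat _ (star F.val) *
      conjBy F (conjBy (barGL g) Y) = 1 := by
    rw [hF1, transpose_conjBy hg.star_eq, conjBy_conjBy F, ← hG, conjBy_conjBy, hGF,
      ← conjBy_conjBy G, conjBy_mul, hrel2.2, conjBy_one]
  refine ⟨liftAlg (conjBy g X) (conjBy (barGL g) Y) h1 h2 h3 h4, fun i j => ?_, fun i j => ?_⟩
  · have h : (U F).map (liftAlg (conjBy g X) (conjBy (barGL g) Y) h1 h2 h3 h4) = conjBy g X := by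
      ext1 i j
      exact liftAlg_U _ _ h1 h2 h3 h4 i j
    have h' := map_conjBy (liftAlg (conjBy g X) (conjBy (barGL g) Y) h1 h2 h3 h4) g⁻¹ (U F)
    rw [h, conjBy_inv_conjBy] at h'
    exact congrFun (congrFun h' i) j
  · have h : (barMat (U F)).map (liftAlg (conjBy g X) (conjBy (barGL g) Y) h1 h2 h3 h4) =
        conjBy (barGL g) Y := by
      ext1 i j
      exact liftAlg_star_U _ _ h1 h2 h3 h4 i j
    have h' := map_conjBy (liftAlg (conjBy g X) (conjBy (barGL g) Y) h1 h2 h3 h4) (barGL g)⁻¹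
      (barMat (U F))
    have hb : conjBy (barGL g)⁻¹ (barMat (U F)) = barMat (conjBy g⁻¹ (U F)) := by
      rw [barMat_conjBy]; rfl
    rw [h, conjBy_inv_conjBy, hb] at h'
    exact congrFun (congrFun h' i) j

/-- The linear map `ℂ[U_F⁺] → B` extracted from a representation by operators. -/
def untwist (φ : FreeUnitary F →ₐ[ℂ] Module.End ℂ (Γ → B)) : Transmutation π β →ₗ[ℂ] B :=
  ((Finsupp.lsum ℂ fun p : Γ × Γ => (β (p.1⁻¹ * p.2) p.1 : ℂ) •
    (LinearMap.proj (R := ℂ) (φ := fun _ : Γ => B) 1 ∘ₗ LinearMap.applyₗ (R := ℂ) (1 : Γ → B) ∘ₗ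
      φ.toLinearMap)) ∘ₗ components π) ∘ₗ (Transmutation.of π β).symm.toLinearMap

/-- The degree must be read off in H through `components`: the operator alone need not determine it,
for instance when β is trivial. Once the degree is known, `twistOp_one_one` returns y. -/
theorem untwist_of {φ : FreeUnitary F →ₐ[ℂ] Module.End ℂ (Γ → B)} {b c : Γ} {x : FreeUnitary F}
    (hx : x ∈ bigraded π b c) {y : B} (hy : φ x = twistOp β b c y) :
    untwist π β φ (Transmutation.of π β x) = y := by
  rw [← twistOp_one_one β b c y, ← hy, untwist, LinearMap.comp_apply, LinearMap.comp_apply,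
    LinearEquiv.coe_coe, LinearEquiv.symm_apply_apply, components_of_mem π hx,
    Finsupp.lsum_single]
  rfl

/-- The existence part of the universal property of the transmutation. -/
theorem exists_starAlgHom (hZ : (U F).map π.hom ∈ unitary (Matrix n n (MonoidAlgebra ℂ Γ)))
    (hFZ : conjBy F (barMat ((U F).map π.hom)) ∈ unitary (Matrix n n (MonoidAlgebra ℂ Γ)))
    (hV : V ∈ unitary (Matrix n n B))
    (hFV : conjBy F (barZ (bicharForm β) ((U F).map π.hom) V) ∈ unitary (Matrix n n B)) :
    ∃ φ : Transmutation π β →⋆ₐ[ℂ] B, ∀ i j, φ ((U F).map (Transmutation.of π β) i j) = V i j := by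
  obtain ⟨g, a, hg⟩ := exists_diagonalizes (isCorepMatrix_U.map_hom π) hZ
  have hmem := conjBy_inv_mem_bigraded π isCorepMatrix_U hg
  obtain ⟨φ, hφ, hφs⟩ := exists_algHom_twistOp π β hg hFZ hV hFV
  -- Every element of degree (b, c) acts as `twistOp` of the same degree applied to some y ∈ B.
  -- Generators have this form, and it is preserved by products and linear combinations.
  have hex : ∀ b c, ∀ x ∈ bigraded π b c, ∃ y, φ x = twistOp β b c y := fun b c x hx => by
    refine homogeneous_induction (P := fun b c x => ∃ y, φ x = twistOp β b c y) hg
      ?_ ?_ ?_ ?_ ?_ (fun i j => ⟨_, hφ i j⟩) (fun i j => ⟨_, hφs i j⟩) hx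
    · exact fun _ _ => ⟨0, by rw [map_zero, map_zero]⟩
    · rintro _ _ x x' ⟨y, hy⟩ ⟨y', hy'⟩
      exact ⟨y + y', by rw [map_add, map_add, hy, hy']⟩
    · rintro _ _ k x ⟨y, hy⟩
      exact ⟨k • y, by rw [map_smul, map_smul, hy]⟩
    · exact ⟨1, by rw [map_one, twistOp_one]⟩
    · rintro b c d e x _ x' _ ⟨y, hy⟩ ⟨y', hy'⟩
      exact ⟨(β (b⁻¹ * c) d : ℂ) • (y * y'), by rw [map_mul, hy, hy', twistOp_mul, map_smul]⟩
  set ψ := untwist π β φ with hψ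
  have hone : ψ 1 = 1 := by
    rw [← Transmutation.of_one]
    exact untwist_of π β (one_mem_bigraded π) (by rw [map_one, twistOp_one])
  have hmul : ∀ x y, ψ (x * y) = ψ x * ψ y := fun x y => by
    induction x using Transmutation.induction with
    | h0 => simp only [map_zero, zero_mul]
    | ha x x' hx hx' => simp only [map_add, add_mul, hx, hx']
    | hh b c x hx =>
    induction y using Transmutation.induction with
    | h0 => simp only [map_zero, mul_zero]
    | ha y y' hy hy' => simp only [map_add, mul_add, hy, hy']
    | hh d e y hy =>
    obtain ⟨z, hz⟩ := hex b c x hx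
    obtain ⟨z', hz'⟩ := hex d e y hy
    have hzz : φ (x * y) = twistOp β (b * d) (c * e) ((β (b⁻¹ * c) d : ℂ) • (z * z')) := by
      rw [map_mul, hz, hz', twistOp_mul, map_smul]
    -- The scalar of the transmuted product and the scalar from composing operators are inverse, so
    -- x ↦ y is multiplicative on H_β.
    have hβ : β (b⁻¹ * c) d⁻¹ * β (b⁻¹ * c) d = 1 := by
      rw [← map_mul, inv_mul_cancel, map_one]
    rw [Transmutation.of_mul_of_of_mem π β hx hy, map_smul,
      untwist_of π β (mul_mem_bigraded π hx hy) hzz, untwist_of π β hx hz, untwist_of π β hy hz',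
      smul_smul, ← Circle.coe_mul, hβ, Circle.coe_one, one_smul]
  have hU' : ∀ i j, ψ (Transmutation.of π β (conjBy g⁻¹ (U F) i j)) = conjBy g⁻¹ V i j :=
    fun i j => untwist_of π β (hmem i j) (hφ i j)
  have hUs' : ∀ i j, ψ (star (Transmutation.of π β (conjBy g⁻¹ (U F) i j))) =
      star (conjBy g⁻¹ V i j) := fun i j => by
    have hβ : β ((a i)⁻¹ * a j) (a i)⁻¹ * β ((a i)⁻¹ * a j) (a i) = 1 := by
      rw [← map_mul, inv_mul_cancel, map_one]
    rw [Transmutation.star_of_of_mem π β (hmem i j), map_smul,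
      untwist_of π β (star_mem_bigraded π (hmem i j)) (hφs i j), twistedBar, Matrix.of_apply,
      smul_smul, ← Circle.coe_mul, hβ, Circle.coe_one, one_smul]
  have hUg : (U F).map (Transmutation.of π β) =
      conjBy g ((conjBy g⁻¹ (U F)).map (Transmutation.of π β)) := by
    rw [← map_of_conjBy, conjBy_conjBy_inv]
  have hVg : V = conjBy g (conjBy g⁻¹ V) := (conjBy_conjBy_inv g V).symm
  have hU : ∀ i j, ψ ((U F).map (Transmutation.of π β) i j) = V i j := fun i j => by
    rw [hUg, hVg]
    simp only [conjBy_apply g, map_sum, map_smul, Matrix.map_apply, hU']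
  have hUs : ∀ i j, ψ (star ((U F).map (Transmutation.of π β) i j)) = star (V i j) :=
    fun i j => by
    rw [hUg, hVg]
    simp only [conjBy_apply g, star_sum, star_smul, map_sum, map_smul, Matrix.map_apply, hUs']
  -- Compatibility with the involution is needed only on the generators u_ij, since ψ is a unital
  -- homomorphism and these generate H_β as a star-algebra.
  have hstar : ∀ x, ψ (star x) = star (ψ x) := fun x => by
    have hx : x ∈ StarAlgebra.adjoin ℂ
        {x | ∃ i j, x = (U F).map (Transmutation.of π β) i j} := by
      rw [adjoin_map_of_eq_top π β hg]; trivial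
    induction hx using StarAlgebra.adjoin_induction with
    | mem x hx =>
      obtain ⟨i, j, rfl⟩ := hx
      rw [hU, hUs]
    | algebraMap r =>
      rw [Algebra.algebraMap_eq_smul_one, star_smul, star_one, map_smul, map_smul, star_smul, hone,
        star_one]
    | add x y _ _ hx hy => rw [star_add, map_add, map_add, star_add, hx, hy]
    | mul x y _ _ hx hy => rw [star_mul, hmul, hmul, star_mul, hx, hy]
    | star x _ hx => rw [star_star, hx, star_star]
  exact ⟨{ AlgHom.ofLinearMap ψ hone hmul with map_star' := hstar }, hU⟩

/-- The universal property of the transmutation. -/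
theorem existsUnique_starAlgHom
    (hZ : (U F).map π.hom ∈ unitary (Matrix n n (MonoidAlgebra ℂ Γ)))
    (hFZ : conjBy F (barMat ((U F).map π.hom)) ∈ unitary (Matrix n n (MonoidAlgebra ℂ Γ)))
    (hV : V ∈ unitary (Matrix n n B))
    (hFV : conjBy F (barZ (bicharForm β) ((U F).map π.hom) V) ∈ unitary (Matrix n n B)) :
    ∃! φ : Transmutation π β →⋆ₐ[ℂ] B,
      ∀ i j, φ ((U F).map (Transmutation.of π β) i j) = V i j := by
  obtain ⟨φ, hφ⟩ := exists_starAlgHom π β hZ hFZ hV hFV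
  obtain ⟨g, a, hg⟩ := exists_diagonalizes (isCorepMatrix_U.map_hom π) hZ
  refine ⟨φ, hφ, fun φ' hφ' => ?_⟩
  refine StarAlgHom.ext_of_adjoin_eq_top (adjoin_map_of_eq_top π β hg) ?_
  rintro _ ⟨i, j, rfl⟩
  rw [hφ', hφ]

end Universal

end FreeUnitary

end

theorem mainTheorem11 {m : ℕ} (hm : 2 ≤ m) (F : GL (Fin m) ℂ)
    (hF : (star F.val * F.val).trace = ((star F.val * F.val)⁻¹).trace)
    (T : Type*) [CommGroup T] [TopologicalSpace T] [IsTopologicalGroup T] [CompactSpace T]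
    [T2Space T] (Z : Matrix (Fin m) (Fin m) (MonoidAlgebra ℂ (PontryaginDual T)))
    (hc : IsCorepMatrix Z)
    (hZ : Z ∈ unitary (Matrix (Fin m) (Fin m) (MonoidAlgebra ℂ (PontryaginDual T))))
    (hFZ : conjBy F (barMat Z) ∈
      unitary (Matrix (Fin m) (Fin m) (MonoidAlgebra ℂ (PontryaginDual T))))
    (β : PontryaginDual T →* PontryaginDual T →* Circle) :
    IsBraidedCMQG β Z (Transmutation.coact (FreeUnitary.toHopf (F := F) Z hc hZ hFZ) β)
        (Transmutation.antipode (FreeUnitary.toHopf (F := F) Z hc hZ hFZ) β)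
        (BraidedFreeUnitary.U F Z hc hZ hFZ β) ∧
      BraidedFreeUnitary.U F Z hc hZ hFZ β ∈
        unitary (Matrix (Fin m) (Fin m) (BraidedFreeUnitary F Z hc hZ hFZ β)) ∧
      conjBy F (barZ (bicharForm β) Z (BraidedFreeUnitary.U F Z hc hZ hFZ β)) ∈
        unitary (Matrix (Fin m) (Fin m) (BraidedFreeUnitary F Z hc hZ hFZ β)) ∧
      ∀ (B : Type*) [Ring B] [Algebra ℂ B] [StarRing B] [StarModule ℂ B]
        (V : Matrix (Fin m) (Fin m) B), V ∈ unitary (Matrix (Fin m) (Fin m) B) →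
          conjBy F (barZ (bicharForm β) Z V) ∈ unitary (Matrix (Fin m) (Fin m) B) →
            ∃! φ : BraidedFreeUnitary F Z hc hZ hFZ β →⋆ₐ[ℂ] B,
              ∀ i j, φ (BraidedFreeUnitary.U F Z hc hZ hFZ β i j) = V i j := by
  -- The preceding results hold for any π, with π(U) in the role of Z. The homomorphism built from Z
  -- satisfies π(U) = Z.
  have hπ : (FreeUnitary.U F).map (FreeUnitary.toHopf (F := F) Z hc hZ hFZ).hom = Z :=
    Matrix.ext (FreeUnitary.toHopf_U Z hc hZ hFZ)
  have hZ' := hZ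
  have hFZ' := hFZ
  rw [← hπ] at hZ' hFZ'
  have h1 := FreeUnitary.isBraidedCMQG _ β hZ' hFZ'
  have h2 := FreeUnitary.conjBy_barZ_map_of_mem_unitary _ β hZ' hFZ'
  rw [hπ] at h1 h2
  refine ⟨h1, FreeUnitary.map_of_mem_unitary _ β hZ', h2, fun B _ _ _ _ V hV hFV => ?_⟩
  refine FreeUnitary.existsUnique_starAlgHom _ β hZ' hFZ' hV ?_
  rw [hπ]
  exact hFV
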